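/- An input of the Rooted Subset $(\ell,k)$-Edge-Connectivity Augmentation problem consists of a directed graph $G=(V\cup\{r\},E)$ (parallel edges allowed) with a root $r\notin V$ and nonnegative rational edge costs, a non-empty set $T\subseteq V$ of terminals, and integers $0\le \ell\le k$, such that the subgraph $G_0$ formed by all edges of cost zero contains $\ell$ pairwise edge-disjoint directed paths from $r$ to $t$ for every $t\in T$. A feasible solution is an edge set $J\subseteq E$ that contains $k$ pairwise edge-disjoint directed paths from $r$ to $t$ for every $t\in T$; the goal is to minimize its cost, the sum of the costs of its edges. For $A\subseteq V$ let $d_{G_0}(A)$ be the number of edges of $G_0$ that enter $A$, and let $f(A)=\max\{k-d_{G_0}(A),0\}$ if $A\cap T\neq\emptyset$ and $f(A)=0$ otherwise. Call the set of edges of positive cost quasi-bipartite if each of these edges has an end in $T$, or there is no $A\subseteq V$ with $f(A)>0$ that contains both ends of the edge. (In particular, this holds if every edge of positive cost has an end in $T\cup\{r\}$.) **Corollary.** Rooted Subset $(\ell,k)$-Edge-Connectivity Augmentation admits approximation ratio $2H(k-\ell)\cdot(1+\ln|T|)$ on the inputs whose set of positive cost edges is quasi-bipartite, where $H(j)=\sum_{i=1}^{j}1/i$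 (and $H(0)=0$). That is, there is an algorithm that runs in time polynomial in the bit length of the input on all these inputs and that, whenever a feasible solution exists, outputs a feasible solution whose cost is at most $2H(k-\ell)(1+\ln|T|)$ times the minimum cost of a feasible solution. -/

import Mathlib

/-! ## Model of computation

A first-order structured programming language over binary trees whose leaves are natural numbers
(S-expressions), with sequencing, branching and `while` loops, under the logarithmic cost
criterion: every primitive step costs the total bit length of the data it reads and writes.  With
this cost measure the language and (multi-tape) Turing machines simulate each other with
polynomial overhead. -/

/-- Data: binary trees with natural numbers at the leaves. -/
inductive Data : Type
  | num (n : ℕ) : Data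
  | cons (a b : Data) : Data

namespace Data

/-- The bit length of a piece of data; numbers are written in binary. -/
def size : Data → ℕ
  | num n => Nat.size n + 1
  | cons a b => a.size + b.size + 1

/-- A list is a right-nested sequence of `cons` cells that ends in `num 0`. -/
def ofList : List Data → Data
  | [] => num 0
  | a :: l => cons a (ofList l)

end Data

/-- The primitive operations. -/
inductive Prim : Type
  | skip
  | const (n : ℕ)
  | fst
  | snd
  | isNum
  | add
  | sub
  | mul
  | div

namespace Prim

/-- An arithmetic operation on a pair of numbers (`0` on data of any other shape). -/
def arith (op : ℕ → ℕ → ℕ) : Data → Data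
  | .cons (.num a) (.num b) => .num (op a b)
  | _ => .num 0

/-- What the primitive operations compute.  Subtraction is truncated at `0`, `div` is division with
remainder dropped; a destructor applied to a number returns `0`. -/
def eval : Prim → Data → Data
  | skip, x => x
  | const n, _ => .num n
  | fst, .cons a _ => a
  | fst, .num _ => .num 0
  | snd, .cons _ b => b
  | snd, .num _ => .num 0
  | isNum, .num _ => .num 1
  | isNum, .cons _ _ => .num 0
  | add, x => arith (· + ·) x
  | sub, x => arith (· - ·) x
  | mul, x => arith (· * ·) x
  | div, x => arith (· / ·) x

end Prim

/-- Programs. -/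
inductive Prog : Type
  | prim (p : Prim) : Prog
  | pair (f g : Prog) : Prog
  | seq (f g : Prog) : Prog
  | cond (c f g : Prog) : Prog
  | loop (c f : Prog) : Prog

/-- `Prog.Run p x y t`: the program `p`, started on input `x`, halts with output `y` after `t` steps.
* `pair f g` runs `f` and `g` on the input and pairs their results;
* `seq f g` runs `f` and then `g` on the result;
* `cond c f g` runs the test `c`; then it runs `f` on the input if the result of the test is
  not the number `0`, and `g` otherwise;
* `loop c f` replaces `x` by the result of `f` on `x` while the result of the test `c` on `x` is
  not the number `0`.
A primitive operation costs one more than the bit length of its input and its output. -/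
inductive Prog.Run : Prog → Data → Data → ℕ → Prop
  | prim (p : Prim) (x : Data) :
      Prog.Run (.prim p) x (p.eval x) (x.size + (p.eval x).size + 1)
  | pair {f g : Prog} {x y z : Data} {s t : ℕ} :
      Prog.Run f x y s → Prog.Run g x z t →
      Prog.Run (.pair f g) x (.cons y z) (s + t + 1)
  | seq {f g : Prog} {x y z : Data} {s t : ℕ} :
      Prog.Run f x y s → Prog.Run g y z t →
      Prog.Run (.seq f g) x z (s + t + 1)
  | cond_true {c f g : Prog} {x b y : Data} {s t : ℕ} :
      Prog.Run c x b s → b ≠ .num 0 → Prog.Run f x y t →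
      Prog.Run (.cond c f g) x y (s + t + 1)
  | cond_false {c f g : Prog} {x y : Data} {s t : ℕ} :
      Prog.Run c x (.num 0) s → Prog.Run g x y t →
      Prog.Run (.cond c f g) x y (s + t + 1)
  | loop_done {c f : Prog} {x : Data} {s : ℕ} :
      Prog.Run c x (.num 0) s →
      Prog.Run (.loop c f) x x (s + x.size + 1)
  | loop_step {c f : Prog} {x b y z : Data} {s t u : ℕ} :
      Prog.Run c x b s → b ≠ .num 0 → Prog.Run f x y t → Prog.Run (.loop c f) y z u →
      Prog.Run (.loop c f) x z (s + t + u + 1)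

/-! ## The augmentation problem -/

/-- An input of Rooted Subset `(ℓ,k)`-Edge-Connectivity Augmentation: a directed multigraph with node
set `Fin n` and edge set `Fin m` (the edge `e` goes from `tail e` to `head e`), a root, nonnegative
rational edge costs, a set of terminals that are distinct from the root, and the integers `ℓ`, `k`. -/
structure AugInstance : Type where
  n : ℕ
  m : ℕ
  root : Fin n
  tail : Fin m → Fin n
  head : Fin m → Fin n
  cost : Fin m → NNRat
  terminals : Finset (Fin n)
  root_notMem : root ∉ terminals
  ell : ℕ
  k : ℕ

namespace AugInstance

/-- `IsWalk p s t`: the list of edges `p` is a directed walk from `s` to `t`. -/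
inductive IsWalk (G : AugInstance) : List (Fin G.m) → Fin G.n → Fin G.n → Prop
  | nil (s : Fin G.n) : IsWalk G [] s s
  | cons (e : Fin G.m) {p : List (Fin G.m)} {t : Fin G.n} :
      IsWalk G p (G.head e) t → IsWalk G (e :: p) (G.tail e) t

/-- A directed path from `s` to `t`: a walk that repeats no node. -/
def IsPath (G : AugInstance) (p : List (Fin G.m)) (s t : Fin G.n) : Prop :=
  G.IsWalk p s t ∧ (s :: p.map G.head).Nodup

/-- The edge set `J` contains `q` pairwise edge-disjoint directed paths from `s` to `t`. -/
def HasDisjointPaths (G : AugInstance) (J : Finset (Fin G.m)) (q : ℕ) (s t : Fin G.n) : Prop :=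
  ∃ P : Fin q → List (Fin G.m),
    (∀ i, G.IsPath (P i) s t ∧ ∀ e ∈ P i, e ∈ J) ∧
    ∀ i j, i ≠ j → (P i).Disjoint (P j)

/-- The edges of cost zero. -/
def zeroEdges (G : AugInstance) : Finset (Fin G.m) :=
  Finset.univ.filter fun e => G.cost e = 0

/-- The standing requirements on an input: there is a terminal, `ℓ ≤ k`, and the subgraph of
zero-cost edges has `ℓ` edge-disjoint paths from the root to every terminal. -/
def IsValid (G : AugInstance) : Prop :=
  G.terminals.Nonempty ∧ G.ell ≤ G.k ∧
    ∀ t ∈ G.terminals, G.HasDisjointPaths G.zeroEdges G.ell G.root t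

/-- `J` is a feasible solution: it has `k` edge-disjoint paths from the root to every terminal. -/
def Feasible (G : AugInstance) (J : Finset (Fin G.m)) : Prop :=
  ∀ t ∈ G.terminals, G.HasDisjointPaths J G.k G.root t

/-- The cost of an edge set. -/
def totalCost (G : AugInstance) (J : Finset (Fin G.m)) : NNRat :=
  ∑ e ∈ J, G.cost e

/-- The number of edges of `J` that enter the node set `A`. -/
def inDeg (G : AugInstance) (J : Finset (Fin G.m)) (A : Finset (Fin G.n)) : ℕ :=
  (J.filter fun e => G.head e ∈ A ∧ G.tail e ∉ A).card

/-- The set function of the instance: `max {k - d(A), 0}` if `A` contains a terminal, where `d(A)` is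
the number of zero-cost edges that enter `A` (the subtraction is truncated), and `0` otherwise. -/
def demand (G : AugInstance) (A : Finset (Fin G.n)) : ℕ :=
  if (A ∩ G.terminals).Nonempty then G.k - G.inDeg G.zeroEdges A else 0

/-- The set of positive-cost edges is quasi-bipartite: every such edge has an end in the set of
terminals, or it does not belong to (have both its ends in) any set `A` of non-root nodes of
positive demand. -/
def PosEdgesQuasiBipartite (G : AugInstance) : Prop :=
  ∀ e, 0 < G.cost e →
    (G.tail e ∈ G.terminals ∨ G.head e ∈ G.terminals) ∨
    ∀ A : Finset (Fin G.n), G.root ∉ A → 0 < G.demand A →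
      ¬ (G.tail e ∈ A ∧ G.head e ∈ A)

/-- The input as data: the lists of nodes, of terminals and of edges (tail, head, numerator and
denominator of the cost), with the root, `ℓ` and `k`; numbers are in binary. -/
def encode (G : AugInstance) : Data :=
  Data.ofList
    [ Data.ofList ((List.finRange G.n).map fun v => Data.num v),
      Data.num G.root,
      Data.ofList (((List.finRange G.n).filter (· ∈ G.terminals)).map fun v => Data.num v),
      Data.ofList ((List.finRange G.m).map fun e => Data.ofList
        [Data.num (G.tail e), Data.num (G.head e),
          Data.num (G.cost e).num, Data.num (G.cost e).den]),
      Data.num G.ell,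
      Data.num G.k ]

/-- The data `d` is a list of the (indices of the) edges in `J`. -/
def Represents (G : AugInstance) (d : Data) (J : Finset (Fin G.m)) : Prop :=
  ∃ js : List (Fin G.m), js.toFinset = J ∧ d = Data.ofList (js.map fun e => Data.num e)

end AugInstance

/-- The restriction of the augmentation problem to the inputs in the class `C` admits approximation
ratio `ratio`: one program runs in polynomial time on all these inputs and, whenever there is a
feasible solution, outputs one whose cost is at most `ratio` times that of any feasible solution. -/
def AdmitsApproxRatio (C : AugInstance → Prop) (ratio : AugInstance → ℝ) : Prop :=
  ∃ (alg : Prog) (q : Polynomial ℕ), ∀ G : AugInstance, C G →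
    ∃ (out : Data) (time : ℕ),
      alg.Run G.encode out time ∧ time ≤ q.eval G.encode.size ∧
      ((∃ J, G.Feasible J) →
        ∃ J, G.Represents out J ∧ G.Feasible J ∧
          ∀ J', G.Feasible J' → (G.totalCost J : ℝ) ≤ ratio G * (G.totalCost J' : ℝ))

open Polynomial

/-! ## Polynomial-time functions -/

/-! The algorithm is greedy. For the current edge set `J`, initially the zero-cost edges, let `v <
k` be the least value of a maximum flow from the root to a terminal. Call a set with a terminal and
without the root tight if exactly `v` edges of `J` enter it. Submodularity makes the intersection of
two tight sets tight if they share a terminal, so distinct minimal tight sets, the cores, share no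
terminal. In the residual graph of a maximum flow to `t`, a set around `t` (without the root) is
tight iff no residual arc enters it (`cut_eq_iff`). Hence cores are found by reachability, and so is
the halo of a core, the largest tight set that contains its representative and no other one.

A spider consists of an edge `e` outside `J` and shortest paths, its legs, from the head of `e` to
cores whose halo `e` enters; residual arcs have length zero. Its density is its cost per leg,
doubled unless the tail of `e` is a terminal in some halo. Each step adds a spider of least density.
Two facts carry the analysis.

Progress (`cores_drop_of_spider`, via `card_cores_drop`): a set that is still tight and contains the
representative of a leg must contain the legs' common head and then the tail of `e`, so it reaches
beyond the halo and contains another core. By quasi-bipartiteness one end of `e` is a terminal, so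
all such sets meet in a terminal and at most one new core contains representatives of legs. So at
least half as many cores vanish as there are legs, and at least as many as legs if the density was
not doubled.

Duality (`dual_bound`): distances to the cores, truncated at a multiple of the least density, are
potentials whose level sets are tight, so `k - v` edges of a feasible solution outside `J` enter
each of them. That no spider is cheaper, together with quasi-bipartiteness, bounds the total
potential drop along an edge by a multiple of its cost (`sum_drop_le`).

Together, a step that removes `g` of `ν` cores costs at most `2 * opt * g / (ν * (k - v))`. At one
level `v` this sums to at most `2 * opt * H(|T|) / (k - v)`, and over the levels from `ℓ` to `k - 1`
to `2 * opt * H(|T|) * H(k - ℓ)` (`GreedyInv.step`, `greedy_spec`); finally `H(|T|) ≤ 1 + ln |T|`.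

For the running time, the algorithm is written with list operations, and a fold along a list is
polynomial as soon as its intermediate states stay polynomially small (`PolyTime.foldl`). -/

theorem Polynomial.eval_nat_mono (q : ℕ[X]) {a b : ℕ} (h : a ≤ b) : q.eval a ≤ q.eval b := by
  rw [eval_eq_sum_range, eval_eq_sum_range]
  gcongr

/-- Writing the output is charged. This makes polynomial time closed under composition: the second
program receives an input of polynomial length. -/
theorem Prog.Run.size_le {p : Prog} {x y : Data} {t : ℕ} (h : p.Run x y t) : y.size ≤ t := by
  induction h with
  | prim p x => omega
  | pair _ _ ih1 ih2 => simp only [Data.size]; omega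
  | seq _ _ ih1 ih2 => omega
  | cond_true _ _ _ ih1 ih2 => omega
  | cond_false _ _ ih1 ih2 => omega
  | loop_done _ ih => omega
  | loop_step _ _ _ _ ih1 ih2 ih3 => omega

/-- `p.Within x y b`: on input `x`, the program `p` outputs `y` within `b` steps. -/
def Prog.Within (p : Prog) (x y : Data) (b : ℕ) : Prop := ∃ t ≤ b, p.Run x y t

namespace Prog.Within

theorem size_le {p : Prog} {x y : Data} {b : ℕ} (h : p.Within x y b) : y.size ≤ b := by
  obtain ⟨t, ht, hr⟩ := h
  exact hr.size_le.trans ht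

theorem mono {p : Prog} {x y : Data} {b c : ℕ} (h : p.Within x y b) (hbc : b ≤ c) :
    p.Within x y c := by
  obtain ⟨t, ht, hr⟩ := h
  exact ⟨t, ht.trans hbc, hr⟩

theorem prim (p : Prim) (x : Data) :
    (Prog.prim p).Within x (p.eval x) (x.size + (p.eval x).size + 1) :=
  ⟨_, le_rfl, .prim p x⟩

theorem pair {f g : Prog} {x y z : Data} {s t : ℕ} (hf : f.Within x y s) (hg : g.Within x z t) :
    (Prog.pair f g).Within x (.cons y z) (s + t + 1) := by
  obtain ⟨a, ha, ha'⟩ := hf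
  obtain ⟨b, hb, hb'⟩ := hg
  exact ⟨_, by omega, .pair ha' hb'⟩

theorem seq {f g : Prog} {x y z : Data} {s t : ℕ} (hf : f.Within x y s) (hg : g.Within y z t) :
    (Prog.seq f g).Within x z (s + t + 1) := by
  obtain ⟨a, ha, ha'⟩ := hf
  obtain ⟨b, hb, hb'⟩ := hg
  exact ⟨_, by omega, .seq ha' hb'⟩

theorem cond_true {c f g : Prog} {x b y : Data} {s t : ℕ} (hc : c.Within x b s)
    (hb : b ≠ .num 0) (hf : f.Within x y t) : (Prog.cond c f g).Within x y (s + t + 1) := by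
  obtain ⟨a, ha, ha'⟩ := hc
  obtain ⟨b, hb, hb'⟩ := hf
  exact ⟨_, by omega, .cond_true ha' ‹_› hb'⟩

theorem cond_false {c f g : Prog} {x y : Data} {s t : ℕ} (hc : c.Within x (.num 0) s)
    (hg : g.Within x y t) : (Prog.cond c f g).Within x y (s + t + 1) := by
  obtain ⟨a, ha, ha'⟩ := hc
  obtain ⟨b, hb, hb'⟩ := hg
  exact ⟨_, by omega, .cond_false ha' hb'⟩

theorem loop_done {c f : Prog} {x : Data} {s : ℕ} (hc : c.Within x (.num 0) s) :
    (Prog.loop c f).Within x x (s + x.size + 1) := by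
  obtain ⟨a, ha, ha'⟩ := hc
  exact ⟨_, by omega, .loop_done ha'⟩

theorem loop_step {c f : Prog} {x b y z : Data} {s t u : ℕ} (hc : c.Within x b s)
    (hb : b ≠ .num 0) (hf : f.Within x y t) (hl : (Prog.loop c f).Within y z u) :
    (Prog.loop c f).Within x z (s + t + u + 1) := by
  obtain ⟨a, ha, ha'⟩ := hc
  obtain ⟨b, hb, hb'⟩ := hf
  obtain ⟨d, hd, hd'⟩ := hl
  exact ⟨_, by omega, .loop_step ha' ‹_› hb' hd'⟩

end Prog.Within

/-! ### Encodings and their bit lengths -/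

/-- Types whose elements are written as data. -/
class Encodes (α : Type) where
  /-- The data that represents an element. -/
  enc : α → Data

open Encodes

instance : Encodes ℕ := ⟨Data.num⟩
instance : Encodes Bool := ⟨fun b => .num b.toNat⟩
instance {α β : Type} [Encodes α] [Encodes β] : Encodes (α × β) := ⟨fun p => .cons (enc p.1) (enc p.2)⟩
instance {α : Type} [Encodes α] : Encodes (List α) := ⟨fun l => Data.ofList (l.map enc)⟩

/-- The bit length of the encoding. -/
def encSize {α : Type} [Encodes α] (a : α) : ℕ := (enc a).size

section encSize

variable {α β : Type} [Encodes α] [Encodes β]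

theorem enc_prod (a : α) (b : β) : enc (a, b) = .cons (enc a) (enc b) := rfl

theorem enc_nil : enc ([] : List α) = .num 0 := rfl

theorem enc_cons (a : α) (l : List α) : enc (a :: l) = .cons (enc a) (enc l) := rfl

theorem encSize_prod (a : α) (b : β) : encSize (a, b) = encSize a + encSize b + 1 := rfl

theorem encSize_prod' (p : α × β) : encSize p = encSize p.1 + encSize p.2 + 1 := rfl

theorem encSize_nil : encSize ([] : List α) = 1 := rfl

theorem encSize_cons (a : α) (l : List α) : encSize (a :: l) = encSize a + encSize l + 1 := rfl

theorem encSize_nat (n : ℕ) : encSize n = Nat.size n + 1 := rfl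

theorem encSize_list (l : List α) : encSize l = (l.map fun a => encSize a + 1).sum + 1 := by
  induction l with
  | nil => rfl
  | cons a l ih => simp only [encSize_cons, ih, List.map_cons, List.sum_cons]; omega

theorem encSize_append (l l' : List α) : encSize (l ++ l') + 1 = encSize l + encSize l' := by
  simp only [encSize_list, List.map_append, List.sum_append]; omega

theorem encSize_le_of_mem {a : α} {l : List α} (h : a ∈ l) : encSize a + 1 ≤ encSize l := by
  rw [encSize_list]
  have := List.single_le_sum (l := l.map fun a => encSize a + 1) (by simp) _
    (List.mem_map_of_mem h)
  omega

theorem encSize_sublist {l l' : List α} (h : l.Sublist l') : encSize l ≤ encSize l' := by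
  rw [encSize_list, encSize_list]
  have := List.Sublist.sum_le_sum (h.map fun a => encSize a + 1) (by simp)
  omega

theorem length_le_encSize (l : List α) : l.length + 1 ≤ encSize l := by
  induction l with
  | nil => simp [encSize_nil]
  | cons a l ih => rw [encSize_cons, List.length_cons]; omega

theorem encSize_le_of_forall {l : List α} {M N : ℕ} (h : ∀ a ∈ l, encSize a ≤ M)
    (hN : l.length ≤ N) : encSize l ≤ N * (M + 1) + 1 := by
  rw [encSize_list]
  have := List.sum_le_card_nsmul (l.map fun a => encSize a + 1) (M + 1) (by simpa using h)
  simp only [List.length_map, smul_eq_mul] at this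
  have := Nat.mul_le_mul_right (M + 1) hN
  omega

end encSize

/-! ### Polynomial bounds and polynomial-time functions -/

/-- Functions that are bounded by a polynomial in the bit length of their argument. -/
def PolyBounded {α : Type} [Encodes α] (f : α → ℕ) : Prop :=
  ∃ q : ℕ[X], ∀ a, f a ≤ q.eval (encSize a)

/-- Functions that are computed by a program in polynomial time. -/
@[fun_prop]
def PolyTime {α β : Type} [Encodes α] [Encodes β] (f : α → β) : Prop :=
  ∃ (p : Prog) (b : α → ℕ), PolyBounded b ∧ ∀ a, p.Within (enc a) (enc (f a)) (b a)

namespace PolyBounded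

variable {α β : Type} [Encodes α] [Encodes β] {f g : α → ℕ}

theorem mono (hg : PolyBounded g) (h : ∀ a, f a ≤ g a) : PolyBounded f := by
  obtain ⟨q, hq⟩ := hg
  exact ⟨q, fun a => (h a).trans (hq a)⟩

theorem const (n : ℕ) : PolyBounded (fun _ : α => n) := ⟨C n, fun a => by simp⟩

theorem encSize : PolyBounded (fun a : α => encSize a) := ⟨X, fun a => by simp⟩

theorem add (hf : PolyBounded f) (hg : PolyBounded g) : PolyBounded fun a => f a + g a := by
  obtain ⟨q, hq⟩ := hf
  obtain ⟨r, hr⟩ := hg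
  exact ⟨q + r, fun a => by rw [eval_add]; exact add_le_add (hq a) (hr a)⟩

theorem mul (hf : PolyBounded f) (hg : PolyBounded g) : PolyBounded fun a => f a * g a := by
  obtain ⟨q, hq⟩ := hf
  obtain ⟨r, hr⟩ := hg
  exact ⟨q * r, fun a => by rw [eval_mul]; exact Nat.mul_le_mul (hq a) (hr a)⟩

theorem comp {f : β → ℕ} (hf : PolyBounded f) {h : α → β}
    (hh : PolyBounded fun a => _root_.encSize (h a)) : PolyBounded fun a => f (h a) := by
  obtain ⟨q, hq⟩ := hf
  obtain ⟨r, hr⟩ := hh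
  refine ⟨q.comp r, fun a => (hq _).trans ?_⟩
  rw [eval_comp]
  exact q.eval_nat_mono (hr a)

end PolyBounded

namespace PolyTime

variable {α β γ σ : Type} [Encodes α] [Encodes β] [Encodes γ] [Encodes σ]

theorem size_bounded {f : α → β} (hf : PolyTime f) : PolyBounded fun a => encSize (f a) := by
  obtain ⟨p, b, hb, h⟩ := hf
  exact hb.mono fun a => (h a).size_le

theorem comp_bounded {f : β → ℕ} (hf : PolyBounded f) {h : α → β} (hh : PolyTime h) :
    PolyBounded fun a => f (h a) := hf.comp hh.size_bounded

theorem of_prim (p : Prim) {f : α → β} (h : ∀ a, p.eval (enc a) = enc (f a))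
    (hb : PolyBounded fun a => encSize (f a)) : PolyTime f := by
  refine ⟨.prim p, _, (PolyBounded.encSize.add hb).add (.const 1), fun a => ?_⟩
  have := Prog.Within.prim p (enc a)
  rwa [h] at this

@[fun_prop]
theorem id' : PolyTime (fun a : α => a) :=
  of_prim .skip (fun _ => rfl) .encSize

@[fun_prop]
theorem comp' {f : β → γ} {g : α → β} (hf : PolyTime f) (hg : PolyTime g) :
    PolyTime fun a => f (g a) := by
  have hg' := hg
  obtain ⟨p, b, hb, h⟩ := hf
  obtain ⟨p', b', hb', h'⟩ := hg
  exact ⟨.seq p' p, _, (hb'.add (comp_bounded hb hg')).add (.const 1),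
    fun a => (h' a).seq (h (g a))⟩

@[fun_prop]
theorem prodMk {f : α → β} {g : α → γ} (hf : PolyTime f) (hg : PolyTime g) :
    PolyTime fun a => (f a, g a) := by
  obtain ⟨p, b, hb, h⟩ := hf
  obtain ⟨p', b', hb', h'⟩ := hg
  exact ⟨.pair p p', _, (hb.add hb').add (.const 1), fun a => (h a).pair (h' a)⟩

@[fun_prop]
theorem fst {f : α → β × γ} (hf : PolyTime f) : PolyTime fun a => (f a).1 :=
  comp' (of_prim .fst (fun _ => rfl)
    (PolyBounded.encSize.mono fun a => by rw [encSize_prod' a]; omega)) hf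

@[fun_prop]
theorem snd {f : α → β × γ} (hf : PolyTime f) : PolyTime fun a => (f a).2 :=
  comp' (of_prim .snd (fun _ => rfl)
    (PolyBounded.encSize.mono fun a => by rw [encSize_prod' a]; omega)) hf

/-- Only numbers are primitive constants; a tree is assembled by pairing, and every leaf is charged
for reading the input again. -/
theorem exists_const (d : Data) : ∃ (p : Prog) (c : ℕ), ∀ x, p.Within x d (c * (x.size + 1)) := by
  induction d with
  | num n =>
    refine ⟨.prim (.const n), (Data.num n).size + 2, fun x => (Prog.Within.prim _ x).mono ?_⟩
    simp only [Prim.eval]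
    nlinarith
  | cons a b iha ihb =>
    obtain ⟨p, c, h⟩ := iha
    obtain ⟨p', c', h'⟩ := ihb
    refine ⟨.pair p p', c + c' + 1, fun x => ((h x).pair (h' x)).mono ?_⟩
    nlinarith

@[fun_prop]
theorem const' (b : β) : PolyTime fun _ : α => b := by
  obtain ⟨p, c, h⟩ := exists_const (enc b)
  exact ⟨p, _, (PolyBounded.const c).mul (PolyBounded.encSize.add (.const 1)), fun a => h (enc a)⟩

/-! ### Arithmetic -/

theorem size_le_of_le {m n : ℕ} (h : m ≤ n) : encSize m ≤ encSize n := by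
  simp only [encSize_nat]
  have := Nat.size_le_size h
  omega

theorem size_mul_le (m n : ℕ) : Nat.size (m * n) ≤ Nat.size m + Nat.size n := by
  rw [Nat.size_le, pow_add]
  exact Nat.mul_lt_mul'' (Nat.lt_size_self m) (Nat.lt_size_self n)

theorem size_add_le (m n : ℕ) : Nat.size (m + n) ≤ Nat.size m + Nat.size n + 1 := by
  rw [Nat.size_le]
  have h1 : m < 2 ^ (m.size + n.size) :=
    (Nat.lt_size_self m).trans_le (Nat.pow_le_pow_right (by norm_num) (by omega))
  have h2 : n < 2 ^ (m.size + n.size) :=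
    (Nat.lt_size_self n).trans_le (Nat.pow_le_pow_right (by norm_num) (by omega))
  rw [pow_succ]; omega

@[fun_prop]
theorem add {f g : α → ℕ} (hf : PolyTime f) (hg : PolyTime g) : PolyTime fun a => f a + g a := by
  refine comp' (f := fun p : ℕ × ℕ => p.1 + p.2) (of_prim .add (fun _ => rfl) ?_) (hf.prodMk hg)
  refine PolyBounded.encSize.mono fun p => ?_
  rw [encSize_prod' p]
  have := size_add_le p.1 p.2
  simp only [encSize_nat]; omega

@[fun_prop]
theorem mul {f g : α → ℕ} (hf : PolyTime f) (hg : PolyTime g) : PolyTime fun a => f a * g a := by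
  refine comp' (f := fun p : ℕ × ℕ => p.1 * p.2) (of_prim .mul (fun _ => rfl) ?_) (hf.prodMk hg)
  refine PolyBounded.encSize.mono fun p => ?_
  rw [encSize_prod' p]
  have := size_mul_le p.1 p.2
  simp only [encSize_nat]; omega

@[fun_prop]
theorem sub {f g : α → ℕ} (hf : PolyTime f) (hg : PolyTime g) : PolyTime fun a => f a - g a := by
  refine comp' (f := fun p : ℕ × ℕ => p.1 - p.2) (of_prim .sub (fun _ => rfl) ?_) (hf.prodMk hg)
  refine PolyBounded.encSize.mono fun p => ?_
  rw [encSize_prod' p]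
  have := size_le_of_le (Nat.sub_le p.1 p.2)
  omega

@[fun_prop]
theorem div {f g : α → ℕ} (hf : PolyTime f) (hg : PolyTime g) : PolyTime fun a => f a / g a := by
  refine comp' (f := fun p : ℕ × ℕ => p.1 / p.2) (of_prim .div (fun _ => rfl) ?_) (hf.prodMk hg)
  refine PolyBounded.encSize.mono fun p => ?_
  rw [encSize_prod' p]
  have := size_le_of_le (Nat.div_le_self p.1 p.2)
  omega

/-! ### Branching -/

@[fun_prop]
theorem ite' {c : α → Prop} [DecidablePred c] {f g : α → β} (hc : PolyTime fun a => decide (c a))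
    (hf : PolyTime f) (hg : PolyTime g) : PolyTime fun a => if c a then f a else g a := by
  obtain ⟨p, b, hb, h⟩ := hc
  obtain ⟨p₁, b₁, hb₁, h₁⟩ := hf
  obtain ⟨p₂, b₂, hb₂, h₂⟩ := hg
  refine ⟨.cond p p₁ p₂, _, (hb.add (hb₁.add hb₂)).add (.const 1), fun a => ?_⟩
  have h := h a
  beta_reduce at h ⊢
  by_cases hca : c a
  · rw [if_pos hca]
    rw [decide_eq_true hca] at h
    exact (h.cond_true (by simp [enc]) (h₁ a)).mono (by omega)
  · rw [if_neg hca]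
    rw [decide_eq_false hca] at h
    exact (Prog.Within.cond_false h (h₂ a)).mono (by omega)

/-- Branching accepts any value other than `num 0`, so a test by truncated subtraction has to be
normalized to the encodings of the two Booleans. -/
theorem of_nat_cond {n : α → ℕ} (hn : PolyTime n) {b : α → Bool} (h : ∀ a, n a ≠ 0 ↔ b a = true) :
    PolyTime b := by
  obtain ⟨p, t, ht, h'⟩ := hn
  obtain ⟨p₁, t₁, ht₁, h₁⟩ := const' (α := α) true
  obtain ⟨p₂, t₂, ht₂, h₂⟩ := const' (α := α) false
  refine ⟨.cond p p₁ p₂, _, (ht.add (ht₁.add ht₂)).add (.const 1), fun a => ?_⟩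
  have h'' := h' a
  by_cases hb : b a = true
  · rw [hb]
    exact (h''.cond_true (by simpa [enc] using (h a).2 hb) (h₁ a)).mono (by omega)
  · have : n a = 0 := by_contra fun h0 => hb ((h a).1 h0)
    rw [this] at h''
    rw [Bool.eq_false_iff.2 hb]
    exact (Prog.Within.cond_false h'' (h₂ a)).mono (by omega)

@[fun_prop]
theorem decide_lt {f g : α → ℕ} (hf : PolyTime f) (hg : PolyTime g) :
    PolyTime fun a => decide (f a < g a) :=
  of_nat_cond (n := fun a => g a - f a) (by fun_prop) fun a => by simp only [decide_eq_true_eq]; omega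

@[fun_prop]
theorem decide_le {f g : α → ℕ} (hf : PolyTime f) (hg : PolyTime g) :
    PolyTime fun a => decide (f a ≤ g a) :=
  of_nat_cond (n := fun a => g a + 1 - f a) (by fun_prop) fun a => by
    simp only [decide_eq_true_eq]; omega

@[fun_prop]
theorem decide_and {c d : α → Prop} [DecidablePred c] [DecidablePred d]
    (hc : PolyTime fun a => decide (c a)) (hd : PolyTime fun a => decide (d a)) :
    PolyTime fun a => decide (c a ∧ d a) := by
  have : (fun a => decide (c a ∧ d a)) = fun a => if c a then decide (d a) else false := by
    funext a; by_cases h : c a <;> simp [h]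
  rw [this]
  fun_prop

@[fun_prop]
theorem decide_not {c : α → Prop} [DecidablePred c]
    (hc : PolyTime fun a => decide (c a)) : PolyTime fun a => decide (¬ c a) := by
  have : (fun a => decide (¬ c a)) = fun a => if c a then false else true := by
    funext a; by_cases h : c a <;> simp [h]
  rw [this]
  fun_prop

@[fun_prop]
theorem decide_or {c d : α → Prop} [DecidablePred c] [DecidablePred d]
    (hc : PolyTime fun a => decide (c a)) (hd : PolyTime fun a => decide (d a)) :
    PolyTime fun a => decide (c a ∨ d a) := by
  have : (fun a => decide (c a ∨ d a)) = fun a => if c a then true else decide (d a) := by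
    funext a; by_cases h : c a <;> simp [h]
  rw [this]
  fun_prop

@[fun_prop]
theorem decide_imp {c d : α → Prop} [DecidablePred c] [DecidablePred d]
    (hc : PolyTime fun a => decide (c a)) (hd : PolyTime fun a => decide (d a)) :
    PolyTime fun a => decide (c a → d a) := by
  have : (fun a => decide (c a → d a)) = fun a => if c a then decide (d a) else true := by
    funext a; by_cases h : c a <;> simp [h]
  rw [this]
  fun_prop

@[fun_prop]
theorem decide_eq {f g : α → ℕ} (hf : PolyTime f) (hg : PolyTime g) :
    PolyTime fun a => decide (f a = g a) := by
  simp only [le_antisymm_iff]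
  fun_prop

/-! ### Lists -/

@[fun_prop]
theorem cons {f : α → β} {g : α → List β} (hf : PolyTime f) (hg : PolyTime g) :
    PolyTime fun a => f a :: g a :=
  hf.prodMk hg

theorem encSize_bool (b : Bool) : encSize b ≤ 2 := by
  cases b <;> decide

theorem decide_eq_nil {f : α → List β} (hf : PolyTime f) :
    PolyTime fun a => decide (f a = []) := by
  refine comp' (f := fun l : List β => decide (l = [])) (of_prim .isNum (fun l => ?_) ?_) hf
  · cases l <;> rfl
  · exact (PolyBounded.const 2).mono fun l => encSize_bool _

@[fun_prop]
theorem headD {f : α → List β} {g : α → β} (hf : PolyTime f) (hg : PolyTime g) :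
    PolyTime fun a => (f a).headD (g a) := by
  obtain ⟨p, b, hb, h⟩ := decide_eq_nil hf
  obtain ⟨p₁, b₁, hb₁, h₁⟩ := hf
  obtain ⟨p₂, b₂, hb₂, h₂⟩ := hg
  refine ⟨.cond p p₂ (.seq p₁ (.prim .fst)), _,
    (hb.add (hb₂.add ((hb₁.add (hb₁.add hb₁)).add (.const 2)))).add (.const 1), fun a => ?_⟩
  have h := h a
  have h₁ := h₁ a
  beta_reduce at h ⊢
  generalize f a = l at h h₁
  cases l with
  | nil => exact (Prog.Within.cond_true h (by simp [enc]) (h₂ a)).mono (by omega)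
  | cons x l =>
    have e : (enc x).size ≤ b₁ a := by
      have := h₁.size_le
      rw [enc_cons, Data.size] at this; omega
    refine (Prog.Within.cond_false h (h₁.seq (Prog.Within.prim .fst _))).mono ?_
    have := h₁.size_le
    simp only [enc_cons, Prim.eval] at this ⊢
    omega

/-- The loop that folds the program `p` along a list. -/
def foldLoop (p : Prog) : Prog :=
  .loop (.cond (.seq (.prim .snd) (.prim .isNum)) (.prim (.const 0)) (.prim (.const 1)))
    (.pair (.pair (.seq (.prim .fst) (.prim .fst))
      (.seq (.pair (.prim .fst) (.seq (.prim .snd) (.prim .fst))) p))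
        (.seq (.prim .snd) (.prim .snd)))

/-- `B` bounds one run of `p` on any state of size at most `S`. The factor 100 is slack for the
bounded number of tuple accesses per round, each linear in the sizes of the context, the state and
the remaining list. -/
theorem loop_foldl {γ σ α : Type} [Encodes γ] [Encodes σ] [Encodes α] {step : γ → σ → α → σ}
    {p : Prog} {b : (γ × σ) × α → ℕ}
    (hp : ∀ x : (γ × σ) × α, p.Within (enc x) (enc (step x.1.1 x.1.2 x.2)) (b x))
    (c : γ) (B S : ℕ) : ∀ (l : List α) (s : σ),
    (∀ l', l' <+: l → encSize (l'.foldl (step c) s) ≤ S) →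
    (∀ s', encSize s' ≤ S → ∀ a ∈ l, b ((c, s'), a) ≤ B) →
    (foldLoop p).Within
      (enc ((c, s), l)) (enc ((c, l.foldl (step c) s), ([] : List α)))
      ((l.length + 1) * (100 * (encSize c + S + encSize l + 1) + B)) := by
  intro l
  induction l with
  | nil =>
    intro s hS hB
    have hs : (enc s).size ≤ S := hS [] List.prefix_rfl
    refine (Prog.Within.loop_done ((((Prog.Within.prim .snd _).seq
      (Prog.Within.prim .isNum _)).cond_true (by simp [enc_prod, enc_nil, Prim.eval])
        (Prog.Within.prim (.const 0) _)))).mono ?_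
    simp only [enc_prod, enc_nil, Prim.eval, Data.size, encSize, List.length_nil]
    simp
    omega
  | cons a l ih =>
    intro s hS hB
    have hs : (enc s).size ≤ S := hS [] (List.nil_prefix)
    have hs' : (enc (step c s a)).size ≤ S := by
      simpa [encSize] using hS [a] (by simp)
    have hba : b ((c, s), a) ≤ B := hB s hs a (by simp)
    have hi := ih (step c s a) (fun l' hl' => by
      simpa using hS (a :: l') (by simpa using hl')) (fun s' hs' a ha => hB s' hs' a (by simp [ha]))
    unfold foldLoop at hi ⊢
    refine (Prog.Within.loop_step
      (Prog.Within.cond_false ((Prog.Within.prim .snd (enc ((c, s), a :: l))).seq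
        (Prog.Within.prim .isNum _)) (Prog.Within.prim (.const 1) _)) (by simp [Prim.eval])
      (((((Prog.Within.prim .fst (enc ((c, s), a :: l))).seq (Prog.Within.prim .fst _)).pair
        (((Prog.Within.prim .fst _).pair ((Prog.Within.prim .snd _).seq
          (Prog.Within.prim .fst _))).seq (hp ((c, s), a)))).pair
            ((Prog.Within.prim .snd _).seq (Prog.Within.prim .snd _)))) hi).mono ?_
    simp only [enc_prod, enc_cons, Prim.eval, Data.size, encSize, List.length_cons]
    have e : (l.length + 1) * (100 * ((enc c).size + S + (enc l).size + 1) + B) ≤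
        (l.length + 1) * (100 * ((enc c).size + S + ((enc a).size + (enc l).size + 1) + 1) + B) := by
      gcongr
      omega
    rw [show l.length + 1 + 1 = (l.length + 1) + 1 from rfl, add_mul (l.length + 1) 1]
    simp
    omega

/-- Iteration along a list, provided that the intermediate states stay small. -/
theorem foldl {l : γ → List α} {init : γ → σ} {step : γ → σ → α → σ} (hl : PolyTime l)
    (hi : PolyTime init) (hs : PolyTime fun x : (γ × σ) × α => step x.1.1 x.1.2 x.2)
    {S : γ → ℕ} (hS : PolyBounded S)
    (hb : ∀ c l', l' <+: l c → encSize (l'.foldl (step c) (init c)) ≤ S c) :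
    PolyTime fun c => (l c).foldl (step c) (init c) := by
  have hl' := hl.size_bounded
  obtain ⟨p, b, ⟨q, hq⟩, h⟩ := hs
  obtain ⟨pl, bl, hbl, hpl⟩ := hl
  obtain ⟨ps, bs, hbs, hps⟩ := hi
  obtain ⟨pc, bc, hbc, hpc⟩ := id' (α := γ)
  -- The step reads `((c, s'), a)`; the two `cons` cells of this tuple account for the 2.
  have hB : PolyBounded fun c => q.eval (encSize c + S c + encSize (l c) + 2) := by
    obtain ⟨r, hr⟩ := ((PolyBounded.encSize (α := γ).add hS).add hl').add (.const 2)
    refine ⟨q.comp r, fun c => ?_⟩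
    rw [eval_comp]
    exact q.eval_nat_mono (hr c)
  have hT : PolyBounded fun c => (encSize (l c) + 1) *
      (100 * (encSize c + S c + encSize (l c) + 1) +
        q.eval (encSize c + S c + encSize (l c) + 2)) :=
    (hl'.add (.const 1)).mul (((PolyBounded.const 100).mul
      (((PolyBounded.encSize.add hS).add hl').add (.const 1))).add hB)
  refine ⟨.seq (.seq (.pair (.pair pc ps) pl) (foldLoop p)) (.seq (.prim .fst) (.prim .snd)), _,
    ((((((hbc.add hbs).add (.const 1)).add hbl).add (.const 1)).add hT).add (.const 1)).add
      (((PolyBounded.const 100).mul ((PolyBounded.encSize.add hS).add (.const 1)))), fun c => ?_⟩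
  have hloop := loop_foldl h c (q.eval (encSize c + S c + encSize (l c) + 2)) (S c) (l c) (init c)
    (hb c) (fun s' hs' a ha => (hq _).trans (q.eval_nat_mono (by
      have := encSize_le_of_mem ha
      rw [encSize_prod, encSize_prod]; omega)))
  have hfin : encSize ((l c).foldl (step c) (init c)) ≤ S c := hb c _ List.prefix_rfl
  have hfin' := length_le_encSize (l c)
  refine (((((hpc c).pair (hps c)).pair (hpl c)).seq (hloop.mono (c := ?_) ?_)).seq
    ((Prog.Within.prim .fst _).seq (Prog.Within.prim .snd _))).mono ?_
  · exact (encSize (l c) + 1) *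
      (100 * (encSize c + S c + encSize (l c) + 1) + q.eval (encSize c + S c + encSize (l c) + 2))
  · gcongr; omega
  · simp only [enc_prod, enc_nil, Prim.eval, Data.size, encSize] at *
    simp
    omega

end PolyTime

/-! ### List operations and bounded quantifiers obtained from folds -/

namespace PolyTime

theorem foldl_cons_map {α β : Type} (g : α → β) (l : List α) (s : List β) :
    l.foldl (fun acc a => g a :: acc) s = (l.map g).reverse ++ s := by
  induction l generalizing s with
  | nil => simp
  | cons a l ih => simp [ih]

theorem foldl_append_flatMap {α β : Type} (g : α → List β) (l : List α) (s : List β) :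
    l.foldl (fun acc a => acc ++ g a) s = s ++ l.flatMap g := by
  induction l generalizing s with
  | nil => simp
  | cons a l ih => simp [ih]

theorem encSize_flatMap_le {α β : Type} [Encodes β] {g : α → List β} {l : List α} {b : ℕ} (h : ∀ a ∈ l, encSize (g a) ≤ b) :
    encSize (l.flatMap g) ≤ l.length * b + 1 := by
  induction l with
  | nil => simp [encSize_nil]
  | cons a l ih =>
    have h1 := ih fun x hx => h x (by simp [hx])
    have h2 := h a (by simp)
    have h3 := encSize_append (g a) (l.flatMap g)
    rw [List.flatMap_cons, List.length_cons, add_mul]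
    omega

variable {α β γ σ : Type} [Encodes α] [Encodes β] [Encodes γ] [Encodes σ]

theorem encSize_foldl_cons (l l' : List α) :
    encSize (l.foldl (fun acc a => a :: acc) l') + 1 = encSize l + encSize l' := by
  induction l generalizing l' with
  | nil => simp [encSize_nil]; omega
  | cons a l ih => rw [List.foldl_cons, ih, encSize_cons, encSize_cons]; omega

theorem foldl_cons {f g : γ → List α} (hf : PolyTime f) (hg : PolyTime g) :
    PolyTime fun c => (f c).foldl (fun acc a => a :: acc) (g c) := by
  refine foldl (step := fun _ acc a => a :: acc) hf hg (by fun_prop)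
    (hf.size_bounded.add hg.size_bounded) fun c l' hl' => ?_
  have h1 := encSize_foldl_cons l' (g c)
  have h2 := encSize_sublist hl'.sublist
  omega

@[fun_prop]
theorem reverse {f : γ → List α} (hf : PolyTime f) : PolyTime fun c => (f c).reverse := by
  have h := hf.foldl_cons (const' ([] : List α))
  simpa only [foldl_cons_map, List.append_nil, List.map_id'] using h

@[fun_prop]
theorem append {f g : γ → List α} (hf : PolyTime f) (hg : PolyTime g) :
    PolyTime fun c => f c ++ g c := by
  have h := hf.reverse.foldl_cons hg
  simpa only [foldl_cons_map, List.map_id', List.reverse_reverse] using h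

/-- An entry is no longer than its list, so a bound that is polynomial in the entry becomes uniform
over the list. This controls the accumulators of `map` and `flatMap`. -/
theorem bounded_of_mem {l : γ → List α} {h : γ × α → ℕ} (hl : PolyTime l) (hh : PolyBounded h) :
    ∃ b : γ → ℕ, PolyBounded b ∧ ∀ c, ∀ a ∈ l c, h (c, a) ≤ b c := by
  obtain ⟨q, hq⟩ := hh
  obtain ⟨r, hr⟩ := (PolyBounded.encSize (α := γ)).add hl.size_bounded
  refine ⟨fun c => (q.comp r).eval (encSize c), ⟨_, fun _ => le_rfl⟩, fun c a ha => ?_⟩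
  beta_reduce
  rw [eval_comp]
  refine (hq _).trans (q.eval_nat_mono (le_trans ?_ (hr c)))
  rw [encSize_prod]
  have := encSize_le_of_mem ha
  beta_reduce
  omega

@[fun_prop]
theorem map {l : γ → List α} {g : γ → α → β} (hl : PolyTime l)
    (hg : PolyTime fun x : γ × α => g x.1 x.2) : PolyTime fun c => (l c).map (g c) := by
  obtain ⟨b, hb, hb'⟩ := bounded_of_mem hl hg.size_bounded
  have h := (foldl (init := fun _ => ([] : List β)) (step := fun c acc a => g c a :: acc) hl
    (const' _) (by fun_prop) ((hl.size_bounded.mul (hb.add (.const 1))).add (.const 1))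
    (fun c l' hl' => ?_)).reverse
  · simpa only [foldl_cons_map, List.append_nil, List.reverse_reverse] using h
  · simp only [foldl_cons_map, List.append_nil]
    refine encSize_le_of_forall (fun x hx => ?_) ?_
    · simp only [List.mem_reverse, List.mem_map] at hx
      obtain ⟨a, ha, rfl⟩ := hx
      exact hb' c a (hl'.subset ha)
    · have h1 := length_le_encSize (l c)
      have h2 := hl'.length_le
      simp only [List.length_reverse, List.length_map]
      omega

@[fun_prop]
theorem flatMap {l : γ → List α} {g : γ → α → List β} (hl : PolyTime l)
    (hg : PolyTime fun x : γ × α => g x.1 x.2) : PolyTime fun c => (l c).flatMap (g c) := by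
  obtain ⟨b, hb, hb'⟩ := bounded_of_mem hl hg.size_bounded
  have h := (foldl (init := fun _ => ([] : List β)) (step := fun c acc a => acc ++ g c a) hl
    (const' _) (by fun_prop) ((hl.size_bounded.mul hb).add (.const 1))
    (fun c l' hl' => ?_))
  · simpa only [foldl_append_flatMap, List.nil_append] using h
  · simp only [foldl_append_flatMap, List.nil_append]
    refine (encSize_flatMap_le fun a ha => hb' c a (hl'.subset ha)).trans ?_
    have h1 := length_le_encSize (l c)
    have h2 := hl'.length_le
    gcongr
    omega

@[fun_prop]
theorem filter {l : γ → List α} {p : γ → α → Bool} (hl : PolyTime l)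
    (hp : PolyTime fun x : γ × α => p x.1 x.2) : PolyTime fun c => (l c).filter (p c) := by
  have h : PolyTime fun c => (l c).flatMap fun a => if p c a = true then [a] else [] := by
    refine flatMap hl ?_
    refine ite' (c := fun x : γ × α => p x.1 x.2 = true) ?_ (by fun_prop) (by fun_prop)
    simpa using hp
  have e : ∀ c, ((l c).flatMap fun a => if p c a = true then [a] else []) = (l c).filter (p c) := by
    intro c
    induction l c with
    | nil => rfl
    | cons a l ih => by_cases h : p c a = true <;> simp [h, ih]
  simpa only [e] using h

/-- The cell of each entry pays for the possible carry of one addition. -/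
theorem size_sum_le (l : List ℕ) : encSize l.sum ≤ encSize l + 1 := by
  induction l with
  | nil => decide
  | cons a l ih =>
    have := size_add_le a l.sum
    simp only [List.sum_cons, encSize_cons, encSize_nat] at *
    omega

@[fun_prop]
theorem sum {l : γ → List ℕ} (hl : PolyTime l) : PolyTime fun c => (l c).sum := by
  have h := foldl (init := fun _ => 0) (step := fun _ s a => s + a) hl (const' _) (by fun_prop)
    (hl.size_bounded.add (.const 1)) fun c l' hl' => by
      rw [← List.sum_eq_foldl]
      have h1 := size_sum_le l'
      have h2 := encSize_sublist hl'.sublist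
      omega
  simpa only [← List.sum_eq_foldl] using h

theorem size_prod_le (l : List ℕ) : encSize l.prod ≤ encSize l + 1 := by
  induction l with
  | nil => decide
  | cons a l ih =>
    have := size_mul_le a l.prod
    simp only [List.prod_cons, encSize_cons, encSize_nat] at *
    omega

@[fun_prop]
theorem prod {l : γ → List ℕ} (hl : PolyTime l) : PolyTime fun c => (l c).prod := by
  have h := foldl (init := fun _ => 1) (step := fun _ s a => s * a) hl (const' _) (by fun_prop)
    (hl.size_bounded.add (.const 1)) fun c l' hl' => by
      rw [← List.prod_eq_foldl]
      have h1 := size_prod_le l'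
      have h2 := encSize_sublist hl'.sublist
      omega
  simpa only [← List.prod_eq_foldl] using h

@[fun_prop]
theorem length {l : γ → List α} (hl : PolyTime l) : PolyTime fun c => (l c).length := by
  have h : PolyTime fun c => ((l c).map fun _ => 1).sum := by fun_prop
  simpa using h

theorem decide_congr {c d : γ → Prop} [DecidablePred c] [DecidablePred d]
    (hc : PolyTime fun x => decide (c x)) (h : ∀ x, c x ↔ d x) : PolyTime fun x => decide (d x) := by
  simpa only [h] using hc

@[fun_prop]
theorem decide_isNil {f : γ → List α} [DecidablePred fun c => f c = []] (hf : PolyTime f) :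
    PolyTime fun c => decide (f c = []) := by
  have h := hf.decide_eq_nil
  convert h

@[fun_prop]
theorem decide_mem {f : γ → ℕ} {l : γ → List ℕ} (hf : PolyTime f) (hl : PolyTime l) :
    PolyTime fun c => decide (f c ∈ l c) := by
  have h : PolyTime fun c => decide (¬ (l c).filter (fun a => decide (a = f c)) = []) := by fun_prop
  refine decide_congr h fun c => ?_
  simp [List.filter_eq_nil_iff]

@[fun_prop]
theorem decide_ball {l : γ → List α} {p : γ → α → Prop} [∀ c, DecidablePred (p c)]
    (hl : PolyTime l) (hp : PolyTime fun x : γ × α => decide (p x.1 x.2)) :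
    PolyTime fun c => decide (∀ a ∈ l c, p c a) := by
  have h : PolyTime fun c => decide ((l c).filter (fun a => decide (¬ p c a)) = []) := by fun_prop
  refine decide_congr h fun c => ?_
  simp [List.filter_eq_nil_iff]

@[fun_prop]
theorem decide_bex {l : γ → List α} {p : γ → α → Prop} [∀ c, DecidablePred (p c)]
    (hl : PolyTime l) (hp : PolyTime fun x : γ × α => decide (p x.1 x.2)) :
    PolyTime fun c => decide (∃ a ∈ l c, p c a) := by
  have h : PolyTime fun c => decide (¬ ∀ a ∈ l c, ¬ p c a) := by fun_prop
  refine decide_congr h fun c => ?_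
  simp

/-- Choosing, along a list, between the current state and an entry of the list. -/
theorem foldl_select {l : γ → List α} {init : γ → List α} {r : γ → List α → α → List α}
    (hl : PolyTime l) (hi : PolyTime init)
    (hr : PolyTime fun x : (γ × List α) × α => r x.1.1 x.1.2 x.2)
    (h : ∀ c s a, r c s a = s ∨ r c s a = [a]) :
    PolyTime fun c => (l c).foldl (r c) (init c) := by
  refine foldl hl hi hr (hi.size_bounded.add (hl.size_bounded.add (.const 1))) fun c l' hl' => ?_
  have key : ∀ (l' : List α) s, l'.foldl (r c) s = s ∨ ∃ a ∈ l', l'.foldl (r c) s = [a] := by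
    intro l'
    induction l' with
    | nil => intro s; simp
    | cons a l' ih =>
      intro s
      rw [List.foldl_cons]
      rcases ih (r c s a) with h1 | ⟨b, hb, h1⟩
      · rcases h c s a with h2 | h2
        · left; rw [h1, h2]
        · right; exact ⟨a, by simp, by rw [h1, h2]⟩
      · right; exact ⟨b, by simp [hb], h1⟩
  rcases key l' (init c) with h1 | ⟨a, ha, h1⟩
  · rw [h1]; omega
  · rw [h1, encSize_cons, encSize_nil]
    have := encSize_le_of_mem (hl'.subset ha)
    omega

end PolyTime

/-! ## The algorithm -/

namespace RootedAug

/-- An arc: tail, head, cost and label. -/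
abbrev Arc : Type := ℕ × ℕ × ℕ × ℕ

namespace Arc

/-- The tail of an arc. -/
abbrev src (a : Arc) : ℕ := a.1
/-- The head of an arc. -/
abbrev tgt (a : Arc) : ℕ := a.2.1
/-- The cost of an arc. -/
abbrev len (a : Arc) : ℕ := a.2.2.1
/-- The label of an arc. -/
abbrev lab (a : Arc) : ℕ := a.2.2.2
/-- The reversed arc. -/
def rev (a : Arc) : Arc := (a.tgt, a.src, a.len, a.lab)
/-- The arc at cost zero. -/
def free (a : Arc) : Arc := (a.src, a.tgt, 0, a.lab)

end Arc

/-- A node that the search has reached, with its distance and the labels of the arcs of a path. -/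
abbrev Entry : Type := ℕ × ℕ × List ℕ

namespace Entry

/-- The node of an entry. -/
abbrev node (x : Entry) : ℕ := x.1
/-- The distance of an entry. -/
abbrev dist (x : Entry) : ℕ := x.2.1
/-- The labels of the path of an entry. -/
abbrev path (x : Entry) : List ℕ := x.2.2
/-- The entry that extends the path of `x` by the arc `a`. -/
def ext (x : Entry) (a : Arc) : Entry := (a.tgt, x.dist + a.len, a.lab :: x.path)

end Entry

/-- The list with the first entry of least distance (empty if there is no entry). -/
def nearest (l : List Entry) : List Entry :=
  l.foldl (fun s x => if s = [] ∨ x.dist < (s.headD x).dist then [x] else s) []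

/-- The extensions of the entries of `L` by arcs that lead to new nodes. -/
def frontier (arcs : List Arc) (L : List Entry) : List Entry :=
  arcs.flatMap fun a =>
    if a.tgt ∈ L.map (fun y => y.node) then []
    else (L.filter fun x => decide (x.node = a.src)).map fun x => x.ext a

/-- Dijkstra's algorithm. -/
def search (arcs : List Arc) (X : List ℕ) : List Entry :=
  arcs.foldl (fun L _ => nearest (frontier arcs L) ++ L) (X.map fun v => (v, 0, []))

/-- The nodes that can be reached from `X`. -/
def reach (arcs : List Arc) (X : List ℕ) : List ℕ :=
  (search arcs X).map fun x => x.node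

/-- The reversals of all arcs. -/
def revAll (arcs : List Arc) : List Arc := arcs.map fun a => a.rev

/-- The entries of the search backwards from `t` that stand for the node `r`. -/
def pathsFrom (D : List Arc) (r t : ℕ) : List Entry :=
  (search (revAll D) [t]).filter fun x => decide (x.node = r)

/-- One augmentation along a path from `r` to `t`, if there is one; counts the augmentations. -/
def augment (r t : ℕ) (s : List Arc × ℕ) : List Arc × ℕ :=
  if pathsFrom s.1 r t = [] then s
  else (s.1.map fun a =>
    if a.lab ∈ ((pathsFrom s.1 r t).headD (0, 0, [])).path then a.rev else a, s.2 + 1)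

/-- The residual arcs and the value of a maximum flow from `r` to `t`. -/
def maxFlow (EJ : List Arc) (r t : ℕ) : List Arc × ℕ :=
  EJ.foldl (fun s _ => augment r t s) (EJ.map fun a => a.free, 0)

/-- A terminal with its flow value, its residual arcs, and the nodes that reach it along these. -/
abbrev FlowRecord : Type := ℕ × ℕ × List Arc × List ℕ

/-- The maximum flows to all terminals. -/
def flows (r : ℕ) (T : List ℕ) (EJ : List Arc) : List FlowRecord :=
  T.map fun t => (t, (maxFlow EJ r t).2, (maxFlow EJ r t).1,
    reach (revAll (maxFlow EJ r t).1) [t])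

/-- The flows of least value, if this is less than `k`. -/
def tightFlows (k : ℕ) (fl : List FlowRecord) : List FlowRecord :=
  fl.filter fun x => decide (x.2.1 < k ∧ ∀ y ∈ fl, x.2.1 ≤ y.2.1)

/-- One flow for each core. -/
def coreFlows (tf : List FlowRecord) : List FlowRecord :=
  tf.filter fun x => decide (∀ y ∈ tf, y.1 ∈ x.2.2.2 → x.1 ∈ y.2.2.2 ∧ x.1 ≤ y.1)

/-- A core, given by a terminal, with the nodes outside of its halo and the distances to it. -/
abbrev Halo : Type := ℕ × List ℕ × List Entry

/-- The halos of the cores. -/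
def halos (r : ℕ) (EN : List Arc) (cf : List FlowRecord) : List Halo :=
  cf.map fun x => (x.1,
    reach x.2.2.1 (r :: (cf.map fun y => y.1).filter fun s => decide (¬ s = x.1)),
    search (revAll (x.2.2.1 ++ EN)) [x.1])

/-- The distances from the head of the arc `e` to the cores whose halo it enters. -/
def offers (hs : List Halo) (e : Arc) : List Entry :=
  hs.flatMap fun h =>
    if e.src ∈ h.2.1 ∧ ¬ e.tgt ∈ h.2.1 then h.2.2.filter fun x => decide (x.node = e.tgt) else []

/-- The weight of the spiders that start with the arc `e`. -/
def weight (T : List ℕ) (hs : List Halo) (e : Arc) : ℕ :=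
  if e.src ∈ T ∧ ∃ h ∈ hs, ¬ e.src ∈ h.2.1 then 1 else 2

/-- A spider: its weighted cost, the number of its legs, and its labels. -/
abbrev Spider : Type := ℕ × ℕ × List ℕ

/-- The spider that starts with the arc `e` and has the legs `S`. -/
def spider (w : ℕ) (e : Arc) (S : List Entry) : Spider :=
  (w * (e.len + (S.map fun x => x.dist).sum), S.length, e.lab :: S.flatMap fun x => x.path)

/-- The candidate spiders. -/
def spiders (T : List ℕ) (hs : List Halo) (EN : List Arc) : List Spider :=
  EN.flatMap fun e => (offers hs e).map fun o =>
    spider (weight T hs e) e ((offers hs e).filter fun x => decide (x.dist ≤ o.dist))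

/-- The list with the first spider of least density (empty if there is none). -/
def best (l : List Spider) : List Spider :=
  l.foldl (fun s x =>
    if s = [] ∨ x.1 * (s.headD x).2.1 < (s.headD x).1 * x.2.1 then [x] else s) []

/-- The arcs whose labels occur in the list. -/
def withLabels (E : List Arc) (ls : List ℕ) : List Arc := E.filter fun a => decide (a.lab ∈ ls)

/-- The arcs whose labels do not occur in the list. -/
def withoutLabels (E : List Arc) (ls : List ℕ) : List Arc :=
  E.filter fun a => decide (¬ a.lab ∈ ls)

/-- The labels of a list of arcs. -/
def labels (E : List Arc) : List ℕ := E.map fun a => a.lab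

/-- The flows that represent the cores for the edge set with the arcs `EJ`. -/
def stepFlows (r k : ℕ) (T : List ℕ) (EJ : List Arc) : List FlowRecord :=
  coreFlows (tightFlows k (flows r T EJ))

/-- The spiders from which the next one is chosen. -/
def stepSpiders (r k : ℕ) (T : List ℕ) (E EJ : List Arc) : List Spider :=
  spiders T (halos r (withoutLabels E (labels EJ)) (stepFlows r k T EJ))
    (withoutLabels E (labels EJ))

/-- Adding the best spider. -/
def step (r k : ℕ) (T : List ℕ) (E EJ : List Arc) : List Arc :=
  withLabels E (((best (stepSpiders r k T E EJ)).headD (0, 0, [])).2.2 ++ labels EJ)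

/-- An input: nodes, root, terminals, edges, `ℓ`, `k`, and an unused end marker. -/
abbrev RawInput : Type :=
  List ℕ × ℕ × List ℕ × List (ℕ × ℕ × ℕ × ℕ × ℕ) × ℕ × ℕ × ℕ

/-- The edges with integral costs and consecutive labels. -/
def scaledArcs (es : List (ℕ × ℕ × ℕ × ℕ × ℕ)) : List Arc :=
  (es.foldl (fun s e => (s.1 ++ [(e.1, e.2.1, e.2.2.1 * ((es.map fun x => x.2.2.2.1).prod / e.2.2.2.1),
    s.2)], s.2 + 1)) (([] : List Arc), 0)).1

/-- The greedy algorithm on the scaled arcs. -/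
def greedy (r k : ℕ) (T : List ℕ) (E : List Arc) : List Arc :=
  E.foldl (fun EJ _ => step r k T E EJ) (E.filter fun a => decide (a.len = 0))

/-- The approximation algorithm. -/
def approximate (x : RawInput) : List ℕ :=
  labels (greedy x.2.1 x.2.2.2.2.2.1 x.2.2.1 (scaledArcs x.2.2.2.1))

/-! ### Its running time -/

open PolyTime

variable {γ : Type} [Encodes γ]

@[fun_prop]
theorem polyTime_rev {f : γ → Arc} (hf : PolyTime f) : PolyTime fun c => (f c).rev := by
  unfold Arc.rev; fun_prop

@[fun_prop]
theorem polyTime_free {f : γ → Arc} (hf : PolyTime f) : PolyTime fun c => (f c).free := by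
  unfold Arc.free; fun_prop

@[fun_prop]
theorem polyTime_ext {f : γ → Entry} {g : γ → Arc} (hf : PolyTime f) (hg : PolyTime g) :
    PolyTime fun c => (f c).ext (g c) := by
  unfold Entry.ext; fun_prop

@[fun_prop]
theorem polyTime_nearest {f : γ → List Entry} (hf : PolyTime f) : PolyTime fun c => nearest (f c) := by
  unfold nearest
  refine foldl_select hf (by fun_prop) (by fun_prop) fun c s a => ?_
  split_ifs <;> simp

@[fun_prop]
theorem polyTime_frontier {f : γ → List Arc} {g : γ → List Entry} (hf : PolyTime f) (hg : PolyTime g) :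
    PolyTime fun c => frontier (f c) (g c) := by
  unfold frontier; fun_prop

@[fun_prop]
theorem polyTime_revAll {f : γ → List Arc} (hf : PolyTime f) : PolyTime fun c => revAll (f c) := by
  unfold revAll; fun_prop

@[fun_prop]
theorem polyTime_coreFlows {f : γ → List FlowRecord} (hf : PolyTime f) : PolyTime fun c => coreFlows (f c) := by
  unfold coreFlows; fun_prop

@[fun_prop]
theorem polyTime_tightFlows {k : γ → ℕ} {f : γ → List FlowRecord} (hk : PolyTime k) (hf : PolyTime f) :
    PolyTime fun c => tightFlows (k c) (f c) := by
  unfold tightFlows; fun_prop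

@[fun_prop]
theorem polyTime_withLabels {f : γ → List Arc} {g : γ → List ℕ} (hf : PolyTime f) (hg : PolyTime g) :
    PolyTime fun c => withLabels (f c) (g c) := by
  unfold withLabels; fun_prop

@[fun_prop]
theorem polyTime_withoutLabels {f : γ → List Arc} {g : γ → List ℕ} (hf : PolyTime f) (hg : PolyTime g) :
    PolyTime fun c => withoutLabels (f c) (g c) := by
  unfold withoutLabels; fun_prop

@[fun_prop]
theorem polyTime_labels {f : γ → List Arc} (hf : PolyTime f) : PolyTime fun c => labels (f c) := by
  unfold labels; fun_prop

@[fun_prop]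
theorem polyTime_spider {w : γ → ℕ} {f : γ → Arc} {g : γ → List Entry} (hw : PolyTime w)
    (hf : PolyTime f) (hg : PolyTime g) : PolyTime fun c => spider (w c) (f c) (g c) := by
  unfold spider; fun_prop

@[fun_prop]
theorem polyTime_offers {f : γ → List Halo} {g : γ → Arc} (hf : PolyTime f) (hg : PolyTime g) :
    PolyTime fun c => offers (f c) (g c) := by
  unfold offers; fun_prop

@[fun_prop]
theorem polyTime_weight {T : γ → List ℕ} {f : γ → List Halo} {g : γ → Arc} (hT : PolyTime T)
    (hf : PolyTime f) (hg : PolyTime g) : PolyTime fun c => weight (T c) (f c) (g c) := by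
  unfold weight; fun_prop

@[fun_prop]
theorem polyTime_spiders {T : γ → List ℕ} {f : γ → List Halo} {g : γ → List Arc} (hT : PolyTime T)
    (hf : PolyTime f) (hg : PolyTime g) : PolyTime fun c => spiders (T c) (f c) (g c) := by
  unfold spiders; fun_prop

@[fun_prop]
theorem polyTime_best {f : γ → List Spider} (hf : PolyTime f) : PolyTime fun c => best (f c) := by
  unfold best
  refine foldl_select hf (by fun_prop) (by fun_prop) fun c s a => ?_
  split_ifs <;> simp

/-! ### Selecting a minimum along a list, and the growth of search states -/

/-- The predicate `P` is needed for densities: comparing fractions by cross multiplication is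
transitive only if the denominators are positive. -/
theorem foldl_select_spec {α : Type} {P : α → Prop} {lt le : α → α → Prop} [DecidableRel lt]
    (h1 : ∀ x y, P x → P y → ¬ lt x y → le y x) (h2 : ∀ x y, P x → P y → lt x y → le x y)
    (h3 : ∀ x y z, P x → P y → P z → le x y → le y z → le x z) (hr : ∀ x, P x → le x x) :
    ∀ (l : List α), (∀ x ∈ l, P x) → l ≠ [] →
      ∃ x ∈ l, l.foldl (fun s x => if s = [] ∨ lt x (s.headD x) then [x] else s) [] = [x] ∧
        ∀ y ∈ l, le x y := by
  have key : ∀ (l : List α) (a : α), P a → (∀ x ∈ l, P x) →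
      ∃ x ∈ a :: l, l.foldl (fun s x => if s = [] ∨ lt x (s.headD x) then [x] else s) [a] = [x] ∧
        ∀ y ∈ a :: l, le x y := by
    intro l
    induction l with
    | nil => intro a ha _; exact ⟨a, by simp, rfl, by simpa using hr a ha⟩
    | cons b l ih =>
      intro a ha hl
      have hb := hl b (by simp)
      have hl' : ∀ x ∈ l, P x := fun x hx => hl x (by simp [hx])
      rw [List.foldl_cons]
      by_cases hba : lt b a
      · rw [if_pos (by right; exact hba)]
        obtain ⟨x, hx, hxe, hxm⟩ := ih b hb hl'
        have hxP : P x := by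
          rcases List.mem_cons.1 hx with rfl | h
          exacts [hb, hl' x h]
        refine ⟨x, by simp only [List.mem_cons] at hx ⊢; tauto, hxe, fun y hy => ?_⟩
        rcases List.mem_cons.1 hy with rfl | hy
        · exact h3 _ _ _ hxP hb ha (hxm b (by simp)) (h2 _ _ hb ha hba)
        · exact hxm y hy
      · rw [if_neg (by simpa using hba)]
        obtain ⟨x, hx, hxe, hxm⟩ := ih a ha hl'
        have hxP : P x := by
          rcases List.mem_cons.1 hx with rfl | h
          exacts [ha, hl' x h]
        refine ⟨x, by simp only [List.mem_cons] at hx ⊢; tauto, hxe, fun y hy => ?_⟩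
        simp only [List.mem_cons] at hy
        rcases hy with rfl | rfl | hy
        · exact hxm y (by simp)
        · exact h3 _ _ _ hxP ha hb (hxm a (by simp)) (h1 _ _ hb ha hba)
        · exact hxm y (by simp [hy])
  intro l hl hne
  cases l with
  | nil => exact absurd rfl hne
  | cons a l =>
    simpa using key l a (hl a (by simp)) fun x hx => hl x (by simp [hx])

theorem nearest_spec {l : List Entry} (h : l ≠ []) :
    ∃ x ∈ l, nearest l = [x] ∧ ∀ y ∈ l, x.dist ≤ y.dist :=
  foldl_select_spec (P := fun _ => True) (lt := fun x y : Entry => x.dist < y.dist)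
    (le := fun x y => x.dist ≤ y.dist) (fun _ _ _ _ h => not_lt.1 h) (fun _ _ _ _ h => le_of_lt h)
    (fun _ _ _ _ _ _ h h' => le_trans h h') (fun _ _ => le_rfl) l (by simp) h

theorem nearest_nil : nearest [] = [] := rfl

theorem best_spec {l : List Spider} (h : l ≠ []) (hpos : ∀ x ∈ l, 0 < x.2.1) :
    ∃ x ∈ l, best l = [x] ∧ ∀ y ∈ l, x.1 * y.2.1 ≤ y.1 * x.2.1 := by
  refine foldl_select_spec (P := fun x : Spider => 0 < x.2.1)
    (lt := fun x y : Spider => x.1 * y.2.1 < y.1 * x.2.1)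
    (le := fun x y => x.1 * y.2.1 ≤ y.1 * x.2.1) (fun _ _ _ _ h => not_lt.1 h)
    (fun _ _ _ _ h => le_of_lt h) ?_ (fun _ _ => le_rfl) l hpos h
  intro x y z hx hy hz hxy hyz
  refine le_of_mul_le_mul_right (a := y.2.1) ?_ hy
  calc x.1 * z.2.1 * y.2.1 = x.1 * y.2.1 * z.2.1 := by ring
    _ ≤ y.1 * x.2.1 * z.2.1 := Nat.mul_le_mul_right _ hxy
    _ = y.1 * z.2.1 * x.2.1 := by ring
    _ ≤ z.1 * y.2.1 * x.2.1 := Nat.mul_le_mul_right _ hyz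
    _ = z.1 * x.2.1 * y.2.1 := by ring

theorem mem_frontier {arcs : List Arc} {L : List Entry} {y : Entry} :
    y ∈ frontier arcs L ↔
      ∃ a ∈ arcs, (∀ z ∈ L, z.node ≠ a.tgt) ∧ ∃ x ∈ L, x.node = a.src ∧ y = x.ext a := by
  simp only [frontier, List.mem_flatMap]
  refine exists_congr fun a => and_congr_right fun _ => ?_
  split_ifs with h
  · simp only [List.mem_map] at h
    obtain ⟨z, hz, hza⟩ := h
    simp only [List.not_mem_nil, false_iff]
    exact fun h' => h'.1 z hz hza
  · simp only [List.mem_map, not_exists, not_and] at h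
    simp only [List.mem_map, List.mem_filter, decide_eq_true_eq]
    constructor
    · rintro ⟨x, ⟨hx, hxa⟩, rfl⟩
      exact ⟨h, x, hx, hxa, rfl⟩
    · rintro ⟨_, x, hx, hxa, rfl⟩
      exact ⟨x, ⟨hx, hxa⟩, rfl⟩

/-- One round of the search. -/
theorem nearest_frontier_cases (arcs : List Arc) (L : List Entry) :
    (frontier arcs L = [] ∧ nearest (frontier arcs L) ++ L = L) ∨
      ∃ y ∈ frontier arcs L, nearest (frontier arcs L) ++ L = y :: L ∧
        ∀ z ∈ frontier arcs L, y.dist ≤ z.dist := by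
  by_cases h : frontier arcs L = []
  · left; rw [h, nearest_nil]; simp
  · right
    obtain ⟨y, hy, he, hm⟩ := nearest_spec h
    exact ⟨y, hy, by rw [he]; rfl, hm⟩

theorem encSize_ext_le (x : Entry) (a : Arc) : encSize (x.ext a) ≤ encSize x + encSize a + 1 := by
  have h := PolyTime.size_add_le x.dist a.len
  obtain ⟨x1, x2, x3⟩ := x
  obtain ⟨a1, a2, a3, a4⟩ := a
  simp only [Entry.ext, encSize_prod, encSize_cons, Entry.dist, Entry.path, Arc.len, Arc.tgt, Arc.lab,
    encSize_nat] at *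
  omega

/-- A round adds at most one entry, which extends an earlier one by a single arc. So entries grow
only linearly in the number of rounds, and the fold has polynomially bounded states. -/
theorem search_bounds (arcs : List Arc) (X : List ℕ) (l : List Arc) :
    (l.foldl (fun L _ => nearest (frontier arcs L) ++ L) (X.map fun v => (v, 0, []))).length ≤
        X.length + l.length ∧
      ∀ x ∈ l.foldl (fun L _ => nearest (frontier arcs L) ++ L) (X.map fun v => (v, 0, [])),
        encSize x ≤ encSize X + 5 + l.length * (encSize arcs + 1) := by
  induction l using List.reverseRecOn with
  | nil =>
    refine ⟨by simp, fun x hx => ?_⟩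
    simp only [List.foldl_nil, List.mem_map] at hx
    obtain ⟨v, hv, rfl⟩ := hx
    have := encSize_le_of_mem hv
    have e : encSize (0 : ℕ) = 1 := rfl
    simp only [encSize_prod, encSize_nil, e, List.length_nil]
    omega
  | append_singleton l a ih =>
    simp only [List.foldl_append, List.foldl_cons, List.foldl_nil]
    rw [List.length_append (as := l), List.length_singleton]
    generalize l.foldl (fun L _ => nearest (frontier arcs L) ++ L)
      (X.map fun v => (v, 0, [])) = L at ih ⊢
    obtain ⟨ih1, ih2⟩ := ih
    rcases nearest_frontier_cases arcs L with ⟨_, h⟩ | ⟨y, hy, h, _⟩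
    · rw [h]
      refine ⟨by omega, fun x hx => (ih2 x hx).trans ?_⟩
      gcongr; omega
    · rw [h]
      refine ⟨by simp only [List.length_cons]; omega, fun x hx => ?_⟩
      rw [add_mul, one_mul]
      rcases List.mem_cons.1 hx with rfl | hx
      · obtain ⟨b, hb, _, z, hz, _, rfl⟩ := mem_frontier.1 hy
        have h1 := encSize_ext_le z b
        have h2 := ih2 z hz
        have h3 := encSize_le_of_mem hb
        omega
      · have := ih2 x hx
        omega

@[fun_prop]
theorem polyTime_search {f : γ → List Arc} {X : γ → List ℕ} (hf : PolyTime f) (hX : PolyTime X) :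
    PolyTime fun c => search (f c) (X c) := by
  unfold search
  have hf' := hf.size_bounded
  have hX' := hX.size_bounded
  refine foldl (S := fun c => (encSize (X c) + encSize (f c)) *
    ((encSize (X c) + 5 + encSize (f c) * (encSize (f c) + 1)) + 1) + 1)
    (step := fun c L _ => nearest (frontier (f c) L) ++ L) hf (by fun_prop) (by fun_prop) ?_
    fun c l' hl' => ?_
  · exact ((hX'.add hf').mul (((hX'.add (.const 5)).add (hf'.mul (hf'.add (.const 1)))).add
      (.const 1))).add (.const 1)
  · obtain ⟨h1, h2⟩ := search_bounds (f c) (X c) l'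
    have h3 := length_le_encSize (X c)
    have h4 := length_le_encSize (f c)
    have h5 := hl'.length_le
    refine encSize_le_of_forall (fun x hx => (h2 x hx).trans ?_) (by omega)
    gcongr; omega

@[fun_prop]
theorem polyTime_reach {f : γ → List Arc} {X : γ → List ℕ} (hf : PolyTime f) (hX : PolyTime X) :
    PolyTime fun c => reach (f c) (X c) := by
  unfold reach; fun_prop

@[fun_prop]
theorem polyTime_pathsFrom {f : γ → List Arc} {r t : γ → ℕ} (hf : PolyTime f) (hr : PolyTime r)
    (ht : PolyTime t) : PolyTime fun c => pathsFrom (f c) (r c) (t c) := by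
  unfold pathsFrom; fun_prop

@[fun_prop]
theorem polyTime_augment {r t : γ → ℕ} {s : γ → List Arc × ℕ} (hr : PolyTime r)
    (ht : PolyTime t) (hs : PolyTime s) : PolyTime fun c => augment (r c) (t c) (s c) := by
  unfold augment; fun_prop

theorem encSize_rev (a : Arc) : encSize a.rev = encSize a := by
  obtain ⟨a1, a2, a3, a4⟩ := a
  simp only [Arc.rev, Arc.src, Arc.tgt, Arc.len, Arc.lab, encSize_prod]
  omega

theorem encSize_free_le (a : Arc) : encSize a.free ≤ encSize a := by
  obtain ⟨a1, a2, a3, a4⟩ := a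
  have : encSize (0 : ℕ) ≤ encSize a3 := PolyTime.size_le_of_le (Nat.zero_le _)
  simp only [Arc.free, Arc.src, Arc.tgt, Arc.lab, encSize_prod]
  omega

theorem encSize_map_le {α : Type} [Encodes α] {g : α → α} (h : ∀ a, encSize (g a) ≤ encSize a)
    (l : List α) : encSize (l.map g) ≤ encSize l := by
  induction l with
  | nil => exact le_rfl
  | cons a l ih =>
    have := h a
    rw [List.map_cons, encSize_cons, encSize_cons]
    omega

/-- Reversing an arc permutes its fields, so the residual list never gets longer. -/
theorem augment_bounds (r t : ℕ) (s : List Arc × ℕ) :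
    encSize (augment r t s).1 ≤ encSize s.1 ∧ (augment r t s).2 ≤ s.2 + 1 := by
  unfold augment
  split_ifs
  · exact ⟨le_rfl, by omega⟩
  · refine ⟨encSize_map_le (fun a => ?_) _, le_rfl⟩
    split_ifs
    exacts [(encSize_rev a).le, le_rfl]

theorem size_le_self (n : ℕ) : Nat.size n ≤ n := by
  rw [Nat.size_le]
  exact Nat.lt_two_pow_self

@[fun_prop]
theorem polyTime_maxFlow {f : γ → List Arc} {r t : γ → ℕ} (hf : PolyTime f) (hr : PolyTime r)
    (ht : PolyTime t) : PolyTime fun c => maxFlow (f c) (r c) (t c) := by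
  unfold maxFlow
  have hf' := hf.size_bounded
  refine foldl (S := fun c => encSize (f c) + encSize (f c) + 2)
    (step := fun c s _ => augment (r c) (t c) s) hf (by fun_prop) (by fun_prop)
    ((hf'.add hf').add (.const 2)) fun c l' hl' => ?_
  have key : ∀ l' : List Arc,
      encSize (l'.foldl (fun s _ => augment (r c) (t c) s) ((f c).map fun a => a.free, 0)).1 ≤
        encSize (f c) ∧
      (l'.foldl (fun s _ => augment (r c) (t c) s) ((f c).map fun a => a.free, 0)).2 ≤
        l'.length := by
    intro l'
    induction l' using List.reverseRecOn with
    | nil => exact ⟨encSize_map_le encSize_free_le _, le_rfl⟩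
    | append_singleton l a ih =>
      simp only [List.foldl_append, List.foldl_cons, List.foldl_nil, List.length_append,
        List.length_singleton]
      have := augment_bounds (r c) (t c)
        (l.foldl (fun s _ => augment (r c) (t c) s) ((f c).map fun a => a.free, 0))
      omega
  have h1 := key l'
  have h2 := hl'.length_le
  have h3 := length_le_encSize (f c)
  have h4 := size_le_self
    (l'.foldl (fun s _ => augment (r c) (t c) s) ((f c).map fun a => a.free, 0)).2
  rw [encSize_prod', encSize_nat]
  omega

@[fun_prop]
theorem polyTime_flows {r : γ → ℕ} {T : γ → List ℕ} {f : γ → List Arc} (hr : PolyTime r)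
    (hT : PolyTime T) (hf : PolyTime f) : PolyTime fun c => flows (r c) (T c) (f c) := by
  unfold flows; fun_prop

@[fun_prop]
theorem polyTime_halos {r : γ → ℕ} {f : γ → List Arc} {g : γ → List FlowRecord} (hr : PolyTime r)
    (hf : PolyTime f) (hg : PolyTime g) : PolyTime fun c => halos (r c) (f c) (g c) := by
  unfold halos; fun_prop

@[fun_prop]
theorem polyTime_stepFlows {r k : γ → ℕ} {T : γ → List ℕ} {f : γ → List Arc} (hr : PolyTime r)
    (hk : PolyTime k) (hT : PolyTime T) (hf : PolyTime f) :
    PolyTime fun c => stepFlows (r c) (k c) (T c) (f c) := by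
  unfold stepFlows; fun_prop

@[fun_prop]
theorem polyTime_stepSpiders {r k : γ → ℕ} {T : γ → List ℕ} {f g : γ → List Arc} (hr : PolyTime r)
    (hk : PolyTime k) (hT : PolyTime T) (hf : PolyTime f) (hg : PolyTime g) :
    PolyTime fun c => stepSpiders (r c) (k c) (T c) (f c) (g c) := by
  unfold stepSpiders; fun_prop

@[fun_prop]
theorem polyTime_step {r k : γ → ℕ} {T : γ → List ℕ} {f g : γ → List Arc} (hr : PolyTime r)
    (hk : PolyTime k) (hT : PolyTime T) (hf : PolyTime f) (hg : PolyTime g) :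
    PolyTime fun c => step (r c) (k c) (T c) (f c) (g c) := by
  unfold step; fun_prop

-- Every intermediate state is a sublist of the list of all arcs, however many labels a spider
-- contributes.
@[fun_prop]
theorem polyTime_greedy {r k : γ → ℕ} {T : γ → List ℕ} {f : γ → List Arc} (hr : PolyTime r)
    (hk : PolyTime k) (hT : PolyTime T) (hf : PolyTime f) :
    PolyTime fun c => greedy (r c) (k c) (T c) (f c) := by
  unfold greedy
  refine foldl (step := fun c s _ => step (r c) (k c) (T c) (f c) s) hf (by fun_prop)
    (by fun_prop) hf.size_bounded fun c l' hl' => ?_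
  induction l' using List.reverseRecOn with
  | nil => exact encSize_sublist List.filter_sublist
  | append_singleton l a ih =>
    simp only [List.foldl_append, List.foldl_cons, List.foldl_nil]
    exact encSize_sublist List.filter_sublist

theorem scaledArcs_foldl (c : ℕ × ℕ × ℕ × ℕ × ℕ → ℕ) (es : List (ℕ × ℕ × ℕ × ℕ × ℕ)) :
    es.foldl (fun s e => (s.1 ++ [(e.1, e.2.1, c e, s.2)], s.2 + 1)) (([] : List Arc), 0) =
      (es.zipIdx.map fun x => (x.1.1, x.1.2.1, c x.1, x.2), es.length) := by
  induction es using List.reverseRecOn with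
  | nil => rfl
  | append_singleton l a ih =>
    simp only [List.foldl_append, List.foldl_cons, List.foldl_nil, ih]
    simp [List.zipIdx_append]

-- The scaling factor is a product of numbers in the list, hence of polynomial length
-- (`size_prod_le`), and the labels are smaller than the length of the list.
@[fun_prop]
theorem polyTime_scaledArcs {f : γ → List (ℕ × ℕ × ℕ × ℕ × ℕ)} (hf : PolyTime f) :
    PolyTime fun c => scaledArcs (f c) := by
  unfold scaledArcs
  refine fst ?_
  obtain ⟨b, hb, hb'⟩ := bounded_of_mem hf (h := fun x => encSize
    ((x.2.1, x.2.2.1, x.2.2.2.1 * (((f x.1).map fun x => x.2.2.2.1).prod / x.2.2.2.2.1)) :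
      ℕ × ℕ × ℕ)) (size_bounded (by fun_prop))
  have hf' := hf.size_bounded
  refine foldl (S := fun c => (encSize (f c) * (b c + encSize (f c) + 2 + 1) + 1) +
      encSize (f c) + 2)
    (step := fun c s e => (s.1 ++ [(e.1, e.2.1, e.2.2.1 * (((f c).map fun x => x.2.2.2.1).prod /
      e.2.2.2.1), s.2)], s.2 + 1)) hf (const' _) (by fun_prop)
    ((((hf'.mul (((hb.add hf').add (.const 2)).add (.const 1))).add (.const 1)).add hf').add
      (.const 2)) fun c l' hl' => ?_
  rw [scaledArcs_foldl fun e => e.2.2.1 * (((f c).map fun x => x.2.2.2.1).prod / e.2.2.2.1)]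
  have h2 := hl'.length_le
  have h3 := length_le_encSize (f c)
  have h4 := size_le_self l'.length
  rw [encSize_prod, encSize_nat]
  have : encSize (l'.zipIdx.map fun x => (x.1.1, x.1.2.1,
      x.1.2.2.1 * (((f c).map fun x => x.2.2.2.1).prod / x.1.2.2.2.1), x.2)) ≤
      encSize (f c) * (b c + encSize (f c) + 2 + 1) + 1 := by
    refine encSize_le_of_forall (fun a ha => ?_) (by simp; omega)
    obtain ⟨⟨e, i⟩, hei, rfl⟩ := List.mem_map.1 ha
    have h5 := hb' c e (hl'.subset (List.fst_mem_of_mem_zipIdx hei))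
    have h6 := List.snd_lt_of_mem_zipIdx hei
    have h7 := size_le_self i
    simp only [encSize_prod, encSize_nat] at h5 ⊢
    omega
  omega

theorem polyTime_approximate : PolyTime approximate := by
  unfold approximate; fun_prop

end RootedAug

namespace RootedAug

/-! ## Correctness of the search -/

/-- The states of a search from `X`, without regard to the order in which nodes are chosen. -/
inductive Built (arcs : List Arc) (X : List ℕ) : List Entry → Prop
  | init : Built arcs X (X.map fun v => (v, 0, []))
  | step {L : List Entry} {x : Entry} {a : Arc} : Built arcs X L → x ∈ L → a ∈ arcs →
      x.node = a.src → (∀ z ∈ L, z.node ≠ a.tgt) → Built arcs X (x.ext a :: L)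

variable {arcs : List Arc} {X : List ℕ}

theorem Built.of_mem_frontier {L : List Entry} (h : Built arcs X L) {y : Entry}
    (hy : y ∈ frontier arcs L) : Built arcs X (y :: L) := by
  obtain ⟨a, ha, hn, x, hx, hxa, rfl⟩ := mem_frontier.1 hy
  exact .step h hx ha hxa hn

/-- Entries after the initial ones have pairwise distinct nodes, each of them the head of an arc. -/
theorem Built.length_le {L : List Entry} (h : Built arcs X L) :
    L.length ≤ X.length + arcs.length := by
  have : ∃ L' : List Entry, L = L' ++ X.map (fun v => (v, 0, [])) ∧
      (L'.map fun x => x.node).Nodup ∧ (L'.map fun x => x.node) ⊆ arcs.map fun a => a.tgt := by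
    induction h with
    | init => exact ⟨[], by simp⟩
    | @step L x a _ hx ha hxa hn ih =>
      obtain ⟨L', rfl, h1, h2⟩ := ih
      refine ⟨x.ext a :: L', rfl, ?_, ?_⟩
      · rw [List.map_cons, List.nodup_cons]
        refine ⟨fun hm => ?_, h1⟩
        obtain ⟨z, hz, hza⟩ := List.mem_map.1 hm
        exact hn z (List.mem_append_left _ hz) hza
      · rw [List.map_cons, List.cons_subset]
        exact ⟨List.mem_map.2 ⟨a, ha, rfl⟩, h2⟩
  obtain ⟨L', rfl, h1, h2⟩ := this
  have := (h1.subperm h2).length_le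
  simp only [List.length_map, List.length_append] at this ⊢
  omega

/-- The invariants of Dijkstra's algorithm. -/
structure SearchInv (arcs : List Arc) (L : List Entry) : Prop where
  relaxed : ∀ x ∈ L, ∀ a ∈ arcs, x.node = a.src →
    (∃ y ∈ L, y.node = a.tgt ∧ y.dist ≤ x.dist + a.len) ∨ ∀ y ∈ L, y.node ≠ a.tgt
  ordered : ∀ z ∈ frontier arcs L, ∀ x ∈ L, x.dist ≤ z.dist

theorem SearchInv.init : SearchInv arcs (X.map fun v => ((v, 0, []) : Entry)) := by
  constructor
  · intro x hx a ha hxa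
    by_cases h : ∃ y ∈ X.map fun v => ((v, 0, []) : Entry), Entry.node y = a.tgt
    · obtain ⟨y, hy, hya⟩ := h
      refine .inl ⟨y, hy, hya, ?_⟩
      obtain ⟨v, _, rfl⟩ := List.mem_map.1 hy
      exact Nat.zero_le _
    · right
      push Not at h
      exact h
  · intro z _ x hx
    obtain ⟨v, _, rfl⟩ := List.mem_map.1 hx
    exact Nat.zero_le _

/-- Dijkstra's argument. An arc from the new node `y` to a settled node is relaxed because settled
nodes are no farther than `y` (`ordered`). An arc from a settled node to `y` gives a frontier entry,
so it is relaxed by the minimality of `y`. -/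
theorem SearchInv.cons {L : List Entry} (h : SearchInv arcs L) {y : Entry}
    (hy : y ∈ frontier arcs L) (hmin : ∀ z ∈ frontier arcs L, y.dist ≤ z.dist) :
    SearchInv arcs (y :: L) := by
  constructor
  · intro x hx a ha hxa
    by_cases hya : y.node = a.tgt
    · rcases List.mem_cons.1 hx with rfl | hx
      · exact .inl ⟨x, by simp, hya, Nat.le_add_right _ _⟩
      · rcases h.relaxed x hx a ha hxa with ⟨z, hz, hza⟩ | hn
        · exact .inl ⟨z, by simp [hz], hza⟩
        · exact .inl ⟨y, by simp, hya, hmin _ (mem_frontier.2 ⟨a, ha, hn, x, hx, hxa, rfl⟩)⟩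
    · by_cases hn : ∃ z ∈ L, z.node = a.tgt
      · rcases List.mem_cons.1 hx with rfl | hx
        · obtain ⟨z, hz, hza⟩ := hn
          exact .inl ⟨z, by simp [hz], hza, (h.ordered _ hy z hz).trans (Nat.le_add_right _ _)⟩
        · rcases h.relaxed x hx a ha hxa with ⟨z, hz, hza⟩ | hn'
          · exact .inl ⟨z, by simp [hz], hza⟩
          · obtain ⟨z, hz, hza⟩ := hn
            exact absurd hza (hn' z hz)
      · right
        push Not at hn
        intro z hz
        rcases List.mem_cons.1 hz with rfl | hz
        exacts [hya, hn z hz]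
  · intro z hz x hx
    obtain ⟨a, ha, hn, w, hw, hwa, rfl⟩ := mem_frontier.1 hz
    have hyz : y.dist ≤ (w.ext a).dist := by
      rcases List.mem_cons.1 hw with rfl | hw
      · exact Nat.le_add_right _ _
      · exact hmin _ (mem_frontier.2 ⟨a, ha, fun z hz => hn z (by simp [hz]), w, hw, hwa, rfl⟩)
    rcases List.mem_cons.1 hx with rfl | hx
    · exact hyz
    · exact (h.ordered y hy x hx).trans hyz

/-- The last clause is the termination argument: until the frontier is empty, every round adds an
entry. -/
theorem search_aux (arcs : List Arc) (X : List ℕ) (l : List Arc) :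
    let L := l.foldl (fun L _ => nearest (frontier arcs L) ++ L) (X.map fun v => (v, 0, []))
    Built arcs X L ∧ SearchInv arcs L ∧ (frontier arcs L = [] ∨ L.length = X.length + l.length) := by
  induction l using List.reverseRecOn with
  | nil => exact ⟨.init, .init, .inr (by simp)⟩
  | append_singleton l a ih =>
    simp only [List.foldl_append, List.foldl_cons, List.foldl_nil]
    rw [List.length_append (as := l), List.length_singleton]
    simp only at ih
    generalize l.foldl (fun L _ => nearest (frontier arcs L) ++ L)
      (X.map fun v => (v, 0, [])) = L at ih ⊢
    obtain ⟨ih1, ih2, ih3⟩ := ih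
    rcases nearest_frontier_cases arcs L with ⟨h, h'⟩ | ⟨y, hy, h', hm⟩
    · rw [h']
      exact ⟨ih1, ih2, .inl h⟩
    · rw [h']
      refine ⟨ih1.of_mem_frontier hy, ih2.cons hy hm, .inr ?_⟩
      have : frontier arcs L ≠ [] := List.ne_nil_of_mem hy
      simp only [List.length_cons]
      have := ih3.resolve_left this
      omega

theorem search_built (arcs : List Arc) (X : List ℕ) : Built arcs X (search arcs X) :=
  (search_aux arcs X arcs).1

/-- A nonempty frontier after `arcs.length` rounds would allow one entry more than `Built.length_le`
permits. -/
theorem frontier_search (arcs : List Arc) (X : List ℕ) : frontier arcs (search arcs X) = [] := by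
  obtain ⟨h1, _, h3⟩ := search_aux arcs X arcs
  by_contra hne
  obtain ⟨y, hy⟩ := List.exists_mem_of_ne_nil _ hne
  have := (h1.of_mem_frontier hy).length_le
  have := h3.resolve_left hne
  simp only [List.length_cons] at *
  omega

theorem search_closed {x : Entry} (hx : x ∈ search arcs X) {a : Arc} (ha : a ∈ arcs)
    (hxa : x.node = a.src) :
    ∃ y ∈ search arcs X, y.node = a.tgt ∧ y.dist ≤ x.dist + a.len := by
  rcases (search_aux arcs X arcs).2.1.relaxed x hx a ha hxa with h | h
  · exact h
  · have : x.ext a ∈ frontier arcs (search arcs X) := mem_frontier.2 ⟨a, ha, h, x, hx, hxa, rfl⟩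
    rw [frontier_search] at this
    simp at this

theorem Built.init_mem {L : List Entry} (h : Built arcs X L) {v : ℕ} (hv : v ∈ X) :
    (v, 0, []) ∈ L := by
  induction h with
  | init => exact List.mem_map.2 ⟨v, hv, rfl⟩
  | step _ _ _ _ _ ih => exact List.mem_cons_of_mem _ ih

theorem mem_search_of_mem {v : ℕ} (hv : v ∈ X) : (v, 0, []) ∈ search arcs X :=
  (search_built arcs X).init_mem hv

theorem Built.nodup {L : List Entry} (h : Built arcs X L) (hX : X.Nodup) :
    (L.map fun x => x.node).Nodup := by
  induction h with
  | init => simpa [Function.comp_def] using hX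
  | step _ _ _ _ hn ih =>
    rw [List.map_cons, List.nodup_cons]
    refine ⟨fun hm => ?_, ih⟩
    obtain ⟨z, hz, hza⟩ := List.mem_map.1 hm
    exact hn z hz hza

theorem mem_reach_of_mem {v : ℕ} (hv : v ∈ X) : v ∈ reach arcs X :=
  List.mem_map.2 ⟨_, mem_search_of_mem hv, rfl⟩

theorem reach_closed {a : Arc} (ha : a ∈ arcs) (h : a.src ∈ reach arcs X) :
    a.tgt ∈ reach arcs X := by
  obtain ⟨x, hx, hxa⟩ := List.mem_map.1 h
  obtain ⟨y, hy, hya, _⟩ := search_closed hx ha hxa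
  exact List.mem_map.2 ⟨y, hy, hya⟩

theorem reach_induction {P : ℕ → Prop} (h0 : ∀ v ∈ X, P v)
    (h1 : ∀ a ∈ arcs, P a.src → P a.tgt) : ∀ v ∈ reach arcs X, P v := by
  have key : ∀ L, Built arcs X L → ∀ x ∈ L, P x.node := by
    intro L h
    induction h with
    | init =>
      intro x hx
      obtain ⟨v, hv, rfl⟩ := List.mem_map.1 hx
      exact h0 v hv
    | step _ hx ha hxa _ ih =>
      intro y hy
      rcases List.mem_cons.1 hy with rfl | hy
      · exact h1 _ ha (hxa ▸ ih _ hx)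
      · exact ih y hy
  intro v hv
  obtain ⟨x, hx, rfl⟩ := List.mem_map.1 hv
  exact key _ (search_built arcs X) x hx

theorem mem_revAll {D : List Arc} {a : Arc} : a ∈ revAll D ↔ ∃ b ∈ D, b.rev = a := List.mem_map

/-! ## Arcs of an instance -/

variable (G : AugInstance) (c : Fin G.m → ℕ)

/-- The edge `e` at cost `c e`. -/
def arcOf (e : Fin G.m) : Arc := (G.tail e, G.head e, c e, e)

/-- The edges of `J` as a list of arcs. -/
def arcsOf (J : Finset (Fin G.m)) : List Arc :=
  ((List.finRange G.m).filter fun e => decide (e ∈ J)).map (arcOf G c)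

/-- The residual arc of the edge `e`: it is reversed if `e` belongs to the flow `F`. -/
def resArc (F : Finset (Fin G.m)) (e : Fin G.m) : Arc :=
  if e ∈ F then (G.head e, G.tail e, 0, e) else (G.tail e, G.head e, 0, e)

/-- The residual arcs of a flow `F` in `J`. -/
def resArcs (J F : Finset (Fin G.m)) : List Arc :=
  ((List.finRange G.m).filter fun e => decide (e ∈ J)).map (resArc G F)

variable {G c}

theorem mem_arcsOf {J : Finset (Fin G.m)} {a : Arc} :
    a ∈ arcsOf G c J ↔ ∃ e ∈ J, arcOf G c e = a := by
  simp [arcsOf]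

theorem mem_resArcs {J F : Finset (Fin G.m)} {a : Arc} :
    a ∈ resArcs G J F ↔ ∃ e ∈ J, resArc G F e = a := by
  simp [resArcs]

theorem resArc_lab (F : Finset (Fin G.m)) (e : Fin G.m) : (resArc G F e).lab = e := by
  unfold resArc; split_ifs <;> rfl

theorem resArc_len (F : Finset (Fin G.m)) (e : Fin G.m) : (resArc G F e).len = 0 := by
  unfold resArc; split_ifs <;> rfl

theorem labels_arcsOf (J : Finset (Fin G.m)) :
    labels (arcsOf G c J) =
      ((List.finRange G.m).filter fun e => decide (e ∈ J)).map fun e : Fin G.m => (e : ℕ) := by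
  rw [labels, arcsOf, List.map_map]
  rfl

theorem mem_labels_arcsOf {J : Finset (Fin G.m)} {e : Fin G.m} :
    (e : ℕ) ∈ labels (arcsOf G c J) ↔ e ∈ J := by
  rw [labels_arcsOf, List.mem_map]
  constructor
  · rintro ⟨e', he', h⟩
    rw [Fin.ext (a := e') (b := e) h] at he'
    simpa using he'
  · exact fun h => ⟨e, List.mem_filter.2 ⟨List.mem_finRange e, decide_eq_true h⟩, rfl⟩

theorem length_arcsOf (J : Finset (Fin G.m)) : (arcsOf G c J).length = J.card := by
  rw [arcsOf, List.length_map]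
  rw [← List.toFinset_card_of_nodup ((List.nodup_finRange _).filter _)]
  congr 1
  ext e
  simp

theorem filter_arcsOf (J : Finset (Fin G.m)) (p : Arc → Bool) :
    (arcsOf G c J).filter p = arcsOf G c (J.filter fun e => p (arcOf G c e) = true) := by
  rw [arcsOf, List.filter_map, List.filter_filter, arcsOf]
  congr 1
  refine List.filter_congr fun e _ => ?_
  simp [Bool.and_comm]

/-! ## Maximum flows -/

/-- `F` is a flow of value `v` from the root to `t`. -/
def Balanced (G : AugInstance) (F : Finset (Fin G.m)) (t v : ℕ) : Prop :=
  ∀ φ : ℕ → ℤ, ∑ e ∈ F, (φ (G.tail e) - φ (G.head e)) = v * (φ G.root - φ t)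

/-- An arc is used only when its residual tail is a new node, so no edge occurs twice on a path. The
path is therefore a set of edges over which potential differences telescope. -/
theorem exists_path_edges {J F : Finset (Fin G.m)} {t : ℕ} {x : Entry}
    (hx : x ∈ search (revAll (resArcs G J F)) [t]) :
    ∃ Q ⊆ J, (∀ e : Fin G.m, (e : ℕ) ∈ x.path ↔ e ∈ Q) ∧
      ∀ φ : ℕ → ℤ, ∑ e ∈ Q, (φ (resArc G F e).src - φ (resArc G F e).tgt) = φ x.node - φ t := by
  have key : ∀ L, Built (revAll (resArcs G J F)) [t] L → ∀ x ∈ L,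
      ∃ Q ⊆ J, (∀ e : Fin G.m, (e : ℕ) ∈ x.path ↔ e ∈ Q) ∧
        (∀ e ∈ Q, ∃ z ∈ L, z.node = (resArc G F e).src) ∧
        ∀ φ : ℕ → ℤ, ∑ e ∈ Q, (φ (resArc G F e).src - φ (resArc G F e).tgt) =
          φ x.node - φ t := by
    intro L h
    induction h with
    | init =>
      intro x hx
      simp only [List.map_cons, List.map_nil, List.mem_singleton] at hx
      subst hx
      exact ⟨∅, by simp, by simp [Entry.path], by simp, by simp [Entry.node]⟩
    | @step L y a _ hy ha hya hn ih =>
      intro x hx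
      rcases List.mem_cons.1 hx with rfl | hx
      · obtain ⟨Q, hQJ, hQ, hQL, hQφ⟩ := ih y hy
        obtain ⟨b, hb, rfl⟩ := mem_revAll.1 ha
        obtain ⟨e, heJ, rfl⟩ := mem_resArcs.1 hb
        have heQ : e ∉ Q := fun heQ => by
          obtain ⟨z, hz, hze⟩ := hQL e heQ
          exact hn z hz hze
        refine ⟨insert e Q, Finset.insert_subset heJ hQJ, fun e' => ?_, fun e' he' => ?_,
          fun φ => ?_⟩
        · have h1 : (y.ext (resArc G F e).rev).path = (resArc G F e).lab :: y.path := rfl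
          rw [h1, resArc_lab, List.mem_cons, Finset.mem_insert, hQ, Fin.ext_iff]
        · rcases Finset.mem_insert.1 he' with rfl | he'
          · exact ⟨_, List.mem_cons_self, rfl⟩
          · obtain ⟨z, hz, hze⟩ := hQL e' he'
            exact ⟨z, List.mem_cons_of_mem _ hz, hze⟩
        · rw [Finset.sum_insert heQ, hQφ]
          have h1 : (y.ext (resArc G F e).rev).node = (resArc G F e).src := rfl
          have h2 : y.node = (resArc G F e).tgt := hya
          rw [h1, h2]
          ring
      · obtain ⟨Q, hQJ, hQ, hQL, hQφ⟩ := ih x hx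
        refine ⟨Q, hQJ, hQ, fun e he => ?_, hQφ⟩
        obtain ⟨z, hz, hze⟩ := hQL e he
        exact ⟨z, List.mem_cons_of_mem _ hz, hze⟩
  obtain ⟨Q, hQJ, hQ, _, hQφ⟩ := key _ (search_built _ _) x hx
  exact ⟨Q, hQJ, hQ, hQφ⟩

/-- Edges of `Q` inside `F` are traversed backwards and cancelled, the others are added; this is
augmentation along `Q`. -/
theorem sum_symmDiff (F Q : Finset (Fin G.m)) (φ : ℕ → ℤ) :
    ∑ e ∈ symmDiff F Q, (φ (G.tail e) - φ (G.head e)) =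
      ∑ e ∈ F, (φ (G.tail e) - φ (G.head e)) +
        ∑ e ∈ Q, (φ (resArc G F e).src - φ (resArc G F e).tgt) := by
  rw [← Finset.sum_filter_add_sum_filter_not (symmDiff F Q) (· ∈ F),
    ← Finset.sum_filter_add_sum_filter_not F (· ∈ Q),
    ← Finset.sum_filter_add_sum_filter_not Q (· ∈ F)]
  have h1 : (symmDiff F Q).filter (· ∈ F) = F.filter (· ∉ Q) := by
    ext e; simp only [Finset.mem_filter, Finset.mem_symmDiff]; tauto
  have h2 : (symmDiff F Q).filter (· ∉ F) = Q.filter (· ∉ F) := by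
    ext e; simp only [Finset.mem_filter, Finset.mem_symmDiff]; tauto
  have h3 : F.filter (· ∈ Q) = Q.filter (· ∈ F) := by
    ext e; simp only [Finset.mem_filter]; tauto
  have h4 : ∑ e ∈ Q.filter (· ∈ F), (φ (resArc G F e).src - φ (resArc G F e).tgt) =
      -∑ e ∈ Q.filter (· ∈ F), (φ (G.tail e) - φ (G.head e)) := by
    rw [← Finset.sum_neg_distrib]
    refine Finset.sum_congr rfl fun e he => ?_
    rw [resArc, if_pos (Finset.mem_filter.1 he).2]
    simp [Arc.src, Arc.tgt]
  have h5 : ∑ e ∈ Q.filter (· ∉ F), (φ (resArc G F e).src - φ (resArc G F e).tgt) =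
      ∑ e ∈ Q.filter (· ∉ F), (φ (G.tail e) - φ (G.head e)) := by
    refine Finset.sum_congr rfl fun e he => ?_
    rw [resArc, if_neg (Finset.mem_filter.1 he).2]
  rw [h1, h2, h3, h4, h5]
  ring

/-- Testing a flow against all potentials `φ` encodes conservation and value in one identity. Here
`φ` is the indicator of `t`, for which an edge contributes at least `-1`. -/
theorem Balanced.le_card {F : Finset (Fin G.m)} {t v : ℕ} (h : Balanced G F t v)
    (ht : (G.root : ℕ) ≠ t) : v ≤ F.card := by
  have h1 := h fun u => if u = t then 1 else 0
  simp only [if_neg ht, if_true] at h1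
  have h2 : -(F.card : ℤ) ≤ ∑ e ∈ F, ((if (G.tail e : ℕ) = t then (1 : ℤ) else 0) -
      if (G.head e : ℕ) = t then 1 else 0) := by
    rw [Finset.card_eq_sum_ones, Nat.cast_sum, ← Finset.sum_neg_distrib]
    refine Finset.sum_le_sum fun e _ => ?_
    split_ifs <;> simp
  rw [h1] at h2
  have : (v : ℤ) ≤ F.card := by linarith
  exact_mod_cast this

/-- One augmentation keeps the invariants of the flow. -/
theorem augment_spec {J F : Finset (Fin G.m)} {t v : ℕ} (hFJ : F ⊆ J) (hF : Balanced G F t v) :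
    (pathsFrom (resArcs G J F) G.root t = [] ∧
        augment G.root t (resArcs G J F, v) = (resArcs G J F, v)) ∨
      ∃ F' ⊆ J, Balanced G F' t (v + 1) ∧
        augment G.root t (resArcs G J F, v) = (resArcs G J F', v + 1) := by
  by_cases hp : pathsFrom (resArcs G J F) G.root t = []
  · exact .inl ⟨hp, by simp [augment, hp]⟩
  · right
    obtain ⟨x, l, hxl⟩ := List.exists_cons_of_ne_nil hp
    have hx : x ∈ pathsFrom (resArcs G J F) G.root t := by rw [hxl]; simp
    simp only [pathsFrom, List.mem_filter, decide_eq_true_eq] at hx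
    obtain ⟨hx, hxr⟩ := hx
    obtain ⟨Q, hQJ, hQ, hQφ⟩ := exists_path_edges hx
    refine ⟨symmDiff F Q, ?_, fun φ => ?_, ?_⟩
    · intro e he
      rcases Finset.mem_symmDiff.1 he with h | h
      exacts [hFJ h.1, hQJ h.1]
    · rw [sum_symmDiff, hF φ, hQφ, hxr]
      push_cast
      ring
    · rw [augment, if_neg hp]
      refine Prod.ext ?_ rfl
      simp only [hxl, List.headD_cons]
      simp only [resArcs, List.map_map]
      refine List.map_congr_left fun e _ => ?_
      simp only [Function.comp_apply, resArc_lab, hQ]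
      unfold resArc
      simp only [Finset.mem_symmDiff]
      by_cases h1 : e ∈ F <;> by_cases h2 : e ∈ Q <;>
        simp [h1, h2, Arc.rev, Arc.src, Arc.tgt, Arc.len, Arc.lab]

/-- Each successful round raises the value by one, and the value never exceeds the number of edges
of `J`, which is the number of rounds. So no augmenting path survives the last round. -/
theorem maxFlow_spec (J : Finset (Fin G.m)) {t : ℕ} (ht : (G.root : ℕ) ≠ t) :
    ∃ F ⊆ J, ∃ v, maxFlow (arcsOf G c J) G.root t = (resArcs G J F, v) ∧ Balanced G F t v ∧
      (G.root : ℕ) ∉ reach (revAll (resArcs G J F)) [t] := by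
  have key : ∀ l : List Arc, ∃ F ⊆ J, ∃ v,
      l.foldl (fun s _ => augment G.root t s) ((arcsOf G c J).map fun a => a.free, 0) =
        (resArcs G J F, v) ∧ Balanced G F t v ∧
      (pathsFrom (resArcs G J F) G.root t = [] ∨ v = l.length) := by
    intro l
    induction l using List.reverseRecOn with
    | nil =>
      refine ⟨∅, by simp, 0, ?_, fun φ => by simp, .inr rfl⟩
      simp [arcsOf, resArcs, arcOf, resArc, Arc.free, Function.comp_def]
    | append_singleton l a ih =>
      obtain ⟨F, hFJ, v, he, hb, hv⟩ := ih
      simp only [List.foldl_append, List.foldl_cons, List.foldl_nil, he]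
      rcases augment_spec hFJ hb with ⟨h1, h2⟩ | ⟨F', hF', hb', h2⟩
      · exact ⟨F, hFJ, v, h2, hb, .inl h1⟩
      · refine ⟨F', hF', v + 1, h2, hb', .inr ?_⟩
        rcases hv with hv | hv
        · rw [augment, if_pos hv] at h2
          have := congrArg Prod.snd h2
          simp at this
        · simp [hv]
  obtain ⟨F, hFJ, v, he, hb, hv⟩ := key (arcsOf G c J)
  refine ⟨F, hFJ, v, he, hb, fun hr => ?_⟩
  have hne : pathsFrom (resArcs G J F) G.root t ≠ [] := by
    obtain ⟨x, hx, hxr⟩ := List.mem_map.1 hr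
    exact List.ne_nil_of_mem (a := x) (by simp [pathsFrom, hx, hxr])
  rcases augment_spec hFJ hb with ⟨h1, _⟩ | ⟨F', hF', hb', _⟩
  · exact hne h1
  · have h1 := hb'.le_card ht
    have h2 := Finset.card_le_card hF'
    have h3 := hv.resolve_left hne
    rw [length_arcsOf] at h3
    omega

end RootedAug

namespace RootedAug

/-! ## Cuts and Menger's theorem -/

variable {G : AugInstance} {c : Fin G.m → ℕ}

open Classical in
/-- The number of edges of `J` that enter `A`. -/
noncomputable def cut (G : AugInstance) (J : Finset (Fin G.m)) (A : Set ℕ) : ℕ :=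
  (J.filter fun e => (G.head e : ℕ) ∈ A ∧ (G.tail e : ℕ) ∉ A).card

-- Test the flow with the indicator of `A`. A flow edge entering `A` ceases to enter it in the
-- residual graph, and one leaving `A` becomes an entering arc. The cut thus exceeds the residual
-- cut by the net flow into `A`, which is `v`.
open Classical in
theorem cut_eq_of_balanced {J F : Finset (Fin G.m)} {t v : ℕ} (hFJ : F ⊆ J)
    (hF : Balanced G F t v) {A : Set ℕ} (ht : t ∈ A) (hr : (G.root : ℕ) ∉ A) :
    cut G J A =
      v + (J.filter fun e => (resArc G F e).tgt ∈ A ∧ (resArc G F e).src ∉ A).card := by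
  have h := hF fun u => if u ∈ A then 1 else 0
  simp only [if_neg hr, if_pos ht] at h
  have key : (cut G J A : ℤ) - (J.filter fun e =>
      (resArc G F e).tgt ∈ A ∧ (resArc G F e).src ∉ A).card =
      -∑ e ∈ F, ((if (G.tail e : ℕ) ∈ A then (1 : ℤ) else 0) -
        if (G.head e : ℕ) ∈ A then 1 else 0) := by
    rw [cut, Finset.card_filter, Finset.card_filter, Nat.cast_sum, Nat.cast_sum,
      ← Finset.sum_sub_distrib, ← Finset.sum_neg_distrib, ← Finset.sum_subset hFJ]
    · refine Finset.sum_congr rfl fun e he => ?_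
      rw [resArc, if_pos he]
      by_cases h1 : (G.head e : ℕ) ∈ A <;> by_cases h2 : (G.tail e : ℕ) ∈ A <;>
        simp [h1, h2, Arc.src, Arc.tgt]
    · intro e _ he
      rw [resArc, if_neg he]
      simp [Arc.src, Arc.tgt]
  rw [h] at key
  zify
  linarith

theorem le_cut_of_balanced {J F : Finset (Fin G.m)} {t v : ℕ} (hFJ : F ⊆ J)
    (hF : Balanced G F t v) {A : Set ℕ} (ht : t ∈ A) (hr : (G.root : ℕ) ∉ A) :
    v ≤ cut G J A := by
  rw [cut_eq_of_balanced hFJ hF ht hr]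
  omega

/-- The number of residual arcs that enter `A` is the excess of the cut over `v`. This turns
tightness into closure under residual predecessors, hence questions about minimal and maximal tight
sets into reachability. -/
theorem cut_eq_iff {J F : Finset (Fin G.m)} {t v : ℕ} (hFJ : F ⊆ J)
    (hF : Balanced G F t v) {A : Set ℕ} (ht : t ∈ A) (hr : (G.root : ℕ) ∉ A) :
    cut G J A = v ↔ ∀ a ∈ resArcs G J F, a.tgt ∈ A → a.src ∈ A := by
  classical
  rw [cut_eq_of_balanced hFJ hF ht hr, Nat.add_eq_left, Finset.card_eq_zero,
    Finset.filter_eq_empty_iff]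
  constructor
  · intro h a ha hat
    obtain ⟨e, he, rfl⟩ := mem_resArcs.1 ha
    exact by_contra fun hs => h he ⟨hat, hs⟩
  · rintro h e he ⟨h1, h2⟩
    exact h2 (h _ (mem_resArcs.2 ⟨e, he, rfl⟩) h1)

/-- The nodes that reach `t` along the arcs of `D`. -/
def coreSet (D : List Arc) (t : ℕ) : Set ℕ := {u | u ∈ reach (revAll D) [t]}

theorem self_mem_coreSet (D : List Arc) (t : ℕ) : t ∈ coreSet D t :=
  mem_reach_of_mem (by simp)

theorem coreSet_closed {D : List Arc} {t : ℕ} {a : Arc} (ha : a ∈ D) (h : a.tgt ∈ coreSet D t) :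
    a.src ∈ coreSet D t :=
  reach_closed (mem_revAll.2 ⟨a, ha, rfl⟩) h

theorem coreSet_subset {D : List Arc} {t : ℕ} {A : Set ℕ} (ht : t ∈ A)
    (h : ∀ a ∈ D, a.tgt ∈ A → a.src ∈ A) : coreSet D t ⊆ A := by
  refine fun u hu => reach_induction (P := (· ∈ A)) (by simpa using ht) (fun b hb hbA => ?_) u hu
  obtain ⟨a, ha, rfl⟩ := mem_revAll.1 hb
  exact h a ha hbA

theorem IsWalk.exists_entering {p : List (Fin G.m)} {s t : Fin G.n} (h : G.IsWalk p s t)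
    {A : Set ℕ} (hs : (s : ℕ) ∉ A) (ht : (t : ℕ) ∈ A) :
    ∃ e ∈ p, (G.head e : ℕ) ∈ A ∧ (G.tail e : ℕ) ∉ A := by
  induction h with
  | nil => exact absurd ht hs
  | cons e _ ih =>
    by_cases h : (G.head e : ℕ) ∈ A
    · exact ⟨e, by simp, h, hs⟩
    · obtain ⟨e', he', h'⟩ := ih h ht
      exact ⟨e', by simp [he'], h'⟩

theorem le_cut_of_hasDisjointPaths {J : Finset (Fin G.m)} {q : ℕ} {s t : Fin G.n}
    (h : G.HasDisjointPaths J q s t) {A : Set ℕ} (hs : (s : ℕ) ∉ A) (ht : (t : ℕ) ∈ A) :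
    q ≤ cut G J A := by
  classical
  obtain ⟨P, hP, hd⟩ := h
  choose f hf hfA using fun i => IsWalk.exists_entering (hP i).1.1 hs ht
  have hinj : Function.Injective f := fun i j hij => by
    by_contra hne
    exact hd i j hne (hf i) (hij ▸ hf j)
  have := Finset.card_le_card_of_injOn (s := (Finset.univ : Finset (Fin q))) (t := J.filter
    fun e => (G.head e : ℕ) ∈ A ∧ (G.tail e : ℕ) ∉ A) f
    (fun i _ => by simpa using ⟨(hP i).2 _ (hf i), hfA i⟩) hinj.injOn
  simpa [cut] using this

theorem IsWalk.snoc {p : List (Fin G.m)} {s u : Fin G.n} (h : G.IsWalk p s u) (e : Fin G.m)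
    (he : G.tail e = u) : G.IsWalk (p ++ [e]) s (G.head e) := by
  induction h with
  | nil s => subst he; exact .cons e (.nil _)
  | cons e' _ ih => exact .cons e' (ih he)

theorem IsWalk.sum_eq {p : List (Fin G.m)} {s t : Fin G.n} (h : G.IsWalk p s t) (φ : ℕ → ℤ) :
    (p.map fun e => φ (G.tail e) - φ (G.head e)).sum = φ s - φ t := by
  induction h with
  | nil => simp
  | cons e _ ih => rw [List.map_cons, List.sum_cons, ih]; ring

theorem IsPath.exists_suffix {p : List (Fin G.m)} {s t u : Fin G.n} (h : G.IsPath p s t)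
    (hu : u ∈ s :: p.map G.head) : ∃ p' ⊆ p, G.IsPath p' u t := by
  obtain ⟨hw, hn⟩ := h
  induction hw with
  | nil s =>
    simp only [List.map_nil, List.mem_singleton] at hu
    subst hu
    exact ⟨[], by simp, .nil _, by simp⟩
  | @cons e p t hw ih =>
    rcases List.mem_cons.1 hu with rfl | hu
    · exact ⟨_, List.Subset.refl _, .cons e hw, hn⟩
    · obtain ⟨p', hp', h'⟩ := ih hu (List.nodup_cons.1 hn).2
      exact ⟨p', fun x hx => List.mem_cons_of_mem _ (hp' hx), h'⟩

theorem IsWalk.exists_path {p : List (Fin G.m)} {s t : Fin G.n} (h : G.IsWalk p s t) :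
    ∃ p' ⊆ p, G.IsPath p' s t := by
  induction h with
  | nil s => exact ⟨[], by simp, .nil _, by simp⟩
  | @cons e p t _ ih =>
    obtain ⟨p', hp', h'⟩ := ih
    by_cases hmem : G.tail e ∈ G.head e :: p'.map G.head
    · obtain ⟨q, hq, hqp⟩ := IsPath.exists_suffix h' hmem
      exact ⟨q, fun x hx => List.mem_cons_of_mem _ (hp' (hq hx)), hqp⟩
    · exact ⟨e :: p', List.cons_subset_cons _ hp', .cons e h'.1, List.nodup_cons.2 ⟨hmem, h'.2⟩⟩

/-- A flow of positive value contains a path. -/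
theorem Balanced.exists_path {F : Finset (Fin G.m)} {t : Fin G.n} {v : ℕ}
    (h : Balanced G F t (v + 1)) : ∃ p, G.IsPath p G.root t ∧ ∀ e ∈ p, e ∈ F := by
  classical
  -- The nodes reachable from the root inside `F`. No flow edge leaves `X`, so if `t` were outside,
  -- the net flow out of `X` could not be positive.
  let X : Set ℕ := {u | ∃ w : Fin G.n, (w : ℕ) = u ∧ ∃ p, G.IsWalk p G.root w ∧ ∀ e ∈ p, e ∈ F}
  by_cases ht : (t : ℕ) ∈ X
  · obtain ⟨w, hw, p, hp, hpF⟩ := ht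
    obtain rfl := Fin.ext hw
    obtain ⟨p', hp', h'⟩ := IsWalk.exists_path hp
    exact ⟨p', h', fun e he => hpF e (hp' he)⟩
  · exfalso
    have hr : (G.root : ℕ) ∈ X := ⟨G.root, rfl, [], .nil _, by simp⟩
    have h1 := h fun u => if u ∈ X then 1 else 0
    simp only [if_pos hr, if_neg ht] at h1
    have h2 : ∑ e ∈ F, ((if (G.tail e : ℕ) ∈ X then (1 : ℤ) else 0) -
        if (G.head e : ℕ) ∈ X then 1 else 0) ≤ 0 := by
      refine Finset.sum_nonpos fun e he => ?_
      by_cases h3 : (G.tail e : ℕ) ∈ X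
      · have h4 : (G.head e : ℕ) ∈ X := by
          obtain ⟨w, hw, p, hp, hpF⟩ := h3
          refine ⟨_, rfl, _, IsWalk.snoc hp e (Fin.ext hw).symm, fun e' he' => ?_⟩
          rcases List.mem_append.1 he' with h | h
          · exact hpF _ h
          · rwa [List.mem_singleton.1 h]
        simp [h3, h4]
      · rw [if_neg h3]
        split_ifs <;> simp
    rw [h1] at h2
    push_cast at h2
    linarith

/-- Removing the edges of one path leaves a flow whose value is smaller by one. -/
theorem Balanced.hasDisjointPaths {t : Fin G.n} : ∀ {v : ℕ} {F : Finset (Fin G.m)},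
    Balanced G F t v → G.HasDisjointPaths F v G.root t
  | 0, F, _ => ⟨Fin.elim0, fun i => i.elim0, fun i => i.elim0⟩
  | v + 1, F, h => by
    obtain ⟨p, hp, hpF⟩ := h.exists_path
    have hnd : p.Nodup := List.Nodup.of_map _ (List.nodup_cons.1 hp.2).2
    have hsub : p.toFinset ⊆ F := fun e he => hpF e (List.mem_toFinset.1 he)
    have hb : Balanced G (F \ p.toFinset) t v := fun φ => by
      have h1 := Finset.sum_sdiff (f := fun e => φ (G.tail e) - φ (G.head e)) hsub
      have h2 := List.sum_toFinset (fun e => φ (G.tail e) - φ (G.head e)) hnd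
      rw [IsWalk.sum_eq hp.1] at h2
      rw [h φ, h2] at h1
      push_cast at h1
      linarith
    obtain ⟨P, hP, hd⟩ := hb.hasDisjointPaths
    have hdis : ∀ i, (P i).Disjoint p := fun i e he hep => by
      have := (hP i).2 e he
      simp [hep] at this
    refine ⟨Fin.cons p P, fun i => ?_, fun i j hij => ?_⟩
    · refine Fin.cases ⟨hp, hpF⟩ (fun i => ?_) i
      simp only [Fin.cons_succ]
      exact ⟨(hP i).1, fun e he => (Finset.mem_sdiff.1 ((hP i).2 e he)).1⟩
    · revert hij
      refine Fin.cases ?_ (fun i => ?_) i <;> refine Fin.cases ?_ (fun j => ?_) j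
      · exact fun h => absurd rfl h
      · intro _
        simpa using (hdis j).symm
      · intro _
        simpa using hdis i
      · intro hij
        simpa using hd i j fun h => hij (by rw [h])

theorem HasDisjointPaths.mono {J J' : Finset (Fin G.m)} {q q' : ℕ} {s t : Fin G.n}
    (h : G.HasDisjointPaths J q s t) (hJ : J ⊆ J') (hq : q' ≤ q) :
    G.HasDisjointPaths J' q' s t := by
  obtain ⟨P, hP, hd⟩ := h
  exact ⟨fun i => P (Fin.castLE hq i), fun i => ⟨(hP _).1, fun e he => hJ ((hP _).2 e he)⟩,
    fun i j hij => hd _ _ fun h => hij (Fin.castLE_injective hq h)⟩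

/-- Menger's theorem. For sufficiency, the nodes that reach `t` in the residual graph of a maximum
flow form a cut whose size is the value of the flow. -/
theorem hasDisjointPaths_iff {J : Finset (Fin G.m)} {q : ℕ} {t : Fin G.n} (ht : G.root ≠ t) :
    G.HasDisjointPaths J q G.root t ↔
      ∀ A : Set ℕ, (t : ℕ) ∈ A → (G.root : ℕ) ∉ A → q ≤ cut G J A := by
  refine ⟨fun h A hA hr => le_cut_of_hasDisjointPaths h hr hA, fun h => ?_⟩
  obtain ⟨F, hFJ, v, _, hb, hr⟩ := maxFlow_spec (c := fun _ => 0) J (t := t)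
    fun h => ht (Fin.ext h)
  have hv := (cut_eq_iff hFJ hb (self_mem_coreSet (resArcs G J F) t) hr).2
    fun a ha h => coreSet_closed ha h
  have := h _ (self_mem_coreSet (resArcs G J F) t) hr
  exact HasDisjointPaths.mono hb.hasDisjointPaths hFJ (by omega)

/-- The set of terminals, as natural numbers. -/
def termSet (G : AugInstance) : Set ℕ := {u | ∃ t ∈ G.terminals, (t : ℕ) = u}

theorem root_ne_of_mem {t : Fin G.n} (ht : t ∈ G.terminals) : G.root ≠ t :=
  fun h => G.root_notMem (h ▸ ht)

theorem feasible_iff {J : Finset (Fin G.m)} : G.Feasible J ↔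
    ∀ A : Set ℕ, (A ∩ termSet G).Nonempty → (G.root : ℕ) ∉ A → G.k ≤ cut G J A := by
  constructor
  · rintro h A ⟨_, hA, t, ht, rfl⟩ hr
    exact (hasDisjointPaths_iff (root_ne_of_mem ht)).1 (h t ht) A hA hr
  · exact fun h t ht => (hasDisjointPaths_iff (root_ne_of_mem ht)).2
      fun A hA hr => h A ⟨t, hA, t, ht, rfl⟩ hr

theorem cut_mono {J J' : Finset (Fin G.m)} (h : J ⊆ J') (A : Set ℕ) : cut G J A ≤ cut G J' A := by
  classical exact Finset.card_le_card (Finset.filter_subset_filter _ h)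

theorem cut_submodular (J : Finset (Fin G.m)) (A B : Set ℕ) :
    cut G J (A ∩ B) + cut G J (A ∪ B) ≤ cut G J A + cut G J B := by
  classical
  simp only [cut, Finset.card_filter, ← Finset.sum_add_distrib]
  refine Finset.sum_le_sum fun e _ => ?_
  simp only [Set.mem_inter_iff, Set.mem_union]
  by_cases h1 : (G.head e : ℕ) ∈ A <;> by_cases h2 : (G.head e : ℕ) ∈ B <;>
    by_cases h3 : (G.tail e : ℕ) ∈ A <;> by_cases h4 : (G.tail e : ℕ) ∈ B <;>
      simp [h1, h2, h3, h4]

end RootedAug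

namespace RootedAug

/-! ## Cores of set families -/

/-- Two members that share an element of `T` have their intersection in the family. -/
def InterClosed (𝓕 : Set (Set ℕ)) (T : Set ℕ) : Prop :=
  ∀ A ∈ 𝓕, ∀ B ∈ 𝓕, (A ∩ B ∩ T).Nonempty → A ∩ B ∈ 𝓕

/-- The minimal members of the family are the sets `C t` for the representatives `t ∈ R`. -/
structure Cores (𝓕 : Set (Set ℕ)) (T : Set ℕ) (R : Finset ℕ) (C : ℕ → Set ℕ) : Prop where
  mem : ∀ t ∈ R, C t ∈ 𝓕
  self_mem : ∀ t ∈ R, t ∈ C t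
  term : ∀ t ∈ R, t ∈ T
  exists_subset : ∀ A ∈ 𝓕, ∃ t ∈ R, C t ⊆ A
  inj : ∀ t ∈ R, ∀ t' ∈ R, t ∈ C t' → t = t'

section

variable {𝓕 𝓕' : Set (Set ℕ)} {T : Set ℕ} {R R' : Finset ℕ} {C C' : ℕ → Set ℕ}

theorem Cores.exists_mem (h : Cores 𝓕 T R C) {A : Set ℕ} (hA : A ∈ 𝓕) : ∃ t ∈ R, t ∈ A := by
  obtain ⟨t, ht, htA⟩ := h.exists_subset A hA
  exact ⟨t, ht, htA (h.self_mem t ht)⟩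

/-- The intersection is a member, so it contains the representative of some core; lying in both
cores, this equals both `t` and `t'`. -/
theorem Cores.eq_of_inter (h : Cores 𝓕 T R C) (hI : InterClosed 𝓕 T) {t t' : ℕ} (ht : t ∈ R)
    (ht' : t' ∈ R) (hne : (C t ∩ C t' ∩ T).Nonempty) : t = t' := by
  obtain ⟨s, hs, hsA⟩ := h.exists_mem (hI _ (h.mem t ht) _ (h.mem t' ht') hne)
  rw [← h.inj s hs t ht hsA.1, h.inj s hs t' ht' hsA.2]

/-- If every new core that meets `S` contains another old core, and there is at most one such core,
then the number of cores drops by at least `|S| / 2`, and by `|S|` if such a core contains an old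
core that is not in `S`. -/
theorem card_cores_drop (h : Cores 𝓕 T R C) (hsub : 𝓕' ⊆ 𝓕) (hI' : InterClosed 𝓕' T)
    (h' : Cores 𝓕' T R' C') {S : Finset ℕ} (hS : S ⊆ R) (hSne : S.Nonempty)
    (hother : ∀ t ∈ S, ∀ A ∈ 𝓕', t ∈ A → ∃ t' ∈ R, t' ≠ t ∧ t' ∈ A)
    (honce : ∀ t ∈ S, ∀ t' ∈ S, ∀ A ∈ 𝓕', ∀ B ∈ 𝓕', t ∈ A → t' ∈ B → (A ∩ B ∩ T).Nonempty) :
    S.card + 2 * R'.card ≤ 2 * R.card ∧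
      ((∀ t ∈ S, ∀ A ∈ 𝓕', t ∈ A → ∃ t' ∈ R, t' ∉ S ∧ t' ∈ A) → S.card + R'.card ≤ R.card) := by
  classical
  -- Every new core contains an old one, whose representative is `κ`. New cores that share an old
  -- representative coincide, so `κ` is injective.
  choose! κ hκR hκ using fun t (ht : t ∈ R') => h.exists_mem (hsub (h'.mem t ht))
  have hinj : ∀ t ∈ R', ∀ t' ∈ R', ∀ s ∈ R, s ∈ C' t → s ∈ C' t' → t = t' :=
    fun t ht t' ht' s hs h1 h2 => h'.eq_of_inter hI' ht ht' ⟨s, ⟨h1, h2⟩, h.term s hs⟩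
  have hSpos := hSne.card_pos
  by_cases hex : ∃ t' ∈ R', ∃ t ∈ S, t ∈ C' t'
  · obtain ⟨a, ha, t, htS, hta⟩ := hex
    -- By `honce`, `a` is the only new core that meets `S`. All the others choose their `κ` outside
    -- `S` and outside `C' a`.
    let K : Finset ℕ := S ∪ R.filter (· ∈ C' a)
    have hKR : K ⊆ R := Finset.union_subset hS (Finset.filter_subset _ _)
    have hle : (R'.erase a).card ≤ (R \ K).card := by
      refine Finset.card_le_card_of_injOn κ (fun t' ht' => ?_) (fun t' ht' s' hs' he => ?_)
      · obtain ⟨hne, ht'⟩ := Finset.mem_erase.1 (Finset.mem_coe.1 ht')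
        refine Finset.mem_coe.2 (Finset.mem_sdiff.2 ⟨hκR t' ht', fun hK => ?_⟩)
        rcases Finset.mem_union.1 hK with hK | hK
        · exact hne (h'.eq_of_inter hI' ht' ha
            (honce _ hK t htS _ (h'.mem t' ht') _ (h'.mem a ha) (hκ t' ht') hta))
        · exact hne (hinj t' ht' a ha _ (hκR t' ht') (hκ t' ht') (Finset.mem_filter.1 hK).2)
      · have ht' := (Finset.mem_erase.1 (Finset.mem_coe.1 ht')).2
        have hs' := (Finset.mem_erase.1 (Finset.mem_coe.1 hs')).2
        exact hinj t' ht' s' hs' _ (hκR t' ht') (hκ t' ht') (he ▸ hκ s' hs')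
    rw [Finset.card_erase_of_mem ha, Finset.card_sdiff_of_subset hKR] at hle
    have hKle := Finset.card_le_card hKR
    have hSK : S.card ≤ K.card := Finset.card_le_card Finset.subset_union_left
    have hapos : 0 < R'.card := Finset.card_pos.2 ⟨a, ha⟩
    constructor
    -- The loss is at least `|K| - 1` with `|K| ≥ max |S| 2`, and this is at least `|S| / 2`. The
    -- bound 2 matters only when `S` is a singleton.
    · obtain ⟨t', ht'R, hne, ht'⟩ := hother t htS _ (h'.mem a ha) hta
      have : 2 ≤ K.card := by
        rw [← Finset.card_pair hne]
        refine Finset.card_le_card fun x hx => ?_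
        rcases Finset.mem_insert.1 hx with rfl | hx
        · exact Finset.mem_union_right _ (Finset.mem_filter.2 ⟨ht'R, ht'⟩)
        · exact Finset.mem_union_left _ (Finset.mem_singleton.1 hx ▸ htS)
      omega
    · intro hout
      obtain ⟨t', ht'R, hnS, ht'⟩ := hout t htS _ (h'.mem a ha) hta
      have : (insert t' S).card ≤ K.card := by
        refine Finset.card_le_card fun x hx => ?_
        rcases Finset.mem_insert.1 hx with rfl | hx
        · exact Finset.mem_union_right _ (Finset.mem_filter.2 ⟨ht'R, ht'⟩)
        · exact Finset.mem_union_left _ hx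
      rw [Finset.card_insert_of_notMem hnS] at this
      omega
  · push Not at hex
    have hle : R'.card ≤ (R \ S).card := by
      refine Finset.card_le_card_of_injOn κ (fun t' ht' => ?_) (fun t' ht' s' hs' he => ?_)
      · exact Finset.mem_coe.2 (Finset.mem_sdiff.2
          ⟨hκR t' ht', fun hK => hex t' ht' _ hK (hκ t' ht')⟩)
      · exact hinj t' ht' s' hs' _ (hκR t' ht') (hκ t' ht') (he ▸ hκ s' hs')
    rw [Finset.card_sdiff_of_subset hS] at hle
    have := Finset.card_le_card hS
    exact ⟨by omega, fun _ => by omega⟩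

end

/-! ## The dual bound -/

/-- An edge from `u` to `w` of cost `c` pays for the potential drops along it. -/
theorem sum_drop_le {R : Finset ℕ} {M : ℕ → Set ℕ} {T : Set ℕ} {h : ℕ → ℕ → ℕ} {B c u w : ℕ}
    (hB : ∀ t x, h t x ≤ B) (hout : ∀ t ∈ R, ∀ x, x ∉ M t → h t x = B)
    (hin : ∀ t ∈ R, u ∈ M t → w ∈ M t → h t u ≤ h t w + c)
    (hdisj : ∀ t ∈ R, ∀ t' ∈ R, ∀ z ∈ T, z ∈ M t → z ∈ M t' → t = t')
    (hqb : ∀ t ∈ R, u ∈ M t → w ∈ M t → u ∈ T ∨ w ∈ T)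
    (hS : ∀ S : Finset ℕ, S.Nonempty → (∀ t, t ∈ S ↔ t ∈ R ∧ u ∉ M t ∧ h t w < B) →
      B * S.card ≤ c + ∑ t ∈ S, h t w ∧
        (u ∈ T → (∃ t ∈ R, u ∈ M t) → 2 * (B * S.card) ≤ c + ∑ t ∈ S, h t w)) :
    ∑ t ∈ R, (h t u - h t w) ≤ c := by
  classical
  -- A drop can be nonzero only for `t ∈ S`, where the edge enters `M t`, or if both ends lie in `M
  -- t`. The second case occurs for at most one `t`, as one end is then in `T` and the sets `M t`
  -- share no element of `T`.
  let S : Finset ℕ := R.filter fun t => u ∉ M t ∧ h t w < B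
  have hmemS : ∀ t, t ∈ S ↔ t ∈ R ∧ u ∉ M t ∧ h t w < B := fun t => Finset.mem_filter
  have hSR : S ⊆ R := Finset.filter_subset _ _
  have hsumS : ∑ t ∈ S, (h t u - h t w) + ∑ t ∈ S, h t w = B * S.card := by
    rw [← Finset.sum_add_distrib, mul_comm, ← smul_eq_mul, ← Finset.sum_const]
    refine Finset.sum_congr rfl fun t ht => ?_
    obtain ⟨htR, hu, hw⟩ := (hmemS t).1 ht
    rw [hout t htR u hu]
    omega
  have hzero : ∀ t ∈ R, u ∉ M t → t ∉ S → h t u - h t w = 0 := by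
    intro t ht hu htS
    have : ¬ h t w < B := fun hw => htS ((hmemS t).2 ⟨ht, hu, hw⟩)
    have := hB t u
    omega
  rcases S.eq_empty_or_nonempty with hSe | hSne
  · by_cases hex : ∃ t ∈ R, h t u - h t w ≠ 0
    · obtain ⟨t, ht, hne⟩ := hex
      have hu : u ∈ M t := by_contra fun hu => hne (hzero t ht hu (by simp [hSe]))
      have hw : w ∈ M t := by_contra fun hw => hne (by
        have := hout t ht w hw
        have := hB t u
        omega)
      rw [Finset.sum_eq_single_of_mem t ht]
      · have := hin t ht hu hw
        omega
      · intro t' ht' hne'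
        by_contra h0
        have hu' : u ∈ M t' := by_contra fun hu => h0 (hzero t' ht' hu (by simp [hSe]))
        have hw' : w ∈ M t' := by_contra fun hw => h0 (by
          have := hout t' ht' w hw
          have := hB t' u
          omega)
        rcases hqb t ht hu hw with hz | hz
        · exact hne' (hdisj t' ht' t ht u hz hu' hu)
        · exact hne' (hdisj t' ht' t ht w hz hw' hw)
    · push Not at hex
      rw [Finset.sum_eq_zero hex]
      exact Nat.zero_le _
  · obtain ⟨hS1, hS2⟩ := hS S hSne hmemS
    obtain ⟨s, hs⟩ := hSne
    obtain ⟨hsR, hsu, hsw⟩ := (hmemS s).1 hs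
    have hswM : w ∈ M s := by_contra fun hw => by
      have := hout s hsR w hw
      omega
    by_cases hex : ∃ t ∈ R, t ∉ S ∧ h t u - h t w ≠ 0
    · obtain ⟨t, ht, htS, hne⟩ := hex
      have hu : u ∈ M t := by_contra fun hu => hne (hzero t ht hu htS)
      have hw : w ∈ M t := by_contra fun hw => hne (by
        have := hout t ht w hw
        have := hB t u
        omega)
      -- The head `w` lies in `M s` for `s ∈ S` as well, so it cannot be the end in `T`. Hence the
      -- tail is, and the stronger half of `hS` applies.
      have huT : u ∈ T := by
        rcases hqb t ht hu hw with hz | hz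
        · exact hz
        · have := hdisj s hsR t ht w hz hswM hw
          exact absurd (this ▸ hs) htS
      have h2 := hS2 huT ⟨t, ht, hu⟩
      have hsplit : ∑ t ∈ R, (h t u - h t w) =
          ∑ t ∈ S, (h t u - h t w) + (h t u - h t w) := by
        rw [← Finset.sum_sdiff hSR, add_comm]
        congr 1
        refine Finset.sum_eq_single_of_mem t (Finset.mem_sdiff.2 ⟨ht, htS⟩) fun t' ht' hne' => ?_
        obtain ⟨ht'R, ht'S⟩ := Finset.mem_sdiff.1 ht'
        by_contra h0
        have hu' : u ∈ M t' := by_contra fun hu => h0 (hzero t' ht'R hu ht'S)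
        exact hne' (hdisj t' ht'R t ht u huT hu' hu)
      rw [hsplit]
      have hcard : 1 ≤ S.card := Finset.card_pos.2 ⟨s, hs⟩
      -- The stronger bound leaves a surplus of `B * S.card ≥ B`, which pays for the drop at `t`.
      have hBS : B * 1 ≤ B * S.card := Nat.mul_le_mul_left _ hcard
      have := hB t u
      omega
    · push Not at hex
      rw [← Finset.sum_subset hSR hex]
      omega

/-- Weak duality for potentials all of whose level sets are entered by `p` edges. -/
theorem mul_le_sum_drop {ι : Type} {N : Finset ι} {hd tl : ι → ℕ} {h : ℕ → ℕ} {B p : ℕ}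
    (hp : ∀ θ < B, p ≤ (N.filter fun e => h (hd e) ≤ θ ∧ ¬ h (tl e) ≤ θ).card) :
    p * B ≤ ∑ e ∈ N, (h (tl e) - h (hd e)) := by
  calc p * B = ∑ _θ ∈ Finset.range B, p := by simp [mul_comm]
    _ ≤ ∑ θ ∈ Finset.range B, (N.filter fun e => h (hd e) ≤ θ ∧ ¬ h (tl e) ≤ θ).card :=
        Finset.sum_le_sum fun θ hθ => hp θ (Finset.mem_range.1 hθ)
    _ = ∑ e ∈ N, ((Finset.range B).filter fun θ => h (hd e) ≤ θ ∧ ¬ h (tl e) ≤ θ).card := by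
        simp only [Finset.card_filter]
        exact Finset.sum_comm
    _ ≤ ∑ e ∈ N, (h (tl e) - h (hd e)) := by
        refine Finset.sum_le_sum fun e _ => ?_
        rw [← Nat.card_Ico]
        refine Finset.card_le_card fun θ hθ => ?_
        simp only [Finset.mem_filter, not_le] at hθ
        exact Finset.mem_Ico.2 hθ.2

end RootedAug

namespace RootedAug

/-! ## One step of the algorithm -/

variable {G : AugInstance} {c : Fin G.m → ℕ}

/-- Every set that separates a terminal from the root is entered by at least `v` edges of `J`. -/
def CutsGe (G : AugInstance) (J : Finset (Fin G.m)) (v : ℕ) : Prop :=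
  ∀ A : Set ℕ, (A ∩ termSet G).Nonempty → (G.root : ℕ) ∉ A → v ≤ cut G J A

/-- The sets that separate a terminal from the root and are entered by `v` edges of `J`. -/
def tightSets (G : AugInstance) (J : Finset (Fin G.m)) (v : ℕ) : Set (Set ℕ) :=
  {A | (A ∩ termSet G).Nonempty ∧ (G.root : ℕ) ∉ A ∧ cut G J A = v}

/-- Uncrossing: intersection and union both have cuts of size at least `v`, so equality holds in
submodularity. -/
theorem interClosed_tightSets {J : Finset (Fin G.m)} {v : ℕ} (h : CutsGe G J v) :
    InterClosed (tightSets G J v) (termSet G) := by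
  rintro A ⟨hA, hrA, hvA⟩ B ⟨hB, hrB, hvB⟩ hAB
  have h1 := h (A ∩ B) hAB fun hr => hrA hr.1
  have h2 := h (A ∪ B) (hA.mono (by gcongr; exact Set.subset_union_left))
    fun hr => hr.elim hrA hrB
  have h3 := cut_submodular J A B
  exact ⟨hAB, fun hr => hrA hr.1, by omega⟩

theorem tightSets_anti {J J' : Finset (Fin G.m)} {v : ℕ} (h : CutsGe G J v) (hJ : J ⊆ J') :
    tightSets G J' v ⊆ tightSets G J v := by
  rintro A ⟨hA, hrA, hvA⟩
  exact ⟨hA, hrA, le_antisymm (hvA ▸ cut_mono hJ A) (h A hA hrA)⟩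

/-- Edges of `J` alone already account for `v` entering edges, so a further one would destroy
tightness. -/
theorem not_enters_of_tight {J J' : Finset (Fin G.m)} {v : ℕ} (h : CutsGe G J v) (hJ : J ⊆ J')
    {A : Set ℕ} (hA : A ∈ tightSets G J' v) {e : Fin G.m} (he : e ∈ J') (heJ : e ∉ J) :
    (G.head e : ℕ) ∈ A → (G.tail e : ℕ) ∈ A := by
  classical
  intro hh
  by_contra ht
  have h1 := h A hA.1 hA.2.1
  rw [← hA.2.2] at h1
  refine absurd h1 (not_le.2 (Finset.card_lt_card ?_))
  refine Finset.ssubset_iff_subset_ne.2 ⟨Finset.filter_subset_filter _ hJ, fun he' => heJ ?_⟩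
  have : e ∈ J'.filter fun e => (G.head e : ℕ) ∈ A ∧ (G.tail e : ℕ) ∉ A := by simp [he, hh, ht]
  rw [← he'] at this
  exact (Finset.mem_filter.1 this).1

/-- An edge of positive cost in a tight set has an end among the terminals. -/
theorem end_mem_of_tight (hq : G.PosEdgesQuasiBipartite) {J : Finset (Fin G.m)}
    (hJ : G.zeroEdges ⊆ J) {v : ℕ} (hv : v < G.k) {A : Set ℕ} (hA : A ∈ tightSets G J v)
    {e : Fin G.m} (he : e ∉ J) (ht : (G.tail e : ℕ) ∈ A) (hh : (G.head e : ℕ) ∈ A) :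
    (G.tail e : ℕ) ∈ termSet G ∨ (G.head e : ℕ) ∈ termSet G := by
  classical
  have hpos : 0 < G.cost e := by
    refine pos_iff_ne_zero.2 fun h0 => he (hJ ?_)
    simp [AugInstance.zeroEdges, h0]
  rcases hq e hpos with h | h
  · exact h.imp (fun h => ⟨_, h, rfl⟩) fun h => ⟨_, h, rfl⟩
  · exfalso
    -- A tight set has positive demand: the zero-cost edges belong to `J`, so at most `v < k` of
    -- them enter it. This excludes the second alternative of quasi-bipartiteness.
    refine h (Finset.univ.filter fun u => (u : ℕ) ∈ A) (by simpa using hA.2.1) ?_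
      (by simp [ht, hh])
    obtain ⟨⟨_, htA, t, htT, rfl⟩, _, hc⟩ := hA
    have h1 : G.inDeg G.zeroEdges (Finset.univ.filter fun u => (u : ℕ) ∈ A) ≤ v := by
      rw [← hc]
      refine (le_of_eq ?_).trans (cut_mono hJ A)
      simp [AugInstance.inDeg, cut]
    rw [AugInstance.demand, if_pos ⟨t, by simp [htA, htT]⟩]
    omega

/-- The terminals of an instance as a list. -/
def termList (G : AugInstance) : List ℕ :=
  ((List.finRange G.n).filter fun t => decide (t ∈ G.terminals)).map fun t : Fin G.n => (t : ℕ)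

theorem mem_termList {t : ℕ} : t ∈ termList G ↔ t ∈ termSet G := by
  simp [termList, termSet]

theorem nodup_termList : (termList G).Nodup :=
  ((List.nodup_finRange _).filter _).map fun _ _ h => Fin.ext h

/-- The representatives `Rl` of the cores, with residual arcs `D`, for the edge set `J`. -/
structure StepData (G : AugInstance) (J : Finset (Fin G.m)) (v : ℕ) (D : ℕ → List Arc)
    (Rl : List ℕ) : Prop where
  lt : v < G.k
  cutsGe : CutsGe G J v
  nodup : Rl.Nodup
  nonempty : Rl ≠ []
  cores : Cores (tightSets G J v) (termSet G) Rl.toFinset fun t => coreSet (D t) t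
  residual : ∀ t ∈ Rl, ∃ F, D t = resArcs G J F
  closed_iff : ∀ t ∈ Rl, ∀ A : Set ℕ, t ∈ A → (G.root : ℕ) ∉ A →
    (cut G J A = v ↔ ∀ a ∈ D t, a.tgt ∈ A → a.src ∈ A)

/-- If the flow to `t` has the least value `v`, then `coreSet (D t) t` is the least tight set
containing `t`. The cores are the minimal ones among these sets, and of the terminals that span the
same core the smallest is its representative; `rep` expresses both conditions. If all flow values
reach `k`, nothing is tight and `J` is feasible. -/
theorem stepFlows_spec (J : Finset (Fin G.m)) :
    (stepFlows G.root G.k (termList G) (arcsOf G c J) = [] ∧ G.Feasible J) ∨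
      ∃ v D Rl, StepData G J v D Rl ∧ ∃ val : ℕ → ℕ,
        stepFlows G.root G.k (termList G) (arcsOf G c J) =
          Rl.map fun t => (t, val t, D t, reach (revAll (D t)) [t]) := by
  classical
  have hroot : ∀ t ∈ termSet G, (G.root : ℕ) ≠ t := by
    rintro _ ⟨t, ht, rfl⟩ h
    exact root_ne_of_mem ht (Fin.ext h)
  choose! F hFJ val hmf hbal hrch using fun t ht => maxFlow_spec (c := c) J (hroot t ht)
  let D : ℕ → List Arc := fun t => resArcs G J (F t)
  let mk : ℕ → FlowRecord := fun t => (t, val t, D t, reach (revAll (D t)) [t])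
  have hfl : flows G.root (termList G) (arcsOf G c J) = (termList G).map mk := by
    refine List.map_congr_left fun t ht => ?_
    rw [hmf t (mem_termList.1 ht)]
  have hclosed : ∀ t ∈ termSet G, ∀ A : Set ℕ, t ∈ A → (G.root : ℕ) ∉ A →
      (cut G J A = val t ↔ ∀ a ∈ D t, a.tgt ∈ A → a.src ∈ A) :=
    fun t ht A htA hrA => cut_eq_iff (hFJ t ht) (hbal t ht) htA hrA
  have hcore : ∀ t ∈ termSet G, cut G J (coreSet (D t) t) = val t := fun t ht =>
    (hclosed t ht _ (self_mem_coreSet _ _) (hrch t ht)).2 fun a ha h => coreSet_closed ha h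
  have hle : ∀ t ∈ termSet G, ∀ A : Set ℕ, t ∈ A → (G.root : ℕ) ∉ A → val t ≤ cut G J A :=
    fun t ht A htA hrA => le_cut_of_balanced (hFJ t ht) (hbal t ht) htA hrA
  let tight : ℕ → Prop := fun t => val t < G.k ∧ ∀ t' ∈ termSet G, val t ≤ val t'
  let Tl : List ℕ := (termList G).filter fun t => decide (tight t)
  have htf : tightFlows G.k (flows G.root (termList G) (arcsOf G c J)) = Tl.map mk := by
    rw [hfl, tightFlows, List.filter_map]
    congr 1
    refine List.filter_congr fun t _ => ?_
    simp [tight, mk, mem_termList]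
  have hmemTl : ∀ t, t ∈ Tl ↔ t ∈ termSet G ∧ tight t := fun t => by
    simp [Tl, mem_termList]
  let rep : ℕ → Prop := fun t =>
    ∀ t' ∈ Tl, t' ∈ coreSet (D t) t → t ∈ coreSet (D t') t' ∧ t ≤ t'
  let Rl : List ℕ := Tl.filter fun t => decide (rep t)
  have hsf : stepFlows G.root G.k (termList G) (arcsOf G c J) = Rl.map mk := by
    rw [stepFlows, htf, coreFlows, List.filter_map]
    congr 1
    refine List.filter_congr fun t _ => decide_eq_decide.2 ?_
    simp [rep, mk, coreSet]
  have hmemRl : ∀ t, t ∈ Rl ↔ t ∈ Tl ∧ rep t := fun t => by simp [Rl]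
  by_cases hfeas : ∀ t ∈ termSet G, G.k ≤ val t
  · left
    constructor
    · rw [hsf, List.map_eq_nil_iff]
      refine List.eq_nil_iff_forall_not_mem.2 fun t ht => ?_
      obtain ⟨ht, h1, _⟩ := (hmemTl t).1 ((hmemRl t).1 ht).1
      have := hfeas t ht
      omega
    · refine feasible_iff.2 ?_
      rintro A ⟨t, htA, ht⟩ hrA
      exact (hfeas t ht).trans (hle t ht A htA hrA)
  · right
    push Not at hfeas
    obtain ⟨t₁, ht₁, hlt₁⟩ := hfeas
    obtain ⟨t₀, ht₀, hmin⟩ : ∃ t₀ ∈ (termList G).toFinset, ∀ t ∈ (termList G).toFinset,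
        val t₀ ≤ val t :=
      Finset.exists_min_image _ _ ⟨t₁, by simpa [mem_termList] using ht₁⟩
    simp only [List.mem_toFinset, mem_termList] at ht₀ hmin
    have hv : val t₀ < G.k := (hmin t₁ ht₁).trans_lt hlt₁
    have hge : CutsGe G J (val t₀) := by
      rintro A ⟨t, htA, ht⟩ hrA
      exact (hmin t ht).trans (hle t ht A htA hrA)
    have htightval : ∀ t ∈ Tl, val t = val t₀ := fun t ht => by
      obtain ⟨ht, _, h2⟩ := (hmemTl t).1 ht
      exact le_antisymm (h2 _ ht₀) (hmin t ht)
    have htight : ∀ A ∈ tightSets G J (val t₀), ∀ t ∈ termSet G, t ∈ A →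
        t ∈ Tl ∧ coreSet (D t) t ⊆ A := by
      rintro A ⟨_, hrA, hA⟩ t ht htA
      have h1 : val t = val t₀ := le_antisymm (hA ▸ hle t ht A htA hrA) (hmin t ht)
      exact ⟨(hmemTl t).2 ⟨ht, by rw [h1]; exact hv, fun t' ht' => h1 ▸ hmin t' ht'⟩,
        coreSet_subset htA ((hclosed t ht A htA hrA).1 (hA.trans h1.symm))⟩
    have hcoreT : ∀ t ∈ Tl, coreSet (D t) t ∈ tightSets G J (val t₀) := fun t ht => by
      have ht' := ((hmemTl t).1 ht).1
      exact ⟨⟨t, self_mem_coreSet _ _, ht'⟩, hrch t ht', (hcore t ht').trans (htightval t ht)⟩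
    have hexists : ∀ A ∈ tightSets G J (val t₀), ∃ t ∈ Rl, coreSet (D t) t ⊆ A := by
      intro A hA
      -- Choose a terminal `a` of `A` whose least tight set contains the fewest terminals. Every
      -- terminal in this set then spans a set with the same terminals, so containment is mutual.
      let cnt : ℕ → ℕ := fun t => ((termList G).toFinset.filter (· ∈ coreSet (D t) t)).card
      obtain ⟨a, ha, hamin⟩ : ∃ a ∈ (termList G).toFinset.filter (· ∈ A),
          ∀ t ∈ (termList G).toFinset.filter (· ∈ A), cnt a ≤ cnt t := by
        refine Finset.exists_min_image _ _ ?_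
        obtain ⟨t, htA, ht⟩ := hA.1
        exact ⟨t, by simpa [mem_termList] using ⟨ht, htA⟩⟩
      simp only [Finset.mem_filter, List.mem_toFinset, mem_termList] at ha hamin
      obtain ⟨haT, haA⟩ := htight A hA a ha.1 ha.2
      have hmutual : ∀ t ∈ termSet G, t ∈ coreSet (D a) a →
          t ∈ Tl ∧ coreSet (D t) t ⊆ coreSet (D a) a ∧ a ∈ coreSet (D t) t := by
        intro t ht hta
        obtain ⟨h1, h2⟩ := htight _ (hcoreT a haT) t ht hta
        refine ⟨h1, h2, ?_⟩
        have h3 := hamin t ⟨ht, haA hta⟩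
        have h4 : (termList G).toFinset.filter (· ∈ coreSet (D t) t) ⊆
            (termList G).toFinset.filter (· ∈ coreSet (D a) a) := fun x hx => by
          simp only [Finset.mem_filter] at hx ⊢
          exact ⟨hx.1, h2 hx.2⟩
        have h5 := Finset.eq_of_subset_of_card_le h4 h3
        have h6 : a ∈ (termList G).toFinset.filter (· ∈ coreSet (D a) a) := by
          simp [mem_termList, ha.1, self_mem_coreSet]
        rw [← h5] at h6
        exact (Finset.mem_filter.1 h6).2
      -- The smallest terminal in the set of `a` is the representative sought.
      obtain ⟨b, hb, hbmin⟩ : ∃ b ∈ (termList G).toFinset.filter (· ∈ coreSet (D a) a),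
          ∀ t ∈ (termList G).toFinset.filter (· ∈ coreSet (D a) a), b ≤ t :=
        Finset.exists_min_image _ id ⟨a, by simp [mem_termList, ha.1, self_mem_coreSet]⟩
      simp only [Finset.mem_filter, List.mem_toFinset, mem_termList] at hb hbmin
      obtain ⟨hbT, hba, hab⟩ := hmutual b hb.1 hb.2
      refine ⟨b, (hmemRl b).2 ⟨hbT, fun t ht htb => ?_⟩, hba.trans haA⟩
      have ht' := ((hmemTl t).1 ht).1
      obtain ⟨_, _, hat⟩ := hmutual t ht' (hba htb)
      exact ⟨(htight _ (hcoreT t ht) a ha.1 hat).2 hb.2, hbmin t ⟨ht', hba htb⟩⟩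
    have hRlT : ∀ t ∈ Rl, t ∈ Tl := fun t ht => ((hmemRl t).1 ht).1
    have hRlT' : ∀ t ∈ Rl, t ∈ termSet G := fun t ht => ((hmemTl t).1 (hRlT t ht)).1
    have ht₀T : t₀ ∈ Tl := (hmemTl t₀).2 ⟨ht₀, hv, hmin⟩
    refine ⟨val t₀, D, Rl, ⟨hv, hge, (nodup_termList.filter _).filter _, ?_, ?_, ?_, ?_⟩, val, hsf⟩
    · obtain ⟨t, ht, _⟩ := hexists _ (hcoreT t₀ ht₀T)
      exact List.ne_nil_of_mem ht
    · refine ⟨fun t ht => hcoreT t (hRlT t (List.mem_toFinset.1 ht)),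
        fun t _ => self_mem_coreSet _ _, fun t ht => hRlT' t (List.mem_toFinset.1 ht), ?_, ?_⟩
      · intro A hA
        obtain ⟨t, ht, htA⟩ := hexists A hA
        exact ⟨t, List.mem_toFinset.2 ht, htA⟩
      · intro t ht t' ht' h
        rw [List.mem_toFinset] at ht ht'
        obtain ⟨h1, h2⟩ := ((hmemRl t').1 ht').2 t (hRlT t ht) h
        obtain ⟨_, h4⟩ := ((hmemRl t).1 ht).2 t' (hRlT t' ht') h1
        exact le_antisymm h4 h2
    · exact fun t _ => ⟨F t, rfl⟩
    · intro t ht A htA hrA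
      rw [← htightval t (hRlT t ht)]
      exact hclosed t (hRlT' t ht) A htA hrA

/-! ### Halos -/

/-- The nodes outside the halo of the core of `t`. -/
def outside (G : AugInstance) (D : ℕ → List Arc) (Rl : List ℕ) (t : ℕ) : List ℕ :=
  reach (D t) (G.root :: Rl.filter fun s => decide (¬ s = t))

/-- The halo of the core of `t`. -/
def haloSet (G : AugInstance) (D : ℕ → List Arc) (Rl : List ℕ) (t : ℕ) : Set ℕ :=
  {u | u ∉ outside G D Rl t}

namespace StepData

variable {J : Finset (Fin G.m)} {v : ℕ} {D : ℕ → List Arc} {Rl : List ℕ}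

theorem haloSet_closed {t : ℕ} {a : Arc} (ha : a ∈ D t) (h : a.tgt ∈ haloSet G D Rl t) :
    a.src ∈ haloSet G D Rl t :=
  fun hs => h (reach_closed ha hs)

theorem root_notMem_haloSet (t : ℕ) : (G.root : ℕ) ∉ haloSet G D Rl t :=
  fun h => h (mem_reach_of_mem (by simp))

theorem eq_of_mem_haloSet {t s : ℕ} (hs : s ∈ Rl) (h : s ∈ haloSet G D Rl t) : s = t :=
  by_contra fun hne => h (mem_reach_of_mem (by simp [hs, hne]))

/-- No residual arc enters the core, and the core contains neither the root nor another
representative, so the forward search never gets into it. -/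
theorem self_mem_haloSet (h : StepData G J v D Rl) {t : ℕ} (ht : t ∈ Rl) :
    t ∈ haloSet G D Rl t := by
  intro hout
  refine reach_induction (P := (· ∉ coreSet (D t) t)) ?_
    (fun a ha hs ht => hs (coreSet_closed ha ht)) t hout (self_mem_coreSet _ _)
  intro u hu
  rcases List.mem_cons.1 hu with rfl | hu
  · exact (h.cores.mem t (List.mem_toFinset.2 ht)).2.1
  · simp only [List.mem_filter, decide_eq_true_eq] at hu
    exact fun hut => hu.2 (h.cores.inj u (List.mem_toFinset.2 hu.1) t (List.mem_toFinset.2 ht) hut)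

theorem mem_tightSets (h : StepData G J v D Rl) {t : ℕ} (ht : t ∈ Rl) {A : Set ℕ} (htA : t ∈ A)
    (hrA : (G.root : ℕ) ∉ A) (hA : ∀ a ∈ D t, a.tgt ∈ A → a.src ∈ A) : A ∈ tightSets G J v :=
  ⟨⟨t, htA, h.cores.term t (List.mem_toFinset.2 ht)⟩, hrA, (h.closed_iff t ht A htA hrA).2 hA⟩

theorem haloSet_mem_tightSets (h : StepData G J v D Rl) {t : ℕ} (ht : t ∈ Rl) :
    haloSet G D Rl t ∈ tightSets G J v :=
  h.mem_tightSets ht (h.self_mem_haloSet ht) (root_notMem_haloSet t) fun _ => haloSet_closed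

theorem closed_of_tight (h : StepData G J v D Rl) {t : ℕ} (ht : t ∈ Rl) {A : Set ℕ} (htA : t ∈ A)
    (hA : A ∈ tightSets G J v) : ∀ a ∈ D t, a.tgt ∈ A → a.src ∈ A :=
  (h.closed_iff t ht A htA hA.2.1).1 hA.2.2

/-- A tight set around `t` is not entered by residual arcs. If it also avoided all other
representatives, the search from these and the root would miss it, and it would lie in the halo. So
the halo is the largest tight set of this kind. -/
theorem exists_other (h : StepData G J v D Rl) {t : ℕ} (ht : t ∈ Rl) {A : Set ℕ} (htA : t ∈ A)
    (hA : A ∈ tightSets G J v) {u : ℕ} (hu : u ∈ A) (hut : u ∉ haloSet G D Rl t) :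
    ∃ s ∈ Rl, s ≠ t ∧ s ∈ A := by
  by_contra hno
  push Not at hno
  refine hut fun hout => reach_induction (P := (· ∉ A)) ?_
    (fun a ha hs ht' => hs (h.closed_of_tight ht htA hA a ha ht')) u hout hu
  intro s hs
  rcases List.mem_cons.1 hs with rfl | hs
  · exact hA.2.1
  · simp only [List.mem_filter, decide_eq_true_eq] at hs
    exact hno s hs.1 hs.2

/-- The intersection with the halo is tight and thus contains a representative, and `t` is the only
one in the halo. -/
theorem mem_of_inter_haloSet (h : StepData G J v D Rl) {t : ℕ} (ht : t ∈ Rl) {A : Set ℕ}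
    (hA : A ∈ tightSets G J v) {z : ℕ} (hzA : z ∈ A) (hzt : z ∈ haloSet G D Rl t)
    (hzT : z ∈ termSet G) : t ∈ A := by
  obtain ⟨s, hs, hsA⟩ := h.cores.exists_mem (interClosed_tightSets h.cutsGe A hA _
    (h.haloSet_mem_tightSets ht) ⟨z, ⟨hzA, hzt⟩, hzT⟩)
  rw [← eq_of_mem_haloSet (List.mem_toFinset.1 hs) hsA.2]
  exact hsA.1

theorem haloSet_disjoint (h : StepData G J v D Rl) {t t' : ℕ} (ht : t ∈ Rl) (ht' : t' ∈ Rl)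
    {z : ℕ} (hz : z ∈ termSet G) (h1 : z ∈ haloSet G D Rl t) (h2 : z ∈ haloSet G D Rl t') :
    t = t' :=
  eq_of_mem_haloSet ht (h.mem_of_inter_haloSet ht (h.haloSet_mem_tightSets ht') h2 h1 hz)

end StepData

end RootedAug

namespace RootedAug

variable {G : AugInstance} {c : Fin G.m → ℕ}

/-! ### Spiders -/

/-- The arcs of the edges that do not belong to `J`. -/
def newArcs (G : AugInstance) (c : Fin G.m → ℕ) (J : Finset (Fin G.m)) : List Arc :=
  arcsOf G c (Finset.univ \ J)

theorem mem_newArcs {J : Finset (Fin G.m)} {a : Arc} :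
    a ∈ newArcs G c J ↔ ∃ e, e ∉ J ∧ arcOf G c e = a := by
  simp [newArcs, mem_arcsOf]

theorem withoutLabels_arcsOf (J : Finset (Fin G.m)) :
    withoutLabels (arcsOf G c Finset.univ) (labels (arcsOf G c J)) = newArcs G c J := by
  rw [withoutLabels, filter_arcsOf, newArcs]
  congr 1
  ext e
  simp only [Finset.mem_filter, Finset.mem_sdiff, Finset.mem_univ, true_and, decide_eq_true_eq]
  exact not_congr mem_labels_arcsOf

open Classical in
/-- The cost of the edges outside of `J` whose labels occur in a list. -/
noncomputable def newCost (c : Fin G.m → ℕ) (J : Finset (Fin G.m)) (ls : List ℕ) : ℕ :=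
  ∑ e ∈ Finset.univ.filter fun e : Fin G.m => (e : ℕ) ∈ ls ∧ e ∉ J, c e

theorem newCost_nil (J : Finset (Fin G.m)) : newCost c J [] = 0 := by
  simp [newCost]

theorem newCost_append (J : Finset (Fin G.m)) (l l' : List ℕ) :
    newCost c J (l ++ l') ≤ newCost c J l + newCost c J l' := by
  classical
  rw [newCost, newCost, newCost, ← Finset.sum_union_inter]
  refine (Finset.sum_le_sum_of_subset fun e he => ?_).trans (Nat.le_add_right _ _)
  simp only [Finset.mem_filter, Finset.mem_univ, true_and, List.mem_append,
    Finset.mem_union] at he ⊢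
  tauto

theorem newCost_singleton (J : Finset (Fin G.m)) (e : Fin G.m) : newCost c J [(e : ℕ)] ≤ c e := by
  classical
  rw [newCost]
  refine (Finset.sum_le_sum_of_subset (t := {e}) fun e' he' => ?_).trans (by simp)
  simp only [List.mem_singleton, Finset.mem_filter, Finset.mem_univ, true_and] at he'
  exact Finset.mem_singleton.2 (Fin.ext he'.1)

theorem newCost_cons_of_mem {J : Finset (Fin G.m)} {e : Fin G.m} (he : e ∈ J) (l : List ℕ) :
    newCost c J ((e : ℕ) :: l) ≤ newCost c J l := by
  classical
  refine Finset.sum_le_sum_of_subset fun e' he' => ?_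
  simp only [List.mem_cons, Finset.mem_filter, Finset.mem_univ, true_and] at he' ⊢
  refine ⟨he'.1.resolve_left fun h => he'.2 ?_, he'.2⟩
  rwa [Fin.ext (a := e') (b := e) h]

theorem newCost_cons (J : Finset (Fin G.m)) (e : Fin G.m) (l : List ℕ) :
    newCost c J ((e : ℕ) :: l) ≤ c e + newCost c J l :=
  (newCost_append J [(e : ℕ)] l).trans (by have := newCost_singleton (c := c) J e; omega)

theorem newCost_flatMap_le {J : Finset (Fin G.m)} {l : List Entry}
    (h : ∀ x ∈ l, newCost c J x.path ≤ x.dist) :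
    newCost c J (l.flatMap fun x => x.path) ≤ (l.map fun x => x.dist).sum := by
  induction l with
  | nil => simp [newCost_nil]
  | cons x l ih =>
    rw [List.flatMap_cons, List.map_cons, List.sum_cons]
    have h1 := newCost_append (c := c) J x.path (l.flatMap fun x => x.path)
    have h2 := h x (by simp)
    have h3 := ih fun y hy => h y (by simp [hy])
    omega

/-- The distances to the core of `t`. -/
def table (G : AugInstance) (c : Fin G.m → ℕ) (J : Finset (Fin G.m)) (D : ℕ → List Arc) (t : ℕ) :
    List Entry :=
  search (revAll (D t ++ newArcs G c J)) [t]

theorem table_unique {J : Finset (Fin G.m)} {D : ℕ → List Arc} {t : ℕ} {x y : Entry}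
    (hx : x ∈ table G c J D t) (hy : y ∈ table G c J D t) (h : x.node = y.node) : x = y :=
  List.inj_on_of_nodup_map ((search_built _ _).nodup (by simp)) hx hy h

theorem table_closed {J : Finset (Fin G.m)} {D : ℕ → List Arc} {t : ℕ} {x : Entry}
    (hx : x ∈ table G c J D t) {a : Arc} (ha : a ∈ D t ++ newArcs G c J) (hxa : x.node = a.tgt) :
    ∃ y ∈ table G c J D t, y.node = a.src ∧ y.dist ≤ x.dist + a.len :=
  search_closed hx (mem_revAll.2 ⟨a, ha, rfl⟩) hxa

theorem table_induction {J F : Finset (Fin G.m)} {D : ℕ → List Arc} {t : ℕ}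
    (hD : D t = resArcs G J F) {P : Entry → Prop} (h0 : P (t, 0, []))
    (h1 : ∀ x, P x → ∀ e ∈ J, x.node = (resArc G F e).tgt →
      P ((resArc G F e).src, x.dist, (e : ℕ) :: x.path))
    (h2 : ∀ x, P x → ∀ e, e ∉ J → x.node = G.head e →
      P (G.tail e, x.dist + c e, (e : ℕ) :: x.path)) :
    ∀ x ∈ table G c J D t, P x := by
  have key : ∀ L, Built (revAll (D t ++ newArcs G c J)) [t] L → ∀ x ∈ L, P x := by
    intro L h
    induction h with
    | init =>
      intro x hx
      simp only [List.map_cons, List.map_nil, List.mem_singleton] at hx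
      exact hx ▸ h0
    | @step L y a _ hy ha hya _ ih =>
      intro x hx
      rcases List.mem_cons.1 hx with rfl | hx
      · obtain ⟨b, hb, rfl⟩ := mem_revAll.1 ha
        rcases List.mem_append.1 hb with hb | hb
        · rw [hD] at hb
          obtain ⟨e, he, rfl⟩ := mem_resArcs.1 hb
          have := h1 y (ih y hy) e he hya
          have e1 : y.ext (resArc G F e).rev =
            ((resArc G F e).src, y.dist + (resArc G F e).len, (resArc G F e).lab :: y.path) := rfl
          rwa [e1, resArc_len, resArc_lab]
        · obtain ⟨e, he, rfl⟩ := mem_newArcs.1 hb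
          exact h2 y (ih y hy) e he hya
      · exact ih x hx
  exact key _ (search_built _ _)

/-- Residual arcs, in either direction, come from edges of `J` and add no cost; each step along an
edge outside `J` adds its cost to the distance. -/
theorem newCost_path_le {J F : Finset (Fin G.m)} {D : ℕ → List Arc} {t : ℕ}
    (hD : D t = resArcs G J F) {x : Entry} (hx : x ∈ table G c J D t) :
    newCost c J x.path ≤ x.dist := by
  refine table_induction hD (P := fun x => newCost c J x.path ≤ x.dist) ?_ ?_ ?_ x hx
  · exact (newCost_nil J).le
  · intro x hx e he _
    exact (newCost_cons_of_mem he _).trans hx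
  · intro x hx e he _
    refine (newCost_cons J e _).trans ?_
    simp only [Entry.dist, Entry.path] at *
    omega

/-- A path from outside `A` to `t ∈ A` has to enter `A`. Residual arcs do not enter `A`, so an edge
outside `J` does. -/
theorem exists_entering_path {J F : Finset (Fin G.m)} {D : ℕ → List Arc} {t : ℕ}
    (hD : D t = resArcs G J F) {A : Set ℕ} (htA : t ∈ A) (hA : ∀ a ∈ D t, a.tgt ∈ A → a.src ∈ A)
    {x : Entry} (hx : x ∈ table G c J D t) (hxA : x.node ∉ A) :
    ∃ e : Fin G.m, (e : ℕ) ∈ x.path ∧ e ∉ J ∧ (G.head e : ℕ) ∈ A ∧ (G.tail e : ℕ) ∉ A := by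
  refine table_induction (c := c) hD (P := fun x => x.node ∉ A → ∃ e : Fin G.m, (e : ℕ) ∈ x.path ∧
    e ∉ J ∧ (G.head e : ℕ) ∈ A ∧ (G.tail e : ℕ) ∉ A) ?_ ?_ ?_ x hx hxA
  · exact fun h => absurd htA h
  · intro x hx e he hxe hn
    have : x.node ∉ A := fun h => hn (hA _ (hD ▸ mem_resArcs.2 ⟨e, he, rfl⟩) (hxe ▸ h))
    obtain ⟨e', he', h'⟩ := hx this
    exact ⟨e', List.mem_cons_of_mem _ he', h'⟩
  · intro x hx e he hxe hn
    by_cases h : x.node ∈ A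
    · exact ⟨e, List.mem_cons_self, he, hxe ▸ h, hn⟩
    · obtain ⟨e', he', h'⟩ := hx h
      exact ⟨e', List.mem_cons_of_mem _ he', h'⟩

/-- The halos of the cores that are represented by `Rl`. -/
def haloList (G : AugInstance) (c : Fin G.m → ℕ) (J : Finset (Fin G.m)) (D : ℕ → List Arc)
    (Rl : List ℕ) : List Halo :=
  Rl.map fun t => (t, outside G D Rl t, table G c J D t)

theorem halos_eq (J : Finset (Fin G.m)) (D : ℕ → List Arc) (Rl : List ℕ) (val : ℕ → ℕ) :
    halos G.root (newArcs G c J)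
      (Rl.map fun t => (t, val t, D t, reach (revAll (D t)) [t])) = haloList G c J D Rl := by
  simp [halos, haloList, outside, table, Function.comp_def]

theorem weight_eq_one_iff {J : Finset (Fin G.m)} {D : ℕ → List Arc} {Rl : List ℕ} {e : Fin G.m} :
    weight (termList G) (haloList G c J D Rl) (arcOf G c e) = 1 ↔
      (G.tail e : ℕ) ∈ termSet G ∧ ∃ t ∈ Rl, (G.tail e : ℕ) ∈ haloSet G D Rl t := by
  have h1 : (arcOf G c e).src = G.tail e := rfl
  have h2 : ((arcOf G c e).src ∈ termList G ∧
      ∃ h ∈ haloList G c J D Rl, ¬ (arcOf G c e).src ∈ h.2.1) ↔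
      (G.tail e : ℕ) ∈ termSet G ∧ ∃ t ∈ Rl, (G.tail e : ℕ) ∈ haloSet G D Rl t := by
    rw [h1, mem_termList]
    simp [haloList, haloSet]
  rw [← h2, weight]
  split_ifs with h
  exacts [iff_of_true rfl h, iff_of_false (by norm_num) h]

theorem weight_cases (T : List ℕ) (hs : List Halo) (a : Arc) :
    weight T hs a = 1 ∨ weight T hs a = 2 := by
  unfold weight; split_ifs <;> simp

/-- The legs of the spiders that start with the edge `e` and have legs of length at most `θ`. -/
def IsLegSet (c : Fin G.m → ℕ) (J : Finset (Fin G.m)) (D : ℕ → List Arc) (Rl : List ℕ)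
    (e : Fin G.m) (θ : ℕ) (S : Finset ℕ) : Prop :=
  ∀ t, t ∈ S ↔ t ∈ Rl ∧ (G.tail e : ℕ) ∉ haloSet G D Rl t ∧ (G.head e : ℕ) ∈ haloSet G D Rl t ∧
    ∃ x ∈ table G c J D t, x.node = G.head e ∧ x.dist ≤ θ

theorem mem_offers {J : Finset (Fin G.m)} {D : ℕ → List Arc} {Rl : List ℕ} {e : Fin G.m}
    {x : Entry} : x ∈ offers (haloList G c J D Rl) (arcOf G c e) ↔
      ∃ t ∈ Rl, (G.tail e : ℕ) ∉ haloSet G D Rl t ∧ (G.head e : ℕ) ∈ haloSet G D Rl t ∧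
        x ∈ table G c J D t ∧ x.node = G.head e := by
  have h1 : (arcOf G c e).src = G.tail e := rfl
  have h2 : (arcOf G c e).tgt = G.head e := rfl
  simp only [offers, haloList, List.mem_flatMap, List.mem_map, h1, h2, haloSet,
    Set.mem_ofPred_eq, not_not]
  constructor
  · rintro ⟨_, ⟨t, ht, rfl⟩, hx⟩
    split_ifs at hx with hc
    · simp only [List.mem_filter, decide_eq_true_eq] at hx
      exact ⟨t, ht, hc.1, hc.2, hx⟩
    · simp at hx
  · rintro ⟨t, ht, h1, h2, h3⟩
    refine ⟨_, ⟨t, ht, rfl⟩, ?_⟩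
    rw [if_pos ⟨h1, h2⟩]
    simpa using h3

/-- A table has at most one entry per node, so a core contributes at most one entry for the head of
`e`. Thus the computed list corresponds to the leg set `S` without repetition. -/
theorem filter_offers {J : Finset (Fin G.m)} {D : ℕ → List Arc} {Rl : List ℕ} {e : Fin G.m}
    {θ : ℕ} {S : Finset ℕ} (hS : IsLegSet c J D Rl e θ S) {y : ℕ → Entry}
    (hy : ∀ t ∈ S, y t ∈ table G c J D t ∧ (y t).node = G.head e) :
    (offers (haloList G c J D Rl) (arcOf G c e)).filter (fun x => decide (x.dist ≤ θ)) =
      (Rl.filter fun t => decide (t ∈ S)).map y := by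
  have h1 : (arcOf G c e).src = G.tail e := rfl
  have h2 : (arcOf G c e).tgt = G.head e := rfl
  have key : ∀ t ∈ Rl, ((if (G.tail e : ℕ) ∈ outside G D Rl t ∧ ¬ (G.head e : ℕ) ∈ outside G D Rl t
      then (table G c J D t).filter fun x : Entry => decide (x.node = (G.head e : ℕ)) else []).filter
        fun x => decide (x.dist ≤ θ)) = if t ∈ S then [y t] else [] := by
    intro t ht
    by_cases hc : (G.tail e : ℕ) ∈ outside G D Rl t ∧ ¬ (G.head e : ℕ) ∈ outside G D Rl t
    · rw [if_pos hc, List.filter_filter]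
      by_cases htS : t ∈ S
      · rw [if_pos htS]
        obtain ⟨_, _, _, x, hx, hxn, hxd⟩ := (hS t).1 htS
        obtain ⟨hyt, hyn⟩ := hy t htS
        have hxy : x = y t := table_unique hx hyt (hxn.trans hyn.symm)
        have hnd : (table G c J D t).Nodup :=
          List.Nodup.of_map _ ((search_built _ _).nodup (by simp))
        refine List.perm_singleton.1 ((List.perm_ext_iff_of_nodup (hnd.filter _)
          (List.nodup_singleton _)).2 fun z => ?_)
        simp only [List.mem_filter, Bool.and_eq_true, decide_eq_true_eq, List.mem_singleton]
        constructor
        · rintro ⟨hz, _, hzn⟩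
          exact table_unique hz hyt (hzn.trans hyn.symm)
        · rintro rfl
          exact ⟨hyt, hxy ▸ hxd, hyn⟩
      · rw [if_neg htS, List.filter_eq_nil_iff]
        intro x hx hd
        simp only [Bool.and_eq_true, decide_eq_true_eq] at hd
        exact htS ((hS t).2 ⟨ht, not_not.2 hc.1, hc.2, x, hx, hd.2, hd.1⟩)
    · rw [if_neg hc, if_neg, List.filter_nil]
      intro htS
      obtain ⟨_, h3, h4, _⟩ := (hS t).1 htS
      exact hc ⟨not_not.1 h3, h4⟩
  have gen : ∀ l : List ℕ, (∀ t ∈ l, t ∈ Rl) →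
      ((l.map fun t => ((t, outside G D Rl t, table G c J D t) : Halo)).flatMap fun h =>
        if (G.tail e : ℕ) ∈ h.2.1 ∧ ¬ (G.head e : ℕ) ∈ h.2.1 then
          h.2.2.filter fun x : Entry => decide (x.node = (G.head e : ℕ)) else []).filter
            (fun x => decide (x.dist ≤ θ)) = (l.filter fun t => decide (t ∈ S)).map y := by
    intro l
    induction l with
    | nil => intro _; rfl
    | cons t l ih =>
      intro hl
      rw [List.map_cons, List.flatMap_cons, List.filter_append, key t (hl t (by simp)),
        ih fun t ht => hl t (by simp [ht])]
      by_cases htS : t ∈ S <;> simp [htS]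
  exact gen Rl fun t ht => ht

/-- The candidate spiders for the edge set `J`. -/
def spiderList (G : AugInstance) (c : Fin G.m → ℕ) (J : Finset (Fin G.m)) (D : ℕ → List Arc)
    (Rl : List ℕ) : List Spider :=
  spiders (termList G) (haloList G c J D Rl) (newArcs G c J)

theorem mem_spiderList {J : Finset (Fin G.m)} {D : ℕ → List Arc} {Rl : List ℕ} {sp : Spider} :
    sp ∈ spiderList G c J D Rl ↔ ∃ e, e ∉ J ∧
      ∃ o ∈ offers (haloList G c J D Rl) (arcOf G c e),
        spider (weight (termList G) (haloList G c J D Rl) (arcOf G c e)) (arcOf G c e)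
          ((offers (haloList G c J D Rl) (arcOf G c e)).filter
            fun x => decide (x.dist ≤ o.dist)) = sp := by
  simp only [spiderList, spiders, List.mem_flatMap, List.mem_map]
  constructor
  · rintro ⟨a, ha, o, ho, rfl⟩
    obtain ⟨e, he, rfl⟩ := mem_newArcs.1 ha
    exact ⟨e, he, o, ho, rfl⟩
  · rintro ⟨e, he, o, ho, rfl⟩
    exact ⟨_, mem_newArcs.2 ⟨e, he, rfl⟩, o, ho, rfl⟩

theorem exists_legSet (J : Finset (Fin G.m)) (D : ℕ → List Arc) (Rl : List ℕ) (e : Fin G.m)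
    (θ : ℕ) : ∃ S, IsLegSet c J D Rl e θ S ∧ S ⊆ Rl.toFinset := by
  classical
  exact ⟨Rl.toFinset.filter fun t => (G.tail e : ℕ) ∉ haloSet G D Rl t ∧
    (G.head e : ℕ) ∈ haloSet G D Rl t ∧ ∃ x ∈ table G c J D t, x.node = G.head e ∧ x.dist ≤ θ,
    fun t => by simp, Finset.filter_subset _ _⟩

theorem spider_eq {J : Finset (Fin G.m)} {D : ℕ → List Arc} {Rl : List ℕ} (hnd : Rl.Nodup)
    {e : Fin G.m} {θ w : ℕ} {S : Finset ℕ} (hS : IsLegSet c J D Rl e θ S) {y : ℕ → Entry}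
    (hy : ∀ t ∈ S, y t ∈ table G c J D t ∧ (y t).node = G.head e) :
    spider w (arcOf G c e) ((offers (haloList G c J D Rl) (arcOf G c e)).filter
      fun x => decide (x.dist ≤ θ)) =
      (w * (c e + ∑ t ∈ S, (y t).dist), S.card,
        (e : ℕ) :: ((Rl.filter fun t => decide (t ∈ S)).map y).flatMap fun x => x.path) := by
  have hSf : (Rl.filter fun t => decide (t ∈ S)).toFinset = S := by
    ext t
    simp only [List.mem_toFinset, List.mem_filter, decide_eq_true_eq]
    exact ⟨fun h => h.2, fun h => ⟨((hS t).1 h).1, h⟩⟩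
  have hnd' : (Rl.filter fun t => decide (t ∈ S)).Nodup := hnd.filter _
  rw [filter_offers hS hy, spider]
  refine Prod.ext ?_ (Prod.ext ?_ rfl)
  · have h1 : (arcOf G c e).len = c e := rfl
    have h2 := List.sum_toFinset (fun t => (y t).dist) hnd'
    rw [hSf] at h2
    simp only [h1, h2, List.map_map, Function.comp_def]
  · have h2 := List.toFinset_card_of_nodup hnd'
    rw [hSf] at h2
    simp only [List.length_map, h2]

end RootedAug

namespace RootedAug

variable {G : AugInstance} {c : Fin G.m → ℕ}

/-! ### The dual solution -/

open Classical in
/-- The potential of a node: its distance, scaled by `s` and truncated at `B`. -/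
noncomputable def potential (L : List Entry) (M : Set ℕ) (B s u : ℕ) : ℕ :=
  if h : u ∈ M ∧ ∃ x ∈ L, x.node = u then min B (s * (Classical.choose h.2).dist) else B

section potential

variable {L : List Entry} {M : Set ℕ} {B s u : ℕ}

theorem potential_le : potential L M B s u ≤ B := by
  unfold potential; split_ifs <;> simp

theorem potential_of_notMem (h : u ∉ M) : potential L M B s u = B :=
  dif_neg fun h' => h h'.1

theorem potential_eq {x : Entry} (hL : ∀ x ∈ L, ∀ y ∈ L, x.node = y.node → x = y) (hx : x ∈ L)
    (hu : x.node ∈ M) : potential L M B s x.node = min B (s * x.dist) := by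
  have h : x.node ∈ M ∧ ∃ y ∈ L, y.node = x.node := ⟨hu, x, hx, rfl⟩
  rw [potential, dif_pos h]
  obtain ⟨h1, h2⟩ := Classical.choose_spec h.2
  rw [hL _ h1 x hx h2]

theorem exists_of_potential_lt (h : potential L M B s u < B) :
    u ∈ M ∧ ∃ x ∈ L, x.node = u ∧ potential L M B s u = s * x.dist := by
  unfold potential at h
  split_ifs at h with h'
  · refine ⟨h'.1, Classical.choose h'.2, (Classical.choose_spec h'.2).1,
      (Classical.choose_spec h'.2).2, ?_⟩
    rw [potential, dif_pos h']
    omega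
  · omega

end potential

/-- Below the truncation level only halo nodes occur. Residual arcs have length zero, so the tail of
such an arc is no farther from `t` than its head; together with closure of the halo, no residual arc
enters a level set. -/
theorem StepData.levelSet_mem {J : Finset (Fin G.m)} {v : ℕ} {D : ℕ → List Arc} {Rl : List ℕ}
    (h : StepData G J v D Rl) {t : ℕ} (ht : t ∈ Rl) {B s θ : ℕ} (hθ : θ < B) :
    {u | potential (table G c J D t) (haloSet G D Rl t) B s u ≤ θ} ∈ tightSets G J v := by
  refine h.mem_tightSets ht ?_ ?_ fun a ha hat => ?_
  · have := potential_eq (L := table G c J D t) (M := haloSet G D Rl t) (B := B) (s := s)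
      (fun x hx y hy => table_unique hx hy)
      (x := (t, 0, [])) (mem_search_of_mem (by simp)) (h.self_mem_haloSet ht)
    have e : Entry.node ((t, 0, []) : Entry) = t := rfl
    have e' : Entry.dist ((t, 0, []) : Entry) = 0 := rfl
    rw [e, e'] at this
    show potential _ _ _ _ t ≤ θ
    rw [this]
    simp
  · intro hr
    have : potential (table G c J D t) (haloSet G D Rl t) B s G.root ≤ θ := hr
    rw [potential_of_notMem (root_notMem_haloSet t)] at this
    omega
  · have hat : potential (table G c J D t) (haloSet G D Rl t) B s a.tgt ≤ θ := hat
    obtain ⟨hM, x, hx, hxa, hd⟩ := exists_of_potential_lt (hat.trans_lt hθ)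
    obtain ⟨y, hy, hya, hyd⟩ := table_closed hx (List.mem_append_left _ ha) hxa
    have hlen : a.len = 0 := by
      obtain ⟨F, hF⟩ := h.residual t ht
      rw [hF] at ha
      obtain ⟨e, _, rfl⟩ := mem_resArcs.1 ha
      exact resArc_len F e
    show potential _ _ _ _ a.src ≤ θ
    rw [← hya, potential_eq (fun x hx y hy => table_unique hx hy) hy
      (hya ▸ haloSet_closed ha hM)]
    rw [hlen, Nat.add_zero] at hyd
    have := Nat.mul_le_mul_left s hyd
    omega

/-- Lower bound on the cost of a feasible solution if all spiders have density at least
`num / den`. -/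
theorem dual_bound (hq : G.PosEdgesQuasiBipartite) {J J' : Finset (Fin G.m)}
    (hJ : G.zeroEdges ⊆ J) {v : ℕ} {D : ℕ → List Arc} {Rl : List ℕ}
    (h : StepData G J v D Rl) (hJ' : G.Feasible J') {num den : ℕ}
    (hsp : ∀ sp ∈ spiderList G c J D Rl, num * sp.2.1 ≤ sp.1 * den) :
    (G.k - v) * Rl.toFinset.card * num ≤ 2 * den * ∑ e ∈ J', c e := by
  classical
  -- Distances are scaled by `2 * den` and truncated at `num`. The factor 2 makes a spider of weight
  -- two pay once for its legs and one of weight one pay twice, as `sum_drop_le` requires.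
  let pot : ℕ → ℕ → ℕ := fun t u =>
    potential (table G c J D t) (haloSet G D Rl t) num (2 * den) u
  have hmem : ∀ t, t ∈ Rl.toFinset ↔ t ∈ Rl := fun t => List.mem_toFinset
  have hlow : ∀ t ∈ Rl, (G.k - v) * num ≤
      ∑ e ∈ J' \ J, (pot t (G.tail e) - pot t (G.head e)) := by
    intro t ht
    refine mul_le_sum_drop (hd := fun e => (G.head e : ℕ)) (tl := fun e => (G.tail e : ℕ))
      fun θ hθ => ?_
    -- Exactly `v` edges of `J` and at least `k` edges of `J'` enter this level set, so at least `k
    -- - v` edges of `J' \ J` do.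
    have hA := h.levelSet_mem (c := c) ht (s := 2 * den) hθ
    have h1 := feasible_iff.1 hJ' _ hA.1 hA.2.1
    have h2 := hA.2.2
    generalize hAe : {u | potential (table G c J D t) (haloSet G D Rl t) num (2 * den) u ≤ θ} = A
      at hA h1 h2
    have hmemA : ∀ u, pot t u ≤ θ ↔ u ∈ A := fun u => by rw [← hAe]; exact Iff.rfl
    simp only [hmemA]
    have h3 : cut G J' A ≤ cut G J A +
        ((J' \ J).filter fun e => (G.head e : ℕ) ∈ A ∧ (G.tail e : ℕ) ∉ A).card := by
      refine le_trans (Finset.card_le_card fun e he => ?_) (Finset.card_union_le _ _)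
      simp only [Finset.mem_filter, Finset.mem_union, Finset.mem_sdiff] at he ⊢
      tauto
    omega
  have hup : ∀ e ∈ J' \ J, ∑ t ∈ Rl.toFinset, (pot t (G.tail e) - pot t (G.head e)) ≤
      2 * den * c e := by
    intro e he
    have heJ := (Finset.mem_sdiff.1 he).2
    refine sum_drop_le (M := haloSet G D Rl) (T := termSet G) (B := num)
      (fun t x => potential_le) (fun t _ x hx => potential_of_notMem hx) ?_ ?_ ?_ ?_
    · intro t ht hu hw
      by_cases hlt : pot t (G.head e) < num
      · obtain ⟨_, x, hx, hxn, hd⟩ := exists_of_potential_lt hlt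
        obtain ⟨y, hy, hyn, hyd⟩ := table_closed hx
          (List.mem_append_right _ (mem_newArcs.2 ⟨e, heJ, rfl⟩)) hxn
        have hyn : y.node = G.tail e := hyn
        have hyd : y.dist ≤ x.dist + c e := hyd
        have h1 : pot t (G.tail e) = min num (2 * den * y.dist) := by
          rw [← hyn]
          exact potential_eq (fun x hx y hy => table_unique hx hy) hy (hyn ▸ hu)
        have h2 := Nat.mul_le_mul_left (2 * den) hyd
        have hd : pot t (G.head e) = 2 * den * x.dist := hd
        rw [mul_add] at h2
        omega
      · have : pot t (G.tail e) ≤ num := potential_le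
        omega
    · exact fun t ht t' ht' z hz h1 h2 =>
        h.haloSet_disjoint ((hmem t).1 ht) ((hmem t').1 ht') hz h1 h2
    · exact fun t ht hu hw => end_mem_of_tight hq hJ h.lt
        (h.haloSet_mem_tightSets ((hmem t).1 ht)) heJ hu hw
    · intro S hSne hS
      choose! y hy using fun t (ht : t ∈ S) => (exists_of_potential_lt ((hS t).1 ht).2.2).2
      -- The cores that receive a positive drop are precisely those at most as far from the head as
      -- the farthest one among them. They are hence the legs of a candidate spider, with threshold
      -- `(y o).dist`.
      obtain ⟨o, hoS, hmax⟩ := Finset.exists_max_image S (fun t => (y t).dist) hSne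
      have hpot : ∀ t ∈ S, pot t (G.head e) = 2 * den * (y t).dist := fun t ht => (hy t ht).2.2
      have hleg : IsLegSet c J D Rl e (y o).dist S := by
        intro t
        rw [hS t, hmem]
        refine and_congr_right fun ht => and_congr_right fun hu => ⟨fun hlt => ?_, ?_⟩
        · have htS : t ∈ S := (hS t).2 ⟨(hmem t).2 ht, hu, hlt⟩
          exact ⟨(exists_of_potential_lt hlt).1, y t, (hy t htS).1, (hy t htS).2.1, hmax t htS⟩
        · rintro ⟨hM, x, hx, hxn, hxd⟩
          have h1 : pot t (G.head e) = min num (2 * den * x.dist) := by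
            rw [← hxn]
            exact potential_eq (fun x hx y hy => table_unique hx hy) hx (hxn ▸ hM)
          have h2 := Nat.mul_le_mul_left (2 * den) hxd
          have h3 := ((hS o).1 hoS).2.2
          have h4 := hpot o hoS
          show pot t (G.head e) < num
          have h3 : pot o (G.head e) < num := h3
          omega
      obtain ⟨hoR, hou, hoM, _⟩ := (hleg o).1 hoS
      have hspmem := mem_spiderList.2 ⟨e, heJ, y o, mem_offers.2
        ⟨o, hoR, hou, hoM, (hy o hoS).1, (hy o hoS).2.1⟩, rfl⟩
      have hineq := hsp _ hspmem
      rw [spider_eq h.nodup hleg fun t ht => ⟨(hy t ht).1, (hy t ht).2.1⟩] at hineq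
      have hsum : ∑ t ∈ S, pot t (G.head e) = 2 * den * ∑ t ∈ S, (y t).dist := by
        rw [Finset.mul_sum]
        exact Finset.sum_congr rfl hpot
      have hsum' : 2 * den * c e + ∑ t ∈ S, pot t (G.head e) =
          2 * ((c e + ∑ t ∈ S, (y t).dist) * den) := by
        rw [hsum]; ring
      show num * S.card ≤ 2 * den * c e + ∑ t ∈ S, pot t (G.head e) ∧ (_ → _ →
        2 * (num * S.card) ≤ 2 * den * c e + ∑ t ∈ S, pot t (G.head e))
      rw [hsum']
      have hineq : num * S.card ≤ weight (termList G) (haloList G c J D Rl) (arcOf G c e) *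
        (c e + ∑ t ∈ S, (y t).dist) * den := hineq
      rw [mul_assoc] at hineq
      constructor
      · refine hineq.trans (Nat.mul_le_mul_right _ ?_)
        rcases weight_cases (termList G) (haloList G c J D Rl) (arcOf G c e) with h | h <;> omega
      · rintro hT ⟨t, ht, hu⟩
        rw [weight_eq_one_iff.2 ⟨hT, t, (hmem t).1 ht, hu⟩, one_mul] at hineq
        omega
  calc (G.k - v) * Rl.toFinset.card * num = ∑ _t ∈ Rl.toFinset, (G.k - v) * num := by
        rw [Finset.sum_const, smul_eq_mul]; ring
    _ ≤ ∑ t ∈ Rl.toFinset, ∑ e ∈ J' \ J, (pot t (G.tail e) - pot t (G.head e)) :=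
        Finset.sum_le_sum fun t ht => hlow t ((hmem t).1 ht)
    _ = ∑ e ∈ J' \ J, ∑ t ∈ Rl.toFinset, (pot t (G.tail e) - pot t (G.head e)) :=
        Finset.sum_comm
    _ ≤ ∑ e ∈ J' \ J, 2 * den * c e := Finset.sum_le_sum hup
    _ = 2 * den * ∑ e ∈ J' \ J, c e := (Finset.mul_sum _ _ _).symm
    _ ≤ 2 * den * ∑ e ∈ J', c e :=
        Nat.mul_le_mul_left _ (Finset.sum_le_sum_of_subset Finset.sdiff_subset)

/-! ### The step -/

/-- What adding the spider with the legs `S` achieves. -/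
theorem cores_drop_of_spider (hq : G.PosEdgesQuasiBipartite) {J J₁ : Finset (Fin G.m)}
    (hJ : G.zeroEdges ⊆ J) {v : ℕ} {D : ℕ → List Arc} {Rl : List ℕ}
    (h : StepData G J v D Rl) (hJ₁ : J ⊆ J₁) {e : Fin G.m} (heJ : e ∉ J) (heJ₁ : e ∈ J₁)
    {θ : ℕ} {S : Finset ℕ} (hS : IsLegSet c J D Rl e θ S) (hSne : S.Nonempty) {y : ℕ → Entry}
    (hy : ∀ t ∈ S, y t ∈ table G c J D t ∧ (y t).node = G.head e)
    (hpath : ∀ t ∈ S, ∀ e' : Fin G.m, (e' : ℕ) ∈ (y t).path → e' ∈ J₁)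
    {R' : Finset ℕ} {C' : ℕ → Set ℕ} (hR' : Cores (tightSets G J₁ v) (termSet G) R' C') :
    S.card + weight (termList G) (haloList G c J D Rl) (arcOf G c e) * R'.card ≤
      weight (termList G) (haloList G c J D Rl) (arcOf G c e) * Rl.toFinset.card := by
  have hge : CutsGe G J₁ v := fun A hA hr => (h.cutsGe A hA hr).trans (cut_mono hJ₁ A)
  have hanti := tightSets_anti h.cutsGe hJ₁
  have hSR : S ⊆ Rl.toFinset := fun t ht => List.mem_toFinset.2 ((hS t).1 ht).1
  -- If the head were outside `A`, the leg of `t` would enter `A` by an added edge, and `A` would no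
  -- longer be tight.
  have hhead : ∀ t ∈ S, ∀ A ∈ tightSets G J₁ v, t ∈ A → (G.head e : ℕ) ∈ A := by
    intro t ht A hA htA
    by_contra hn
    have htR := ((hS t).1 ht).1
    obtain ⟨F, hF⟩ := h.residual t htR
    obtain ⟨e', he', he'J, h1, h2⟩ := exists_entering_path hF htA
      (h.closed_of_tight htR htA (hanti hA)) (hy t ht).1 ((hy t ht).2 ▸ hn)
    exact h2 (not_enters_of_tight h.cutsGe hJ₁ hA (hpath t ht e' he') he'J h1)
  have htail : ∀ t ∈ S, ∀ A ∈ tightSets G J₁ v, t ∈ A → (G.tail e : ℕ) ∈ A :=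
    fun t ht A hA htA => not_enters_of_tight h.cutsGe hJ₁ hA heJ₁ heJ (hhead t ht A hA htA)
  -- `A` contains the tail, which lies outside the halo of `t`, hence also another representative.
  -- Any two such sets contain both ends of `e`, one of which is a terminal.
  obtain ⟨h1, h2⟩ := card_cores_drop h.cores hanti (interClosed_tightSets hge) hR' hSR hSne
    (fun t ht A hA htA => by
      obtain ⟨s, hs, hst⟩ := h.exists_other ((hS t).1 ht).1 htA (hanti hA) (htail t ht A hA htA)
        ((hS t).1 ht).2.1
      exact ⟨s, List.mem_toFinset.2 hs, hst⟩)
    (fun t ht t' ht' A hA B hB htA htB => by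
      rcases end_mem_of_tight hq hJ h.lt (hanti hA) heJ (htail t ht A hA htA)
        (hhead t ht A hA htA) with hz | hz
      · exact ⟨_, ⟨htail t ht A hA htA, htail t' ht' B hB htB⟩, hz⟩
      · exact ⟨_, ⟨hhead t ht A hA htA, hhead t' ht' B hB htB⟩, hz⟩)
  rcases weight_cases (termList G) (haloList G c J D Rl) (arcOf G c e) with hw | hw
  -- With weight one, the tail is a terminal in the halo of some `s`. This `s` is not a leg, and
  -- uncrossing with its halo puts it into every such `A`.
  · obtain ⟨huT, s, hs, hus⟩ := weight_eq_one_iff.1 hw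
    rw [hw, one_mul, one_mul]
    refine h2 fun t ht A hA htA => ⟨s, List.mem_toFinset.2 hs, fun hsS => ((hS s).1 hsS).2.1 hus, ?_⟩
    exact h.mem_of_inter_haloSet hs (hanti hA) (htail t ht A hA htA) hus huT
  · rw [hw]
    exact h1

/-- The labels of the spider with the legs `S`. -/
def spiderLabels (Rl : List ℕ) (e : Fin G.m) (S : Finset ℕ) (y : ℕ → Entry) : List ℕ :=
  (e : ℕ) :: ((Rl.filter fun t => decide (t ∈ S)).map y).flatMap fun x => x.path

theorem mem_spiderLabels {Rl : List ℕ} {e : Fin G.m} {S : Finset ℕ} {y : ℕ → Entry} {t : ℕ}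
    (ht : t ∈ Rl) (htS : t ∈ S) {l : ℕ} (hl : l ∈ (y t).path) : l ∈ spiderLabels Rl e S y :=
  List.mem_cons_of_mem _ (List.mem_flatMap.2
    ⟨y t, List.mem_map.2 ⟨t, by simpa using ⟨ht, htS⟩, rfl⟩, hl⟩)

theorem spiderList_form {J : Finset (Fin G.m)} {v : ℕ} {D : ℕ → List Arc} {Rl : List ℕ}
    (h : StepData G J v D Rl) {sp : Spider} (hsp : sp ∈ spiderList G c J D Rl) :
    ∃ e, e ∉ J ∧ ∃ (θ : ℕ) (S : Finset ℕ) (y : ℕ → Entry),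
      IsLegSet c J D Rl e θ S ∧ S.Nonempty ∧ S ⊆ Rl.toFinset ∧
      (∀ t ∈ S, y t ∈ table G c J D t ∧ (y t).node = G.head e) ∧
      sp = (weight (termList G) (haloList G c J D Rl) (arcOf G c e) *
        (c e + ∑ t ∈ S, (y t).dist), S.card, spiderLabels Rl e S y) := by
  obtain ⟨e, he, o, ho, rfl⟩ := mem_spiderList.1 hsp
  obtain ⟨S, hS, hSR⟩ := exists_legSet J D Rl e o.dist
  choose! y hy using fun t (ht : t ∈ S) => ((hS t).1 ht).2.2.2
  refine ⟨e, he, o.dist, S, y, hS, ?_, hSR, fun t ht => ⟨(hy t ht).1, (hy t ht).2.1⟩,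
    spider_eq h.nodup hS fun t ht => ⟨(hy t ht).1, (hy t ht).2.1⟩⟩
  obtain ⟨t, ht, h1, h2, h3, h4⟩ := mem_offers.1 ho
  exact ⟨t, (hS t).2 ⟨ht, h1, h2, o, h3, h4, le_rfl⟩⟩

/-- Only an inequality: legs may share edges, which are paid for once. -/
theorem newCost_spiderLabels_le {J : Finset (Fin G.m)} {v : ℕ} {D : ℕ → List Arc} {Rl : List ℕ}
    (h : StepData G J v D Rl) (e : Fin G.m) {S : Finset ℕ} (hSR : S ⊆ Rl.toFinset)
    {y : ℕ → Entry} (hy : ∀ t ∈ S, y t ∈ table G c J D t) :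
    newCost c J (spiderLabels Rl e S y) ≤ c e + ∑ t ∈ S, (y t).dist := by
  refine (newCost_cons J e _).trans (Nat.add_le_add_left ?_ _)
  refine (newCost_flatMap_le fun x hx => ?_).trans (le_of_eq ?_)
  · simp only [List.mem_map, List.mem_filter, decide_eq_true_eq] at hx
    obtain ⟨t, ⟨htR, htS⟩, rfl⟩ := hx
    obtain ⟨F, hF⟩ := h.residual t htR
    exact newCost_path_le hF (hy t htS)
  · have h5 := List.sum_toFinset (fun t => (y t).dist) (h.nodup.filter fun t => decide (t ∈ S))
    have h6 : (Rl.filter fun t => decide (t ∈ S)).toFinset = S := by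
      ext t
      simp only [List.mem_toFinset, List.mem_filter, decide_eq_true_eq]
      exact ⟨fun h => h.2, fun h => ⟨List.mem_toFinset.1 (hSR h), h⟩⟩
    rw [h6] at h5
    rw [h5, List.map_map]
    rfl

/-- Without spiders the density hypothesis of `dual_bound` is vacuous and the bound holds for every
`num`. Taking `num` larger than twice the cost of a feasible solution gives a contradiction. -/
theorem spiderList_ne_nil (hq : G.PosEdgesQuasiBipartite) {J J' : Finset (Fin G.m)}
    (hJ : G.zeroEdges ⊆ J) (hJ' : G.Feasible J') {v : ℕ} {D : ℕ → List Arc} {Rl : List ℕ}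
    (h : StepData G J v D Rl) : spiderList G c J D Rl ≠ [] := by
  intro hnil
  have h1 := dual_bound (c := c) hq hJ h hJ' (num := 2 * (∑ e ∈ J', c e) + 1) (den := 1)
    (by simp [hnil])
  obtain ⟨t, ht⟩ := List.exists_mem_of_ne_nil _ h.nonempty
  have hRpos : 0 < Rl.toFinset.card := Finset.card_pos.2 ⟨t, List.mem_toFinset.2 ht⟩
  have h2 : 1 ≤ (G.k - v) * Rl.toFinset.card := Nat.mul_pos (Nat.sub_pos_of_lt h.lt) hRpos
  have h3 := Nat.mul_le_mul_right (2 * (∑ e ∈ J', c e) + 1) h2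
  omega

/-- The edge set `J` together with the edges whose labels occur in a list. -/
def addLabels (J : Finset (Fin G.m)) (ls : List ℕ) : Finset (Fin G.m) :=
  Finset.univ.filter fun e => (e : ℕ) ∈ ls ∨ e ∈ J

theorem mem_addLabels {J : Finset (Fin G.m)} {ls : List ℕ} {e : Fin G.m} :
    e ∈ addLabels J ls ↔ (e : ℕ) ∈ ls ∨ e ∈ J := by
  simp [addLabels]

theorem sum_addLabels_sdiff (J : Finset (Fin G.m)) (ls : List ℕ) :
    ∑ e ∈ addLabels J ls \ J, c e = newCost c J ls := by
  rw [newCost]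
  refine Finset.sum_congr ?_ fun _ _ => rfl
  ext e
  simp only [Finset.mem_sdiff, mem_addLabels, Finset.mem_filter, Finset.mem_univ, true_and]
  tauto

theorem withLabels_addLabels (J : Finset (Fin G.m)) (ls : List ℕ) :
    withLabels (arcsOf G c Finset.univ) (ls ++ labels (arcsOf G c J)) =
      arcsOf G c (addLabels J ls) := by
  rw [withLabels, filter_arcsOf]
  congr 1
  ext e
  have : (arcOf G c e).lab = e := rfl
  simp only [Finset.mem_filter, Finset.mem_univ, true_and, decide_eq_true_eq, mem_addLabels, this,
    List.mem_append, mem_labels_arcsOf]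

/-- The effect of one step of the algorithm. -/
theorem step_spec (hq : G.PosEdgesQuasiBipartite) {J J' : Finset (Fin G.m)}
    (hJ : G.zeroEdges ⊆ J) (hJ' : G.Feasible J') {v : ℕ} {D : ℕ → List Arc} {Rl : List ℕ}
    (h : StepData G J v D Rl) {val : ℕ → ℕ}
    (hsf : stepFlows G.root G.k (termList G) (arcsOf G c J) =
      Rl.map fun t => (t, val t, D t, reach (revAll (D t)) [t])) :
    ∃ J₁, J ⊂ J₁ ∧
      step G.root G.k (termList G) (arcsOf G c Finset.univ) (arcsOf G c J) = arcsOf G c J₁ ∧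
      ∃ w den, 0 < w ∧ den ≤ Rl.toFinset.card ∧ 0 < den ∧
        w * (∑ e ∈ J₁ \ J, c e) * ((G.k - v) * Rl.toFinset.card) ≤ 2 * den * ∑ e ∈ J', c e ∧
        ∀ R' C', Cores (tightSets G J₁ v) (termSet G) R' C' →
          den + w * R'.card ≤ w * Rl.toFinset.card := by
  have hlist : stepSpiders G.root G.k (termList G) (arcsOf G c Finset.univ) (arcsOf G c J) =
      spiderList G c J D Rl := by
    rw [stepSpiders, withoutLabels_arcsOf, hsf, halos_eq, spiderList]
  have hpos : ∀ sp ∈ spiderList G c J D Rl, 0 < sp.2.1 := fun sp hsp => by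
    obtain ⟨e, _, θ, S, y, _, hSne, _, _, rfl⟩ := spiderList_form h hsp
    exact hSne.card_pos
  obtain ⟨sp, hsp, hbest, hmin⟩ := best_spec (spiderList_ne_nil (c := c) hq hJ hJ' h) hpos
  -- The density of the chosen spider itself is used as `num / den`.
  have hdual := dual_bound (c := c) hq hJ h hJ' hmin
  obtain ⟨e, heJ, θ, S, y, hS, hSne, hSR, hy, hspe⟩ := spiderList_form h hsp
  have hJJ₁ : J ⊆ addLabels J (spiderLabels Rl e S y) := fun e' he' => mem_addLabels.2 (.inr he')
  have heJ₁ : e ∈ addLabels J (spiderLabels Rl e S y) :=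
    mem_addLabels.2 (.inl List.mem_cons_self)
  refine ⟨addLabels J (spiderLabels Rl e S y),
    Finset.ssubset_iff_subset_ne.2 ⟨hJJ₁, fun he => heJ (he ▸ heJ₁)⟩, ?_,
    weight (termList G) (haloList G c J D Rl) (arcOf G c e), S.card,
    ?_, Finset.card_le_card hSR, hSne.card_pos, ?_, fun R' C' hR' => ?_⟩
  · rw [step, hlist, hbest, List.headD_cons, hspe, withLabels_addLabels]
  · rcases weight_cases (termList G) (haloList G c J D Rl) (arcOf G c e) with h | h <;> omega
  · rw [hspe] at hdual
    have h2 := newCost_spiderLabels_le (c := c) h e hSR fun t ht => (hy t ht).1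
    rw [sum_addLabels_sdiff]
    refine le_trans ?_ hdual
    rw [mul_comm (_ * _)]
    exact Nat.mul_le_mul_left _ (Nat.mul_le_mul_left _ h2)
  · exact cores_drop_of_spider hq hJ h hJJ₁ heJ heJ₁ hS hSne hy (fun t ht e' he' =>
      mem_addLabels.2 (.inl (mem_spiderLabels ((hS t).1 ht).1 ht he'))) hR'

end RootedAug

namespace RootedAug

variable {G : AugInstance} {c : Fin G.m → ℕ}

/-! ## The greedy analysis -/

theorem harmonic_mono' {a b : ℕ} (h : a ≤ b) : harmonic a ≤ harmonic b := by
  rw [harmonic, harmonic]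
  exact Finset.sum_le_sum_of_subset_of_nonneg (Finset.range_mono h) fun _ _ _ => by positivity

theorem harmonic_nonneg' (a : ℕ) : 0 ≤ harmonic a :=
  Finset.sum_nonneg fun _ _ => by positivity

theorem one_le_harmonic {a : ℕ} (h : 0 < a) : 1 ≤ harmonic a := by
  refine le_trans ?_ (harmonic_mono' (Nat.succ_le_of_lt h))
  simp [harmonic]

/-- Each of the `a - b` terms from `1 / (b + 1)` to `1 / a` is at least `1 / a`. -/
theorem harmonic_sub_ge {a b : ℕ} (h : b ≤ a) : ((a : ℚ) - b) / a ≤ harmonic a - harmonic b := by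
  rcases Nat.eq_zero_or_pos a with rfl | ha
  · simp [Nat.le_zero.1 h]
  have ha' : (0 : ℚ) < a := by exact_mod_cast ha
  rw [harmonic, harmonic, ← Finset.sum_range_add_sum_Ico _ h, add_sub_cancel_left]
  have h1 : ∑ _i ∈ Finset.Ico b a, (a : ℚ)⁻¹ ≤ ∑ i ∈ Finset.Ico b a, ((i + 1 : ℕ) : ℚ)⁻¹ := by
    refine Finset.sum_le_sum fun i hi => ?_
    have hi' : ((i + 1 : ℕ) : ℚ) ≤ a := by exact_mod_cast (Finset.mem_Ico.1 hi).2
    exact inv_anti₀ (by positivity) hi'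
  rw [Finset.sum_const, Nat.card_Ico, nsmul_eq_mul, Nat.cast_sub h] at h1
  rwa [div_eq_mul_inv]

/-- The bound that the greedy algorithm maintains, in terms of the number of cores and the
deficiency. -/
def GreedyInv (G : AugInstance) (c : Fin G.m → ℕ) (opt : ℕ) (K : ℚ) (J : Finset (Fin G.m)) :
    Prop :=
  ((∑ e ∈ J, c e : ℕ) : ℚ) ≤ K ∧ ∀ v D Rl, StepData G J v D Rl →
    ((∑ e ∈ J, c e : ℕ) : ℚ) + 2 * opt * (harmonic Rl.toFinset.card / (G.k - v : ℕ) +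
      harmonic G.terminals.card * harmonic (G.k - v - 1)) ≤ K

theorem StepData.card_le {J : Finset (Fin G.m)} {v : ℕ} {D : ℕ → List Arc} {Rl : List ℕ}
    (h : StepData G J v D Rl) : Rl.toFinset.card ≤ G.terminals.card := by
  refine (Finset.card_le_card (t := G.terminals.image fun t : Fin G.n => (t : ℕ))
    fun t ht => ?_).trans Finset.card_image_le
  obtain ⟨s, hs, rfl⟩ := h.cores.term t ht
  exact Finset.mem_image_of_mem _ hs

theorem StepData.card_pos {J : Finset (Fin G.m)} {v : ℕ} {D : ℕ → List Arc} {Rl : List ℕ}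
    (h : StepData G J v D Rl) : 0 < Rl.toFinset.card := by
  obtain ⟨t, ht⟩ := List.exists_mem_of_ne_nil _ h.nonempty
  exact Finset.card_pos.2 ⟨t, List.mem_toFinset.2 ht⟩

theorem StepData.exists_tight {J : Finset (Fin G.m)} {v : ℕ} {D : ℕ → List Arc} {Rl : List ℕ}
    (h : StepData G J v D Rl) : ∃ A, A ∈ tightSets G J v := by
  obtain ⟨t, ht⟩ := List.exists_mem_of_ne_nil _ h.nonempty
  exact ⟨_, h.cores.mem t (List.mem_toFinset.2 ht)⟩

/-- At deficiency `p` the budget is largest when there are `N` cores, and it is then `H(N) * H(p)`.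
-/
theorem potential_le_of_card {N ν p q : ℕ} (hν : ν ≤ N) (hp : 0 < p) (hpq : p ≤ q) :
    harmonic ν / (p : ℕ) + harmonic N * harmonic (p - 1) ≤ harmonic N * harmonic q := by
  have h1 : harmonic p = harmonic (p - 1) + (p : ℚ)⁻¹ := by
    obtain ⟨p, rfl⟩ := Nat.exists_eq_succ_of_ne_zero hp.ne'
    rw [Nat.succ_sub_one, harmonic_succ]
  calc harmonic ν / (p : ℕ) + harmonic N * harmonic (p - 1) ≤
      harmonic N / p + harmonic N * harmonic (p - 1) := by
        have := harmonic_mono' hν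
        gcongr
    _ = harmonic N * harmonic p := by rw [h1]; ring
    _ ≤ harmonic N * harmonic q :=
        mul_le_mul_of_nonneg_left (harmonic_mono' hpq) (harmonic_nonneg' N)

theorem GreedyInv.init (hv : G.IsValid) (hc : ∀ e, c e = 0 ↔ G.cost e = 0) (opt : ℕ) :
    GreedyInv G c opt (2 * opt * (harmonic G.terminals.card * harmonic (G.k - G.ell)))
      G.zeroEdges := by
  have h0 : ∑ e ∈ G.zeroEdges, c e = 0 :=
    Finset.sum_eq_zero fun e he => (hc e).2 (Finset.mem_filter.1 he).2
  have hN := harmonic_nonneg' G.terminals.card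
  have hK := harmonic_nonneg' (G.k - G.ell)
  refine ⟨by rw [h0]; push_cast; positivity, fun v D Rl h => ?_⟩
  rw [h0, Nat.cast_zero, zero_add]
  refine mul_le_mul_of_nonneg_left (potential_le_of_card h.card_le (Nat.sub_pos_of_lt h.lt) ?_)
    (by positivity)
  -- The zero-cost edges have `ℓ` disjoint paths to `t`, so the first level is at least `ℓ`.
  obtain ⟨A, ⟨_, htA, t, ht, rfl⟩, hr, hA⟩ := h.exists_tight
  have := (hasDisjointPaths_iff (root_ne_of_mem ht)).1 (hv.2.2 t ht) A htA hr
  omega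

/-- If the level stays at `v`, the decrease of `H(ν) / p` pays for the step. If the level rises, the
whole term `H(ν) / p` pays, and `H(N) * H(p - 1)` covers whatever number of cores the new level
starts with. -/
theorem GreedyInv.step (hq : G.PosEdgesQuasiBipartite) {J J' : Finset (Fin G.m)}
    (hJ : G.zeroEdges ⊆ J) (hJ' : G.Feasible J') {K : ℚ}
    (hI : GreedyInv G c (∑ e ∈ J', c e) K J) {v : ℕ} {D : ℕ → List Arc} {Rl : List ℕ}
    (h : StepData G J v D Rl) {val : ℕ → ℕ}
    (hsf : stepFlows G.root G.k (termList G) (arcsOf G c J) =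
      Rl.map fun t => (t, val t, D t, reach (revAll (D t)) [t])) :
    ∃ J₁, J ⊂ J₁ ∧
      RootedAug.step G.root G.k (termList G) (arcsOf G c Finset.univ) (arcsOf G c J) =
        arcsOf G c J₁ ∧ GreedyInv G c (∑ e ∈ J', c e) K J₁ := by
  obtain ⟨J₁, hJJ₁, hstep, w, den, hw, hden, _, hcost, hdrop⟩ := step_spec hq hJ hJ' h hsf
  refine ⟨J₁, hJJ₁, hstep, ?_⟩
  have hpot := hI.2 v D Rl h
  have hν := h.card_pos
  have hp : 0 < G.k - v := Nat.sub_pos_of_lt h.lt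
  have hsum : ∑ e ∈ J₁, c e = ∑ e ∈ J, c e + ∑ e ∈ J₁ \ J, c e := by
    rw [add_comm]; exact (Finset.sum_sdiff hJJ₁.subset).symm
  generalize hopt : ∑ e ∈ J', c e = opt at *
  generalize ∑ e ∈ J₁ \ J, c e = δ at *
  generalize hνe : Rl.toFinset.card = ν at *
  generalize hpe : G.k - v = p at *
  have hp' : (0 : ℚ) < p := by exact_mod_cast hp
  have hν' : (0 : ℚ) < ν := by exact_mod_cast hν
  have hopt0 : (0 : ℚ) ≤ opt := Nat.cast_nonneg _
  have hNp : 0 ≤ harmonic G.terminals.card * harmonic (p - 1) :=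
    mul_nonneg (harmonic_nonneg' _) (harmonic_nonneg' _)
  -- Here `g` is the number of cores to which the step is charged: the actual drop if the level
  -- stays, and all `ν` for the bound that is used when the level rises.
  have hδ : ∀ g : ℕ, den ≤ w * g → (δ : ℚ) ≤ 2 * opt * (g / ν / p) := by
    intro g hg
    have h1 : w * (δ * (p * ν)) ≤ w * (2 * g * opt) := by
      calc w * (δ * (p * ν)) = w * δ * (p * ν) := by ring
        _ ≤ 2 * den * opt := hcost
        _ ≤ 2 * (w * g) * opt := by gcongr
        _ = w * (2 * g * opt) := by ring
    have h2 : ((δ * (p * ν) : ℕ) : ℚ) ≤ (2 * g * opt : ℕ) :=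
      Nat.cast_le.2 (Nat.le_of_mul_le_mul_left h1 hw)
    push_cast at h2
    rw [div_div, ← mul_div_assoc, le_div_iff₀ (by positivity)]
    linarith
  have hδ1 : (δ : ℚ) ≤ 2 * opt * (harmonic ν / p) := by
    refine (hδ ν (hden.trans (Nat.le_mul_of_pos_left _ hw))).trans ?_
    rw [div_self hν'.ne']
    have := one_le_harmonic hν
    gcongr
  rw [GreedyInv, hsum]
  push_cast
  constructor
  · have : 0 ≤ 2 * opt * (harmonic G.terminals.card * harmonic (p - 1)) := by positivity
    rw [mul_add] at hpot
    push_cast at hpot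
    linarith
  · intro v₁ D₁ Rl₁ h₁
    obtain ⟨A, hA1, hA2, hA3⟩ := h₁.exists_tight
    have hvv : v ≤ v₁ := hA3 ▸ (h.cutsGe A hA1 hA2).trans (cut_mono hJJ₁.subset A)
    rcases hvv.eq_or_lt with rfl | hlt
    · have hdrop' := hdrop _ _ h₁.cores
      have hle : Rl₁.toFinset.card ≤ ν := by
        by_contra hn
        have := Nat.mul_le_mul_left w (not_le.1 hn).le
        have : w * ν < w * Rl₁.toFinset.card := Nat.mul_lt_mul_of_pos_left (not_le.1 hn) hw
        omega
      have h1 := hδ (ν - Rl₁.toFinset.card) (by rw [Nat.mul_sub]; omega)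
      rw [Nat.cast_sub hle] at h1
      have h2 : (((ν : ℚ) - Rl₁.toFinset.card) / ν) / p ≤
          (harmonic ν - harmonic Rl₁.toFinset.card) / p := by
        have := harmonic_sub_ge hle
        gcongr
      have h3 : 2 * (opt : ℚ) * ((((ν : ℚ) - Rl₁.toFinset.card) / ν) / p) ≤
          2 * opt * ((harmonic ν - harmonic Rl₁.toFinset.card) / p) := by gcongr
      rw [sub_div (harmonic ν), mul_sub] at h3
      rw [hpe]
      rw [mul_add] at hpot ⊢
      push_cast at hpot
      linarith
    · have hp1 : 0 < G.k - v₁ := Nat.sub_pos_of_lt h₁.lt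
      have h1 := potential_le_of_card h₁.card_le hp1 (q := p - 1) (by omega)
      have h2 := mul_le_mul_of_nonneg_left h1 (show (0 : ℚ) ≤ 2 * opt by positivity)
      rw [mul_add] at hpot
      push_cast at hpot
      linarith

theorem step_of_nil {r k : ℕ} {T : List ℕ} {J : Finset (Fin G.m)}
    (h : stepFlows r k T (arcsOf G c J) = []) :
    step r k T (arcsOf G c Finset.univ) (arcsOf G c J) = arcsOf G c J := by
  have h1 : stepSpiders r k T (arcsOf G c Finset.univ) (arcsOf G c J) = [] := by
    rw [stepSpiders, h]
    simp [spiders, halos, offers]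
  have h2 : best [] = [] := rfl
  rw [step, h1, h2, List.headD_nil, withLabels_addLabels]
  congr 1
  ext e
  simp [mem_addLabels]

/-- As long as `J` is infeasible a round adds an edge, so as many rounds as there are edges suffice.
The invariant is kept for all feasible `J'` at once, since the algorithm does not know the optimum.
-/
theorem greedy_spec (hv : G.IsValid) (hq : G.PosEdgesQuasiBipartite)
    (hc : ∀ e, c e = 0 ↔ G.cost e = 0) {J₀ : Finset (Fin G.m)} (hJ₀ : G.Feasible J₀) :
    ∃ J, greedy G.root G.k (termList G) (arcsOf G c Finset.univ) = arcsOf G c J ∧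
      G.Feasible J ∧ ∀ J', G.Feasible J' → ((∑ e ∈ J, c e : ℕ) : ℚ) ≤
        2 * (∑ e ∈ J', c e : ℕ) * (harmonic G.terminals.card * harmonic (G.k - G.ell)) := by
  have key : ∀ l : List Arc, ∃ J, l.foldl (fun EJ _ => step G.root G.k (termList G)
      (arcsOf G c Finset.univ) EJ) (arcsOf G c G.zeroEdges) = arcsOf G c J ∧ G.zeroEdges ⊆ J ∧
      (G.Feasible J ∨ l.length ≤ J.card) ∧ ∀ J', G.Feasible J' →
        GreedyInv G c (∑ e ∈ J', c e) (2 * (∑ e ∈ J', c e : ℕ) *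
          (harmonic G.terminals.card * harmonic (G.k - G.ell))) J := by
    intro l
    induction l using List.reverseRecOn with
    | nil =>
      exact ⟨G.zeroEdges, rfl, Finset.Subset.refl _, .inr (Nat.zero_le _),
        fun J' _ => GreedyInv.init hv hc _⟩
    | append_singleton l a ih =>
      obtain ⟨J, he, hz, hl, hI⟩ := ih
      simp only [List.foldl_append, List.foldl_cons, List.foldl_nil, he]
      rcases stepFlows_spec (c := c) J with ⟨h1, h2⟩ | ⟨v, D, Rl, hD, val, hsf⟩
      · exact ⟨J, step_of_nil h1, hz, .inl h2, hI⟩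
      · obtain ⟨J₁, hJJ₁, hstep, _⟩ := (hI J₀ hJ₀).step hq hz hJ₀ hD hsf
        have hnf : ¬ G.Feasible J := fun hf => by
          obtain ⟨A, hA1, hA2, hA3⟩ := hD.exists_tight
          have := feasible_iff.1 hf A hA1 hA2
          have := hD.lt
          omega
        refine ⟨J₁, hstep, hz.trans hJJ₁.subset, .inr ?_, fun J' hJ' => ?_⟩
        · have h1 := hl.resolve_left hnf
          have h2 := Finset.card_lt_card hJJ₁
          simp only [List.length_append, List.length_singleton]
          omega
        · obtain ⟨J₂, _, hstep₂, hI₂⟩ := (hI J' hJ').step hq hz hJ' hD hsf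
          -- The step is deterministic, and a list of arcs determines its edge set; so the set
          -- obtained for `J'` is the one obtained for `J₀`.
          have : J₁ = J₂ := by
            have h3 : arcsOf G c J₁ = arcsOf G c J₂ := hstep.symm.trans hstep₂
            ext e
            rw [← mem_labels_arcsOf (c := c), h3, mem_labels_arcsOf]
          rwa [this]
  have hinit : (arcsOf G c Finset.univ).filter (fun a => decide (a.len = 0)) =
      arcsOf G c G.zeroEdges := by
    rw [filter_arcsOf]
    congr 1
    ext e
    have : (arcOf G c e).len = c e := rfl
    simp [this, AugInstance.zeroEdges, hc]
  obtain ⟨J, he, hz, hl, hI⟩ := key (arcsOf G c Finset.univ)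
  refine ⟨J, by rw [greedy, hinit, he], ?_, fun J' hJ' => (hI J' hJ').1⟩
  by_contra hnf
  have h1 := hl.resolve_left hnf
  rw [length_arcsOf] at h1
  rcases stepFlows_spec (c := c) J with ⟨_, h2⟩ | ⟨v, D, Rl, hD, val, hsf⟩
  · exact hnf h2
  · obtain ⟨J₁, hJJ₁, _⟩ := (hI J₀ hJ₀).step hq hz hJ₀ hD hsf
    have h2 := Finset.card_lt_card hJJ₁
    have h3 := Finset.card_le_univ J₁
    simp only [Finset.card_univ] at h1
    omega

/-! ## The input -/

/-- The edges of an instance as they occur in its encoding. -/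
def rawEdges (G : AugInstance) : List (ℕ × ℕ × ℕ × ℕ × ℕ) :=
  (List.finRange G.m).map fun e =>
    ((G.tail e : ℕ), (G.head e : ℕ), (G.cost e).num, (G.cost e).den, 0)

/-- The encoded instance. -/
def rawInput (G : AugInstance) : RawInput :=
  ((List.finRange G.n).map fun v : Fin G.n => (v : ℕ), G.root, termList G, rawEdges G, G.ell, G.k, 0)

theorem bind_pure_val {n : ℕ} (l : List (Fin n)) :
    (l >>= fun a => pure (Fin.val a)) = List.map Fin.val l := by
  induction l with
  | nil => rfl
  | cons a l ih => exact congrArg (List.cons _) ih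

/-- Lists end in `num 0`, so a nested tuple whose last entry is 0 is encoded like the list of its
other entries. -/
theorem enc_rawInput (G : AugInstance) : enc (rawInput G) = G.encode := by
  have h1 : enc ((List.finRange G.n).map fun v : Fin G.n => (v : ℕ)) =
      Data.ofList ((List.finRange G.n).map fun v => Data.num v) := by
    rw [bind_pure_val, List.map_map]
    show Data.ofList (List.map enc (List.map _ _)) = _
    rw [List.map_map]; rfl
  have h2 : enc (termList G) = Data.ofList
      (((List.finRange G.n).filter (· ∈ G.terminals)).map fun v => Data.num v) := by
    rw [bind_pure_val, List.map_map]
    show Data.ofList (List.map enc (List.map _ _)) = _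
    rw [List.map_map]; rfl
  have h3 : enc (rawEdges G) = Data.ofList ((List.finRange G.m).map fun e => Data.ofList
        [Data.num (G.tail e), Data.num (G.head e),
          Data.num (G.cost e).num, Data.num (G.cost e).den]) := by
    show Data.ofList (List.map enc (List.map _ _)) = _
    rw [List.map_map]; rfl
  rw [rawInput, AugInstance.encode, enc_prod, enc_prod, enc_prod, enc_prod, h1, h2, h3]
  rfl

/-- The product of the denominators of all costs. -/
def costScale (G : AugInstance) : ℕ := ((rawEdges G).map fun x => x.2.2.2.1).prod

/-- The scaled costs. -/
def scaledCost (G : AugInstance) (e : Fin G.m) : ℕ :=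
  (G.cost e).num * (costScale G / (G.cost e).den)

theorem costScale_pos (G : AugInstance) : 0 < costScale G := by
  refine List.prod_pos fun x hx => ?_
  simp only [rawEdges, List.map_map, List.mem_map] at hx
  obtain ⟨e, _, rfl⟩ := hx
  exact (G.cost e).den_pos

/-- Each denominator divides the product of all of them, so the natural-number division is exact. -/
theorem scaledCost_eq (G : AugInstance) (e : Fin G.m) :
    (scaledCost G e : ℚ) = (G.cost e : ℚ) * costScale G := by
  have hdvd : (G.cost e).den ∣ costScale G := by
    refine List.dvd_prod ?_
    simp only [rawEdges, List.map_map, List.mem_map]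
    exact ⟨e, List.mem_finRange e, rfl⟩
  have hden : ((G.cost e).den : ℚ) ≠ 0 := by exact_mod_cast (G.cost e).den_pos.ne'
  rw [scaledCost, Nat.cast_mul, Nat.cast_div hdvd hden]
  have : (G.cost e : ℚ) = (G.cost e).num / (G.cost e).den := by
    conv_lhs => rw [← NNRat.num_div_den (G.cost e)]
    push_cast
    rfl
  rw [this]
  field_simp

theorem scaledCost_eq_zero (G : AugInstance) (e : Fin G.m) :
    scaledCost G e = 0 ↔ G.cost e = 0 := by
  have h := scaledCost_eq G e
  have hP : (costScale G : ℚ) ≠ 0 := by exact_mod_cast (costScale_pos G).ne'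
  rw [← Nat.cast_eq_zero (R := ℚ), h, mul_eq_zero, or_iff_left hP]
  exact NNRat.coe_eq_zero

theorem scaledArcs_rawEdges (G : AugInstance) :
    scaledArcs (rawEdges G) = arcsOf G (scaledCost G) Finset.univ := by
  rw [scaledArcs, scaledArcs_foldl fun e =>
    e.2.2.1 * (((rawEdges G).map fun x => x.2.2.2.1).prod / e.2.2.2.1)]
  refine List.ext_getElem (by simp [rawEdges, arcsOf]) fun i h1 h2 => ?_
  simp [rawEdges, arcsOf, arcOf, scaledCost, costScale]

/-- The scaling multiplies the cost of every edge set by the same positive factor, which cancels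
from the ratio; `harmonic_le_one_add_log` then replaces `H(|T|)`. -/
theorem approximate_spec (G : AugInstance) (hv : G.IsValid) (hq : G.PosEdgesQuasiBipartite)
    {J₀ : Finset (Fin G.m)} (hJ₀ : G.Feasible J₀) :
    ∃ J, G.Represents (enc (approximate (rawInput G))) J ∧ G.Feasible J ∧
      ∀ J', G.Feasible J' → (G.totalCost J : ℝ) ≤
        2 * (harmonic (G.k - G.ell) : ℝ) * (1 + Real.log (G.terminals.card : ℝ)) *
          (G.totalCost J' : ℝ) := by
  obtain ⟨J, hg, hJ, hcost⟩ := greedy_spec hv hq (scaledCost_eq_zero G) hJ₀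
  refine ⟨J, ⟨(List.finRange G.m).filter fun e => decide (e ∈ J), by ext; simp, ?_⟩, hJ,
    fun J' hJ' => ?_⟩
  · have : approximate (rawInput G) = labels (arcsOf G (scaledCost G) J) := by
      rw [← hg, ← scaledArcs_rawEdges]
      rfl
    rw [this, labels_arcsOf]
    rw [bind_pure_val, List.map_map]
    show Data.ofList (List.map enc (List.map _ _)) = _
    rw [List.map_map]
    rfl
  · have htot : ∀ I : Finset (Fin G.m), ((∑ e ∈ I, scaledCost G e : ℕ) : ℝ) =
        (G.totalCost I : ℝ) * costScale G := by
      intro I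
      have h1 : ((∑ e ∈ I, scaledCost G e : ℕ) : ℚ) = ((G.totalCost I : ℚ≥0) : ℚ) * costScale G := by
        rw [AugInstance.totalCost, NNRat.cast_sum, Finset.sum_mul, Nat.cast_sum]
        exact Finset.sum_congr rfl fun e _ => scaledCost_eq G e
      exact_mod_cast congrArg (Rat.cast : ℚ → ℝ) h1
    have h1 : ((∑ e ∈ J, scaledCost G e : ℕ) : ℝ) ≤ 2 * ((∑ e ∈ J', scaledCost G e : ℕ) : ℝ) *
        ((harmonic G.terminals.card : ℝ) * (harmonic (G.k - G.ell) : ℝ)) := by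
      exact_mod_cast hcost J' hJ'
    rw [htot, htot] at h1
    have hP : (0 : ℝ) < costScale G := by exact_mod_cast costScale_pos G
    have h2 : (G.totalCost J : ℝ) ≤ 2 * (G.totalCost J' : ℝ) *
        ((harmonic G.terminals.card : ℝ) * (harmonic (G.k - G.ell) : ℝ)) := by
      refine le_of_mul_le_mul_right (h1.trans_eq ?_) hP
      ring
    have h3 := harmonic_le_one_add_log G.terminals.card
    have h4 : (0 : ℝ) ≤ (harmonic (G.k - G.ell) : ℝ) := by exact_mod_cast harmonic_nonneg' _
    have h5 : (0 : ℝ) ≤ (G.totalCost J' : ℝ) := by positivity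
    calc (G.totalCost J : ℝ) ≤ 2 * (G.totalCost J' : ℝ) *
          ((harmonic G.terminals.card : ℝ) * (harmonic (G.k - G.ell) : ℝ)) := h2
      _ ≤ 2 * (G.totalCost J' : ℝ) *
          ((1 + Real.log (G.terminals.card : ℝ)) * (harmonic (G.k - G.ell) : ℝ)) := by gcongr
      _ = _ := by ring

end RootedAug

theorem mainTheorem2 :
    AdmitsApproxRatio (fun G => G.IsValid ∧ G.PosEdgesQuasiBipartite)
      (fun G => 2 * (harmonic (G.k - G.ell) : ℝ) * (1 + Real.log (G.terminals.card : ℝ))) := by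
  obtain ⟨p, b, ⟨q, hq⟩, h⟩ := RootedAug.polyTime_approximate
  refine ⟨p, q, fun G hG => ?_⟩
  obtain ⟨t, ht, hrun⟩ := h (RootedAug.rawInput G)
  rw [RootedAug.enc_rawInput] at hrun
  refine ⟨_, t, hrun, ht.trans ?_, fun ⟨J, hJ⟩ => RootedAug.approximate_spec G hG.1 hG.2 hJ⟩
  have := hq (RootedAug.rawInput G)
  rwa [encSize, RootedAug.enc_rawInput] at this
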